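/- An \emph{edge-labeling} of a finite simple graph $G$ is a function $\lambda\colon E(G)\to\mathbb{R}$; a path is \emph{increasing} if the sequence of the labels of its edges is non-decreasing. The labeling is \emph{good} if, for every ordered pair $(x,y)$ of vertices, there are no two distinct increasing paths from $x$ to $y$, and $G$ is \emph{good} if it has a good edge-labeling. The problem \textsc{Good Edge-Labeling} (\textsc{GEL}) asks whether a given graph is good. A \emph{star-forest modulator} of $G$ is a set $X\subseteq V(G)$ such that every connected component of $G\setminus X$ is a star $K_{1,t}$ with $t\ge 0$. \textbf{Theorem.} Given an $n$-vertex graph $G$ and a star-forest modulator $X$ of $G$ of size $k$, \textsc{GEL} can be solved in time $2^{\mathcal{O}(k^4\log k)}\cdot n^{\mathcal{O}(1)}$. That is, there are an algorithm and a constant $c$ such that, for every graph $G$ on $n$ vertices (given by its adjacency matrix) and every star-forest modulator $X$ of $G$ (given by its characteristic vector), with $k=|X|$, the algorithm halts after at most $c\cdot 2^{c\,k^4\log_2 k}\cdot (n+1)^c$ steps and correctly decides whether $G$ is good (here $0^4\log_2 0:=0$). Algorithms are programs of a random access machine on natural numbers, with registers, finitely many indirectly addressed arrays, conditionals and while-loops,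 whose unit-cost arithmetic operations are addition and truncated subtraction. -/

import Mathlib

/-! ## Good edge-labelings -/

/-- A walk is increasing with respect to an edge-labeling `lam : E(G) → ℝ` if the sequence of the
labels of its edges, in the order in which they are traversed, is non-decreasing. -/
def IsIncreasing {V : Type*} {G : SimpleGraph V} (lam : G.edgeSet → ℝ) {x y : V}
    (p : G.Walk x y) : Prop :=
  (p.edges.attach.map fun e => lam ⟨e.1, p.edges_subset_edgeSet e.2⟩).Pairwise (· ≤ ·)

/-- An edge-labeling is good if, for every ordered pair `(x, y)` of vertices, there are no two
distinct increasing paths from `x` to `y`. -/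
def IsGoodLabeling {V : Type*} (G : SimpleGraph V) (lam : G.edgeSet → ℝ) : Prop :=
  ∀ (x y : V) (p q : G.Walk x y), p.IsPath → q.IsPath →
    IsIncreasing lam p → IsIncreasing lam q → p = q

/-- A graph is good if it admits a good edge-labeling. -/
def IsGoodGraph {V : Type*} (G : SimpleGraph V) : Prop :=
  ∃ lam : G.edgeSet → ℝ, IsGoodLabeling G lam

/-! ## Star-forest modulators -/

/-- A forest of stars: every connected component is a star, that is, a graph `K_{1,t}`, `t ≥ 0`
(an isolated vertex is a star without leaves). -/
def IsStarForest {V : Type*} (G : SimpleGraph V) : Prop :=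
  ∀ C : G.ConnectedComponent, ∃ c : C, C.toSimpleGraph = SimpleGraph.starGraph c

/-- `X` is a star-forest modulator of `G` if `G ∖ X` is a forest of stars. -/
def IsStarForestModulator {V : Type*} (G : SimpleGraph V) (X : Finset V) : Prop :=
  IsStarForest (G.induce {v | v ∉ X})

/-! ## Random access machines

A machine has registers `0, 1, 2, …` and arrays `0, 1, 2, …`, each with cells `0, 1, 2, …`; every
register and every cell holds a natural number. A program is a fixed finite text, so it names only
finitely many registers and arrays, but cells are addressed indirectly, by computed values. The
arithmetic operations are addition and truncated subtraction, at unit cost; there is no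
multiplication, so that the bit-length of the stored numbers grows at most linearly with the time,
and the model is polynomially equivalent to Turing machines. -/

/-- The state of the memory. -/
structure RamState where
  reg : ℕ → ℕ
  arr : ℕ → ℕ → ℕ

/-- Assignment of the value `v` to the register `i`. -/
def RamState.setReg (s : RamState) (i v : ℕ) : RamState :=
  { s with reg := Function.update s.reg i v }

/-- Assignment of the value `v` to the cell `j` of the array `a`. -/
def RamState.setArr (s : RamState) (a j v : ℕ) : RamState :=
  { s with arr := Function.update s.arr a (Function.update (s.arr a) j v) }

/-- Expressions: constants, registers, the cell of an array whose index is the value of an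
expression, sums, and truncated differences. -/
inductive RamExpr where
  | const (c : ℕ)
  | reg (i : ℕ)
  | arr (a : ℕ) (e : RamExpr)
  | add (e f : RamExpr)
  | sub (e f : RamExpr)

/-- The value of an expression. -/
def RamExpr.eval (s : RamState) : RamExpr → ℕ
  | const c => c
  | reg i => s.reg i
  | arr a e => s.arr a (e.eval s)
  | add e f => e.eval s + f.eval s
  | sub e f => e.eval s - f.eval s

/-- The time taken by the evaluation of an expression: one unit for each operation. -/
def RamExpr.cost : RamExpr → ℕ
  | const _ => 1
  | reg _ => 1
  | arr _ e => e.cost + 1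
  | add e f => e.cost + f.cost + 1
  | sub e f => e.cost + f.cost + 1

/-- Programs. A test succeeds if the value of the expression is not zero. -/
inductive RamProg where
  | skip
  | setReg (i : ℕ) (e : RamExpr)
  | setArr (a : ℕ) (e f : RamExpr)
  | seq (p q : RamProg)
  | ite (e : RamExpr) (p q : RamProg)
  | loop (e : RamExpr) (p : RamProg)

/-- `Exec p s t s'`: the program `p`, started in the state `s`, halts after exactly `t` units of
time in the state `s'`. (`loop e p` is the loop "while `e` is not zero do `p`".) -/
inductive RamProg.Exec : RamProg → RamState → ℕ → RamState → Prop
  | skip (s : RamState) : Exec skip s 1 s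
  | setReg (i : ℕ) (e : RamExpr) (s : RamState) :
      Exec (setReg i e) s (e.cost + 1) (s.setReg i (e.eval s))
  | setArr (a : ℕ) (e f : RamExpr) (s : RamState) :
      Exec (setArr a e f) s (e.cost + f.cost + 1) (s.setArr a (e.eval s) (f.eval s))
  | seq {p q : RamProg} {s s' s'' : RamState} {t t' : ℕ} :
      Exec p s t s' → Exec q s' t' s'' → Exec (seq p q) s (t + t') s''
  | ite_true {e : RamExpr} {p q : RamProg} {s s' : RamState} {t : ℕ} :
      e.eval s ≠ 0 → Exec p s t s' → Exec (ite e p q) s (e.cost + t + 1) s'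
  | ite_false {e : RamExpr} {p q : RamProg} {s s' : RamState} {t : ℕ} :
      e.eval s = 0 → Exec q s t s' → Exec (ite e p q) s (e.cost + t + 1) s'
  | loop_done {e : RamExpr} {p : RamProg} {s : RamState} :
      e.eval s = 0 → Exec (loop e p) s (e.cost + 1) s
  | loop_step {e : RamExpr} {p : RamProg} {s s' s'' : RamState} {t t' : ℕ} :
      e.eval s ≠ 0 → Exec p s t s' → Exec (loop e p) s' t' s'' →
      Exec (loop e p) s (e.cost + t + t' + 1) s''

/-- The machine is deterministic: the running time and the final state are determined by the
program and the initial state. -/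
theorem RamProg.Exec.deterministic {p : RamProg} {s s₁ s₂ : RamState} {t₁ t₂ : ℕ}
    (h₁ : p.Exec s t₁ s₁) (h₂ : p.Exec s t₂ s₂) : t₁ = t₂ ∧ s₁ = s₂ := by
  induction h₁ generalizing t₂ s₂ with
  | skip | setReg | setArr => cases h₂; exact ⟨rfl, rfl⟩
  | seq _ _ ih ih' =>
    cases h₂ with
    | seq h h' => obtain ⟨rfl, rfl⟩ := ih h; obtain ⟨rfl, rfl⟩ := ih' h'; exact ⟨rfl, rfl⟩
  | ite_true he _ ih =>
    cases h₂ with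
    | ite_true _ h => obtain ⟨rfl, rfl⟩ := ih h; exact ⟨rfl, rfl⟩
    | ite_false he' _ => exact absurd he' he
  | ite_false he _ ih =>
    cases h₂ with
    | ite_true he' _ => exact absurd he he'
    | ite_false _ h => obtain ⟨rfl, rfl⟩ := ih h; exact ⟨rfl, rfl⟩
  | loop_done he =>
    cases h₂ with
    | loop_done => exact ⟨rfl, rfl⟩
    | loop_step he' => exact absurd he he'
  | loop_step he _ _ ih ih' =>
    cases h₂ with
    | loop_done he' => exact absurd he' he
    | loop_step _ h h' => obtain ⟨rfl, rfl⟩ := ih h; obtain ⟨rfl, rfl⟩ := ih' h'; exact ⟨rfl, rfl⟩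

/-! ## The input -/

open Classical in
/-- The initial state for a graph `G` on the vertices `0, …, n - 1` and a set `X` of vertices:
register `0` holds `n`, array `0` holds the adjacency matrix of `G`, row by row (the entry `(i, j)`
stands in cell `i * n + j`), and array `1` holds the characteristic vector of `X`. Everything else
is zero. -/
noncomputable def graphInput {n : ℕ} (G : SimpleGraph (Fin n)) (X : Finset (Fin n)) : RamState where
  reg i := if i = 0 then n else 0
  arr a m :=
    if (a = 0 ∧ ∃ i j : Fin n, G.Adj i j ∧ m = (i : ℕ) * n + j) ∨
        (a = 1 ∧ ∃ i : Fin n, i ∈ X ∧ m = (i : ℕ)) then 1 else 0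

/-!
A labeling is replaced by the order in which it sorts the edges. For a list `l` of edges, the
product `walkCount l` of the elementary matrices of its entries counts, for all `u` and `v`, the
walks from `u` to `v` that use their edges in the order of `l`, and a graph is good if and only if
its edges can be listed so that all entries of this product are at most one
(`isGoodGraph_iff_exists_isGoodOrder`).

A good graph has neither a triangle nor a `K_{2,3}` (`IsGoodGraph.fewCommonNeighbors`). For graphs
without them, a kernel with `O(k ^ 3)` edges, where `k = |X|`, decides. Call a vertex outside `X`
special if it has two neighbors in `X`; since two vertices have at most two common neighbors, there
are `O(k ^ 2)` special vertices. The core consists of `X` and of the vertices of degree at least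
two in the stars with a special vertex. In the other stars, the ordinary ones, each vertex has at
most one neighbor in `X`. Let `c` be the center of an ordinary star, `z` its neighbor in `X`, and
call `c` doubled at `x ∈ X` if two leaves of `c` are adjacent to `x`; then `c` and `x` are opposite
in a four-cycle. In a good order, one of the two paths between them is increasing from `x` to `c`,
and the other one from `c` to `x`. Hence no increasing walk may lead from `x` to `z` before the
edge `zc`, nor from `z` to `x` after it (`IsGoodOrder.exists_split_of_isWitness`). Conversely, if
the edge `zc` is at a position with this property for every `x` at which `c` is doubled, then all
leaves of `c` can be added, with one edge at the beginning and one at the end of the list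
(`IsGoodOrder.insert_leaf`).

Such a position exists for all these `x` as soon as there is, for each two of them, `x` and `y`,
one before which no walk leads from `x` to `z` and after which none leads from `z` to `y`
(`exists_common_split`). For this it is enough to keep, for every triple `(z, x, y)` in `X`, one
center `c` adjacent to `z` and doubled at `x` and `y`, with the leaves that witness it. So the
kernel is made of the core and of these `O(k ^ 3)` witnesses: it is good if and only if the graph
is (`IsGoodOrder.restrict`, `IsStarCenter.exists_isGoodOrder_of_kernel`), and it has at most
`53 * k ^ 3` edges (`IsStarCenter.card_kernel_edges_le`).

The kernel is definable in first-order logic over the ordered graph, with a formula that does not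
depend on the input, so a program that evaluates formulas by nested loops lists its edges in
polynomial time (`Fml.runs_compile`, `runs_edgesProg`). If there are `m` of them, then the program
runs through the `m ^ m = 2 ^ O(k ^ 3 * log k)` sequences of `m` edges and computes `walkCount` for
each (`runs_searchProg`). The centers of the stars are used in proofs only: the program never
computes them.
-/

set_option linter.unusedSectionVars false

/-! ### Counting increasing walks by matrix products -/

section WalkCount

variable {V : Type*} [Fintype V] [DecidableEq V]

/-- The elementary matrix of an edge `e`: multiplication by it on the right extends walks by `e`. -/
def edgeMatrix (e : V × V) : Matrix V V ℕ :=
  1 + Matrix.single e.1 e.2 1 + Matrix.single e.2 e.1 1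

/-- The entry `(u, v)` counts the walks from `u` to `v` whose edges form a subsequence of `l`. -/
def walkCount (l : List (V × V)) : Matrix V V ℕ := (l.map edgeMatrix).prod

@[simp] theorem walkCount_nil : walkCount ([] : List (V × V)) = 1 := rfl

theorem walkCount_cons (e : V × V) (l : List (V × V)) :
    walkCount (e :: l) = edgeMatrix e * walkCount l := by simp [walkCount]

theorem walkCount_append (l₁ l₂ : List (V × V)) :
    walkCount (l₁ ++ l₂) = walkCount l₁ * walkCount l₂ := by simp [walkCount]

theorem single_mul_apply_ite (a b : V) (M : Matrix V V ℕ) (u v : V) :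
    (Matrix.single a b 1 * M : Matrix V V ℕ) u v = if u = a then M b v else 0 := by
  split_ifs with h
  · subst h; simp
  · simp [h]

theorem walkCount_cons_apply (e : V × V) (l : List (V × V)) (u v : V) :
    walkCount (e :: l) u v = walkCount l u v + (if u = e.1 then walkCount l e.2 v else 0)
      + (if u = e.2 then walkCount l e.1 v else 0) := by
  rw [walkCount_cons, edgeMatrix, Matrix.add_mul, Matrix.add_mul, Matrix.one_mul, Matrix.add_apply,
    Matrix.add_apply, single_mul_apply_ite, single_mul_apply_ite]

theorem walkCount_concat_apply (e : V × V) (l : List (V × V)) (u v : V) :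
    walkCount (l ++ [e]) u v = walkCount l u v + (if v = e.2 then walkCount l u e.1 else 0)
      + (if v = e.1 then walkCount l u e.2 else 0) := by
  have key : ∀ a b : V, (walkCount l * Matrix.single a b 1 : Matrix V V ℕ) u v =
      if v = b then walkCount l u a else 0 := by
    intro a b
    split_ifs with h
    · subst h; simp
    · simp [h]
  rw [walkCount_append, walkCount_cons, walkCount_nil, mul_one, edgeMatrix, Matrix.mul_add,
    Matrix.mul_add, Matrix.mul_one, Matrix.add_apply, Matrix.add_apply, key, key]

theorem walkCount_insert (l₁ l₂ : List (V × V)) (a b u v : V) :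
    walkCount (l₁ ++ (a, b) :: l₂) u v = walkCount (l₁ ++ l₂) u v
      + walkCount l₁ u a * walkCount l₂ b v + walkCount l₁ u b * walkCount l₂ a v := by
  have key : ∀ a b : V, (walkCount l₁ * (Matrix.single a b 1 * walkCount l₂) : Matrix V V ℕ) u v =
      walkCount l₁ u a * walkCount l₂ b v := by
    intro a b
    rw [Matrix.mul_apply, Finset.sum_eq_single a]
    · simp
    · intro x _ hx; simp [hx]
    · simp
  rw [walkCount_append, walkCount_cons, walkCount_append, edgeMatrix, Matrix.add_mul,
    Matrix.add_mul, Matrix.one_mul, Matrix.mul_add, Matrix.mul_add, Matrix.add_apply, Matrix.add_apply,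
    key, key]

theorem one_le_walkCount_self (l : List (V × V)) (u : V) : 1 ≤ walkCount l u u := by
  induction l with
  | nil => simp
  | cons e l ih => rw [walkCount_cons_apply]; omega

theorem walkCount_mono {l₁ l₂ : List (V × V)} (h : l₁.Sublist l₂) (u v : V) :
    walkCount l₁ u v ≤ walkCount l₂ u v := by
  induction h generalizing u with
  | slnil => exact le_rfl
  | cons e _ ih => rw [walkCount_cons_apply]; have := ih u; omega
  | cons_cons e _ ih =>
    rw [walkCount_cons_apply, walkCount_cons_apply]
    gcongr
    · exact ih u
    · split_ifs
      · exact ih _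
      · exact le_rfl
    · split_ifs
      · exact ih _
      · exact le_rfl

/-- A nontrivial closed walk and the trivial one are two walks. -/
theorem two_le_walkCount_self (l₁ l₂ : List (V × V)) {u w : V} (huw : u ≠ w)
    (h₁ : walkCount l₁ u w ≠ 0) (h₂ : walkCount l₂ w u ≠ 0) : 2 ≤ walkCount (l₁ ++ l₂) u u := by
  rw [walkCount_append, Matrix.mul_apply]
  have h := Finset.sum_le_sum_of_subset (f := fun w => walkCount l₁ u w * walkCount l₂ w u)
    (Finset.subset_univ {u, w})
  rw [Finset.sum_pair huw] at h
  have a := one_le_walkCount_self l₁ u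
  have b := one_le_walkCount_self l₂ u
  have c : 1 ≤ walkCount l₁ u u * walkCount l₂ u u := Nat.mul_pos a b
  have d : 1 ≤ walkCount l₁ u w * walkCount l₂ w u :=
    Nat.mul_pos (Nat.pos_of_ne_zero h₁) (Nat.pos_of_ne_zero h₂)
  omega

theorem walkCount_eq_one_apply_left {l : List (V × V)} {u : V}
    (h : ∀ e ∈ l, e.1 ≠ u ∧ e.2 ≠ u) (v : V) : walkCount l u v = if u = v then 1 else 0 := by
  induction l with
  | nil => simp [Matrix.one_apply]
  | cons e l ih =>
    have he := h e (by simp)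
    rw [walkCount_cons_apply, ih fun e he => h e (by simp [he]), if_neg he.1.symm, if_neg he.2.symm]
    simp

theorem walkCount_eq_one_apply_right {l : List (V × V)} {v : V}
    (h : ∀ e ∈ l, e.1 ≠ v ∧ e.2 ≠ v) (u : V) : walkCount l u v = if u = v then 1 else 0 := by
  induction l generalizing u with
  | nil => simp [Matrix.one_apply]
  | cons e l ih =>
    have he := h e (by simp)
    have ih := ih fun e he => h e (by simp [he])
    rw [walkCount_cons_apply, ih, ih, ih, if_neg he.1, if_neg he.2]
    simp

/-- The undirected edges of a list of pairs. -/
def undirected (l : List (V × V)) : List (Sym2 V) := l.map fun e => s(e.1, e.2)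

variable {G : SimpleGraph V}

theorem exists_walk_of_walkCount {l : List (V × V)} (hl : ∀ e ∈ l, G.Adj e.1 e.2) {u v : V}
    (h : walkCount l u v ≠ 0) : ∃ p : G.Walk u v, p.edges.Sublist (undirected l) := by
  induction l generalizing u with
  | nil =>
    have : u = v := by by_contra hne; simp [hne] at h
    subst this
    exact ⟨.nil, by simp [undirected]⟩
  | cons e l ih =>
    have ih := fun u => @ih (fun e he => hl e (by simp [he])) u
    have he : G.Adj e.1 e.2 := hl e (by simp)
    rw [walkCount_cons_apply] at h
    by_cases h0 : walkCount l u v = 0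
    · by_cases h1 : u = e.1 ∧ walkCount l e.2 v ≠ 0
      · obtain ⟨rfl, h1⟩ := h1
        obtain ⟨p, hp⟩ := ih _ h1
        exact ⟨.cons he p, by simpa [undirected] using hp⟩
      · have h2 : u = e.2 ∧ walkCount l e.1 v ≠ 0 := by
          by_contra h2
          apply h
          split_ifs <;> simp_all
        obtain ⟨rfl, h2⟩ := h2
        obtain ⟨p, hp⟩ := ih _ h2
        refine ⟨.cons he.symm p, ?_⟩
        simp only [SimpleGraph.Walk.edges_cons, undirected, List.map_cons, Sym2.eq_swap (a := e.2)]
        simpa [undirected] using hp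
    · obtain ⟨p, hp⟩ := ih _ h0
      exact ⟨p, by simpa [undirected] using hp.cons _⟩

/-- A walk whose edges form a subsequence of `e :: l` starts with `e`, or does not use `e`. -/
theorem walk_sublist_cons_cases {e : V × V} {l : List (V × V)} {u v : V} (p : G.Walk u v)
    (hp : p.edges.Sublist (undirected (e :: l))) :
    p.edges.Sublist (undirected l) ∨ ∃ (w : V) (h : G.Adj u w) (q : G.Walk w v),
      p = .cons h q ∧ q.edges.Sublist (undirected l) ∧ (u = e.1 ∧ w = e.2 ∨ u = e.2 ∧ w = e.1) := by
  simp only [undirected, List.map_cons, List.sublist_cons_iff] at hp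
  rcases hp with hp | ⟨r, hr, hs⟩
  · exact .inl hp
  · cases p with
    | nil => simp at hr
    | cons h q =>
      simp only [SimpleGraph.Walk.edges_cons, List.cons.injEq] at hr
      refine .inr ⟨_, h, q, rfl, hr.2 ▸ hs, ?_⟩
      exact Sym2.eq_iff.mp hr.1

theorem walkCount_pos_of_walk {l : List (V × V)} {u v : V} (p : G.Walk u v)
    (hp : p.edges.Sublist (undirected l)) : 1 ≤ walkCount l u v := by
  induction l generalizing u with
  | nil =>
    cases p with
    | nil => simp
    | cons h q => simp [undirected] at hp
  | cons e l ih =>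
    rw [walkCount_cons_apply]
    rcases walk_sublist_cons_cases p hp with h | ⟨w, h, q, -, hq, ⟨rfl, rfl⟩ | ⟨rfl, rfl⟩⟩
    · have := ih p h; omega
    · have := ih q hq; simp; omega
    · have := ih q hq; simp; omega

theorem two_le_walkCount_of_walks {l : List (V × V)} {u v : V} (p q : G.Walk u v)
    (hpq : p ≠ q) (hp : p.edges.Sublist (undirected l)) (hq : q.edges.Sublist (undirected l)) :
    2 ≤ walkCount l u v := by
  induction l generalizing u with
  | nil =>
    cases p with
    | nil =>
      cases q with
      | nil => exact absurd rfl hpq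
      | cons h q => simp [undirected] at hq
    | cons h q => simp [undirected] at hp
  | cons e l ih =>
    rw [walkCount_cons_apply]
    rcases walk_sublist_cons_cases p hp with h | ⟨w, h, p', rfl, hp', hw⟩
    · rcases walk_sublist_cons_cases q hq with h' | ⟨w', h', q', rfl, hq', hw'⟩
      · have := ih p q hpq h h'; omega
      · have := walkCount_pos_of_walk p h
        have := walkCount_pos_of_walk q' hq'
        rcases hw' with ⟨rfl, rfl⟩ | ⟨rfl, rfl⟩ <;> simp <;> omega
    · rcases walk_sublist_cons_cases q hq with h' | ⟨w', h', q', rfl, hq', hw'⟩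
      · have := walkCount_pos_of_walk q h'
        have := walkCount_pos_of_walk p' hp'
        rcases hw with ⟨rfl, rfl⟩ | ⟨rfl, rfl⟩ <;> simp <;> omega
      · have hww : w = w' := by
          have := h.ne
          rcases hw with ⟨h1, rfl⟩ | ⟨h1, rfl⟩ <;> rcases hw' with ⟨h2, rfl⟩ | ⟨h2, rfl⟩
          · rfl
          · exact absurd h2 this
          · exact absurd h2 this
          · rfl
        subst hww
        have := ih p' q' (by rintro rfl; exact hpq rfl) hp' hq'
        rcases hw with ⟨rfl, rfl⟩ | ⟨rfl, rfl⟩ <;> simp <;> omega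

end WalkCount

/-! ### Good labelings and good orders of the edges -/

section GoodOrder

variable {V : Type*} [Fintype V] [DecidableEq V]

/-- The list `l` enumerates the edges of the subgraph of `G` induced by `W`, each in one of its two
directions, in such a way that labels increasing along `l` form a good labeling: between two
vertices there is at most one walk whose edges form a subsequence of `l`. (This excludes
repetitions in `l`.) -/
structure IsGoodOrder (G : SimpleGraph V) (W : Set V) (l : List (V × V)) : Prop where
  adj : ∀ e ∈ l, G.Adj e.1 e.2
  mem : ∀ e ∈ l, e.1 ∈ W ∧ e.2 ∈ W
  complete : ∀ a ∈ W, ∀ b ∈ W, G.Adj a b → (a, b) ∈ l ∨ (b, a) ∈ l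
  count : ∀ u v, walkCount l u v ≤ 1

variable {G : SimpleGraph V}

theorem isPath_of_walkCount_le_one {l : List (V × V)} (hl : ∀ u v, walkCount l u v ≤ 1) {u v : V}
    (p : G.Walk u v) (hp : p.edges.Sublist (undirected l)) : p.IsPath := by
  induction p with
  | nil => simp
  | @cons u w v h p ih =>
    rw [SimpleGraph.Walk.cons_isPath_iff]
    rw [SimpleGraph.Walk.edges_cons] at hp
    refine ⟨ih ((List.sublist_cons_self _ _).trans hp), fun hu => ?_⟩
    have h2 := two_le_walkCount_of_walks (l := l) (SimpleGraph.Walk.cons h (p.takeUntil u hu)) .nil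
      (by simp) ?_ (by simp)
    · have := hl u u; omega
    · refine List.Sublist.trans ?_ hp
      rw [SimpleGraph.Walk.edges_cons]
      refine List.Sublist.cons_cons _ ?_
      conv_rhs => rw [← p.take_spec hu, SimpleGraph.Walk.edges_append]
      exact List.sublist_append_left _ _

/-- An edge-labeling, extended by zero to all pairs of vertices. -/
noncomputable def extendLabel (lam : G.edgeSet → ℝ) (e : Sym2 V) : ℝ :=
  open Classical in if h : e ∈ G.edgeSet then lam ⟨e, h⟩ else 0

theorem isIncreasing_iff (lam : G.edgeSet → ℝ) {u v : V} (p : G.Walk u v) :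
    IsIncreasing lam p ↔ p.edges.Pairwise fun e f => extendLabel lam e ≤ extendLabel lam f := by
  have : (p.edges.attach.map fun e => lam ⟨e.1, p.edges_subset_edgeSet e.2⟩) =
      p.edges.map (extendLabel lam) := by
    conv_rhs => rw [← List.attach_map_subtype_val p.edges, List.map_map]
    refine List.map_congr_left fun e _ => ?_
    simp [extendLabel, p.edges_subset_edgeSet e.2]
  rw [IsIncreasing, this, List.pairwise_map]

/-- If `u` reaches both ends of an edge by increasing walks with smaller labels, then there are two
increasing paths with the same ends. -/
theorem IsGoodLabeling.not_reach_both {lam : G.edgeSet → ℝ} (hlam : IsGoodLabeling G lam)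
    {l : List (V × V)} {a b u : V} (hab : G.Adj a b) (hnot : s(a, b) ∉ undirected l)
    (hs : (undirected l ++ [s(a, b)]).Pairwise fun e f => extendLabel lam e ≤ extendLabel lam f)
    (hadj : ∀ e ∈ l, G.Adj e.1 e.2)
    (hl : ∀ u v, walkCount l u v ≤ 1) (ha : walkCount l u a ≠ 0) (hb : walkCount l u b ≠ 0) :
    False := by
  obtain ⟨p, hp⟩ := exists_walk_of_walkCount hadj ha
  obtain ⟨q, hq⟩ := exists_walk_of_walkCount hadj hb
  have hpp := isPath_of_walkCount_le_one hl p hp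
  have hqp := isPath_of_walkCount_le_one hl q hq
  have hs' := (List.pairwise_append.mp hs).1
  by_cases hbp : b ∈ p.support
  · have hsub : (p.dropUntil b hbp).edges.Sublist (undirected l) := by
      refine List.Sublist.trans ?_ hp
      conv_rhs => rw [← p.take_spec hbp, SimpleGraph.Walk.edges_append]
      exact List.sublist_append_right _ _
    have := hlam b a (p.dropUntil b hbp) (.cons hab.symm .nil) (hpp.dropUntil hbp)
      (by simp [hab.ne']) ((isIncreasing_iff _ _).mpr (hs'.sublist hsub))
      ((isIncreasing_iff _ _).mpr (by simp))
    apply hnot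
    refine hsub.subset ?_
    rw [this]
    simp [Sym2.eq_swap]
  · have := hlam u b (p.concat hab) q (hpp.concat hbp hab) hqp
      ((isIncreasing_iff _ _).mpr (hs.sublist ?_)) ((isIncreasing_iff _ _).mpr (hs'.sublist hq))
    · apply hnot
      refine hq.subset ?_
      rw [← this]
      simp [SimpleGraph.Walk.edges_concat]
    · rw [SimpleGraph.Walk.edges_concat, List.concat_eq_append]
      exact hp.append (List.Sublist.refl _)

theorem List.sublist_of_pairwise_idxOf {α : Type*} [DecidableEq α] {s S : List α}
    (hs : ∀ x ∈ s, x ∈ S) (h : s.Pairwise fun x y => S.idxOf x < S.idxOf y) : s.Sublist S := by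
  induction S generalizing s with
  | nil =>
    cases s with
    | nil => simp
    | cons x s => simpa using hs x
  | cons x S ih =>
    -- The index of an element other than the first drops by one when the first is removed.
    have shift : ∀ t : List α, x ∉ t → (∀ y ∈ t, y ∈ x :: S) →
        (t.Pairwise fun y z => (x :: S).idxOf y < (x :: S).idxOf z) → t.Sublist S := by
      intro t hx ht h
      have hne : ∀ y ∈ t, y ≠ x := fun y hy h => hx (h ▸ hy)
      refine ih (fun y hy => (List.mem_cons.mp (ht y hy)).resolve_left (hne y hy)) ?_
      refine h.imp_of_mem fun {y z} hy hz hyz => ?_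
      rw [List.idxOf_cons_ne _ (hne y hy).symm, List.idxOf_cons_ne _ (hne z hz).symm] at hyz
      omega
    cases s with
    | nil => simp
    | cons y s =>
      rw [List.pairwise_cons] at h
      have hxs : x ∉ s := fun hx => by have := h.1 x hx; simp at this
      by_cases hyx : y = x
      · subst hyx
        exact (shift s hxs (fun z hz => hs z (by simp [hz])) h.2).cons_cons _
      · exact (shift (y :: s) (by simp [hxs, Ne.symm hyx]) hs (List.pairwise_cons.mpr h)).cons _

/-- From left to right, the edges are sorted by their labels; from right to left, an edge is labeled
by its position. A good labeling only forbids two increasing paths, whereas a good order forbids two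
walks: `IsGoodLabeling.not_reach_both` closes this gap, edge by edge. -/
theorem isGoodGraph_iff_exists_isGoodOrder :
    IsGoodGraph G ↔ ∃ l, IsGoodOrder G Set.univ l := by
  classical
  constructor
  · rintro ⟨lam, hlam⟩
    let S := G.edgeFinset.toList.mergeSort fun e f => decide (extendLabel lam e ≤ extendLabel lam f)
    have hSmem : ∀ e, e ∈ S ↔ e ∈ G.edgeSet := by simp [S]
    have hSnd : S.Nodup := (List.mergeSort_perm _ _).nodup_iff.mpr (Finset.nodup_toList _)
    have hSs : S.Pairwise fun e f => extendLabel lam e ≤ extendLabel lam f := by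
      have := List.pairwise_mergeSort
        (le := fun e f : Sym2 V => decide (extendLabel lam e ≤ extendLabel lam f))
        (by intro a b c; simpa using le_trans) (by intro a b; simpa using le_total _ _)
        G.edgeFinset.toList
      simpa [S] using this
    let L : List (V × V) := S.map Quot.out
    have hout : ∀ e : Sym2 V, s((Quot.out e).1, (Quot.out e).2) = e := fun e => Quot.out_eq e
    have hL : undirected L = S := by
      simp only [undirected, L, List.map_map]
      conv_rhs => rw [← List.map_id S]
      exact List.map_congr_left fun e _ => hout e
    have hLadj : ∀ e ∈ L, G.Adj e.1 e.2 := by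
      intro e he
      rw [← SimpleGraph.mem_edgeSet, ← hSmem, ← hL]
      exact List.mem_map.mpr ⟨e, he, rfl⟩
    refine ⟨L, hLadj, by simp, fun a _ b _ hab => ?_, ?_⟩
    · have : s(a, b) ∈ undirected L := by rw [hL, hSmem]; exact hab
      obtain ⟨e, he, hes⟩ := List.mem_map.mp this
      rcases Sym2.eq_iff.mp hes with ⟨h1, h2⟩ | ⟨h1, h2⟩
      · exact .inl (by rw [← h1, ← h2]; exact he)
      · exact .inr (by rw [← h1, ← h2]; exact he)
    · -- The first edge whose addition creates a second walk contradicts `not_reach_both`.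
      have key : ∀ l : List (V × V), l <+: L → ∀ u v, walkCount l u v ≤ 1 := by
        intro l
        induction l using List.reverseRecOn with
        | nil =>
          intro _ u v
          simp only [walkCount_nil, Matrix.one_apply]
          split_ifs <;> simp
        | append_singleton l e ih =>
          intro hpre u v
          have hpre' : l <+: L := (List.prefix_append _ _).trans hpre
          have ih := ih hpre'
          have he : G.Adj e.1 e.2 := hLadj e (hpre.subset (by simp))
          have hsub : (undirected l ++ [s(e.1, e.2)]).Sublist S := by
            rw [← hL]
            have := hpre.sublist.map fun e : V × V => s(e.1, e.2)
            simpa [undirected] using this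
          have hnd := hSnd.sublist hsub
          have hnot : s(e.1, e.2) ∉ undirected l := by
            intro h
            have := List.disjoint_of_nodup_append hnd h
            simp at this
          have hsort := hSs.sublist hsub
          have h1 : ¬ (walkCount l u e.1 ≠ 0 ∧ walkCount l u e.2 ≠ 0) := fun h =>
            hlam.not_reach_both he hnot hsort (fun e he => hLadj e (hpre'.subset he)) ih h.1 h.2
          rw [walkCount_concat_apply]
          have ha := ih u e.1
          have hb := ih u e.2
          have hv := ih u v
          have hne := he.ne
          split_ifs with h2 h3 h3
          · exact absurd (h3.symm.trans h2) hne
          · subst h2; omega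
          · subst h3; omega
          · omega
      exact key L (List.prefix_refl L)
  · rintro ⟨l, hl⟩
    refine ⟨fun e => ((undirected l).idxOf e.1 : ℕ), fun u v p q hp hq hpi hqi => ?_⟩
    have key : ∀ p : G.Walk u v, p.IsPath →
        IsIncreasing (fun e : G.edgeSet => (((undirected l).idxOf e.1 : ℕ) : ℝ)) p →
        p.edges.Sublist (undirected l) := by
      intro p hp hi
      have hmem : ∀ e ∈ G.edgeSet, e ∈ undirected l := by
        intro e he
        induction e with
        | _ a b =>
          rcases hl.complete a trivial b trivial he with h | h
          · exact List.mem_map.mpr ⟨_, h, rfl⟩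
          · exact List.mem_map.mpr ⟨_, h, Sym2.eq_swap⟩
      refine List.sublist_of_pairwise_idxOf (fun e he => hmem e (p.edges_subset_edgeSet he)) ?_
      rw [isIncreasing_iff] at hi
      have hnd : p.edges.Pairwise (· ≠ ·) := hp.isTrail.edges_nodup
      refine (hi.and hnd).imp_of_mem fun {e f} he hf h => ?_
      have he := p.edges_subset_edgeSet he
      have hf := p.edges_subset_edgeSet hf
      have h1 := h.1
      simp only [extendLabel, he, hf, dif_pos, Nat.cast_le] at h1
      exact lt_of_le_of_ne h1 fun h' => h.2 ((List.idxOf_inj (hmem e he)).mp h')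
    by_contra hne
    have := two_le_walkCount_of_walks p q hne (key p hp hpi) (key q hq hqi)
    have := hl.count u v
    omega

end GoodOrder

/-! ### Restricting and extending good orders -/

section Extend

variable {V : Type*} [Fintype V] [DecidableEq V] {G : SimpleGraph V}

theorem walkCount_outside_left {W : Set V} {l : List (V × V)}
    (hl : ∀ e ∈ l, e.1 ∈ W ∧ e.2 ∈ W) {v : V} (hv : v ∉ W) (q : V) :
    walkCount l v q = if v = q then 1 else 0 :=
  walkCount_eq_one_apply_left (fun e he =>
    ⟨fun h => hv (h.subst (motive := (· ∈ W)) (hl e he).1),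
      fun h => hv (h.subst (motive := (· ∈ W)) (hl e he).2)⟩) q

theorem walkCount_outside_right {W : Set V} {l : List (V × V)}
    (hl : ∀ e ∈ l, e.1 ∈ W ∧ e.2 ∈ W) {v : V} (hv : v ∉ W) (p : V) :
    walkCount l p v = if p = v then 1 else 0 :=
  walkCount_eq_one_apply_right (fun e he =>
    ⟨fun h => hv (h.subst (motive := (· ∈ W)) (hl e he).1),
      fun h => hv (h.subst (motive := (· ∈ W)) (hl e he).2)⟩) p

theorem IsGoodOrder.restrict {W B : Set V} [DecidablePred (· ∈ B)] {l : List (V × V)}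
    (h : IsGoodOrder G W l) (hB : B ⊆ W) :
    IsGoodOrder G B (l.filter fun e => e.1 ∈ B ∧ e.2 ∈ B) where
  adj e he := h.adj e (List.mem_of_mem_filter he)
  mem e he := by simpa using (List.mem_filter.mp he).2
  complete a ha b hb hab := by
    rcases h.complete a (hB ha) b (hB hb) hab with h | h
    · exact .inl (List.mem_filter.mpr ⟨h, by simp [ha, hb]⟩)
    · exact .inr (List.mem_filter.mpr ⟨h, by simp [ha, hb]⟩)
  count u v := (walkCount_mono List.filter_sublist u v).trans (h.count u v)

theorem IsGoodOrder.insert_isolated {W : Set V} {l : List (V × V)} (h : IsGoodOrder G W l) {v : V}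
    (hv : ∀ b ∈ W, ¬ G.Adj v b) : IsGoodOrder G (insert v W) l where
  adj := h.adj
  mem e he := ⟨.inr (h.mem e he).1, .inr (h.mem e he).2⟩
  complete := by
    rintro a (rfl | ha) b (rfl | hb) hab
    · exact absurd hab (G.irrefl)
    · exact absurd hab (hv b hb)
    · exact absurd hab.symm (hv a ha)
    · exact h.complete a ha b hb hab
  count := h.count

/-- A pendant edge inside a list does not change the walks between the old vertices. -/
theorem walkCount_insert_pendant {W : Set V} {l₁ l₂ : List (V × V)}
    (h₁ : ∀ e ∈ l₁, e.1 ∈ W ∧ e.2 ∈ W) (h₂ : ∀ e ∈ l₂, e.1 ∈ W ∧ e.2 ∈ W) {v a p q : V}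
    (hv : v ∉ W) (hp : p ∈ W) (hq : q ∈ W) :
    walkCount (l₁ ++ (v, a) :: l₂) p q = walkCount (l₁ ++ l₂) p q := by
  have hpv : p ≠ v := fun h => hv (h ▸ hp)
  have hqv : v ≠ q := fun h => hv (h ▸ hq)
  rw [walkCount_insert, walkCount_outside_right h₁ hv,
    walkCount_outside_left h₂ hv, if_neg hpv, if_neg hqv]
  simp

theorem walkCount_insert_pendant_right {W : Set V} {l₁ l₂ : List (V × V)}
    (h₁ : ∀ e ∈ l₁, e.1 ∈ W ∧ e.2 ∈ W) (h₂ : ∀ e ∈ l₂, e.1 ∈ W ∧ e.2 ∈ W) {v a p : V}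
    (hv : v ∉ W) (hp : p ∈ W) :
    walkCount (l₁ ++ (v, a) :: l₂) p v = walkCount l₁ p a := by
  have hpv : p ≠ v := fun h => hv (h ▸ hp)
  have h : ∀ e ∈ l₁ ++ l₂, e.1 ∈ W ∧ e.2 ∈ W := by
    intro e he; rcases List.mem_append.mp he with he | he <;> [exact h₁ e he; exact h₂ e he]
  rw [walkCount_insert, walkCount_outside_right h₁ hv,
    walkCount_outside_left h₂ hv, walkCount_outside_right h hv, if_neg hpv]
  simp

theorem walkCount_insert_pendant_left {W : Set V} {l₁ l₂ : List (V × V)}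
    (h₁ : ∀ e ∈ l₁, e.1 ∈ W ∧ e.2 ∈ W) (h₂ : ∀ e ∈ l₂, e.1 ∈ W ∧ e.2 ∈ W) {v a q : V}
    (hv : v ∉ W) (hq : q ∈ W) :
    walkCount (l₁ ++ (v, a) :: l₂) v q = walkCount l₂ a q := by
  have hqv : v ≠ q := fun h => hv (h ▸ hq)
  have h : ∀ e ∈ l₁ ++ l₂, e.1 ∈ W ∧ e.2 ∈ W := by
    intro e he; rcases List.mem_append.mp he with he | he <;> [exact h₁ e he; exact h₂ e he]
  rw [walkCount_insert, walkCount_outside_left h₁ hv,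
    walkCount_outside_left h₂ hv, walkCount_outside_left h hv, if_neg hqv]
  simp

/-- A pendant edge may be inserted anywhere. -/
theorem IsGoodOrder.insert_pendant {W : Set V} {l₁ l₂ : List (V × V)}
    (h : IsGoodOrder G W (l₁ ++ l₂)) {v a : V} (hv : v ∉ W) (ha : a ∈ W) (hva : G.Adj v a)
    (huniq : ∀ b ∈ W, G.Adj v b → b = a) : IsGoodOrder G (insert v W) (l₁ ++ (v, a) :: l₂) where
  adj e he := by
    simp only [List.mem_append, List.mem_cons] at he
    rcases he with he | rfl | he
    · exact h.adj e (by simp [he])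
    · exact hva
    · exact h.adj e (by simp [he])
  mem e he := by
    simp only [List.mem_append, List.mem_cons] at he
    rcases he with he | rfl | he
    · exact (h.mem e (by simp [he])).imp .inr .inr
    · exact ⟨.inl rfl, .inr ha⟩
    · exact (h.mem e (by simp [he])).imp .inr .inr
  complete := by
    rintro b (rfl | hb) c (rfl | hc) hbc
    · exact absurd hbc (G.irrefl)
    · left; simp [huniq c hc hbc]
    · right; simp [huniq b hb hbc.symm]
    · exact (h.complete b hb c hc hbc).imp (fun h => by simp at h ⊢; tauto)
        (fun h => by simp at h ⊢; tauto)
  count := by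
    have h₁ : ∀ e ∈ l₁, e.1 ∈ W ∧ e.2 ∈ W := fun e he => h.mem e (by simp [he])
    have h₂ : ∀ e ∈ l₂, e.1 ∈ W ∧ e.2 ∈ W := fun e he => h.mem e (by simp [he])
    have hav : a ≠ v := hva.ne'
    intro p q
    by_cases hp : p ∈ W
    · by_cases hq : q ∈ W
      · rw [walkCount_insert_pendant h₁ h₂ hv hp hq]; exact h.count p q
      · by_cases hqv : q = v
        · subst hqv
          rw [walkCount_insert_pendant_right h₁ h₂ hv hp]
          exact (walkCount_mono (List.sublist_append_left _ _) _ _).trans (h.count _ _)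
        · rw [walkCount_insert, walkCount_outside_right h₂ hq,
            walkCount_outside_right h₂ hq, if_neg (Ne.symm hqv),
            if_neg (fun e : a = q => hq (e ▸ ha))]
          simpa using h.count p q
    · by_cases hpv : p = v
      · subst hpv
        by_cases hq : q ∈ W
        · rw [walkCount_insert_pendant_left h₁ h₂ hv hq]
          exact (walkCount_mono (List.sublist_append_right _ _) _ _).trans (h.count _ _)
        · rw [walkCount_insert, walkCount_outside_left h₁ hv,
            walkCount_outside_left h₁ hv,
            walkCount_outside_right h₂ hq, if_neg hav.symm,
            if_neg (fun e : a = q => hq (e ▸ ha))]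
          simpa using h.count p q
      · rw [walkCount_insert, walkCount_outside_left h₁ hp,
          walkCount_outside_left h₁ hp, if_neg hpv, if_neg (fun e : p = a => hp (e ▸ ha))]
        simpa using h.count p q

/-- All entries at once. The conditions are written as factors, so that `simp` can discard them
independently. -/
theorem walkCount_insert_leaf {W : Set V} {l : List (V × V)} (h : ∀ e ∈ l, e.1 ∈ W ∧ e.2 ∈ W)
    {v : V} (hv : v ∉ W) (a b p q : V) :
    walkCount ((v, a) :: (l ++ [(v, b)])) p q =
      walkCount l p q + (if p = v then 1 else 0) * (if b = q then 1 else 0)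
        + walkCount l p b * (if v = q then 1 else 0)
        + (if p = v then 1 else 0) * (walkCount l a q
          + (if a = v then 1 else 0) * (if b = q then 1 else 0)
          + walkCount l a b * (if v = q then 1 else 0))
        + (if p = a then 1 else 0) * ((if v = q then 1 else 0)
          + (if b = q then 1 else 0)
          + walkCount l v b * (if v = q then 1 else 0)) := by
  have key : ∀ p q, walkCount (l ++ [(v, b)]) p q =
      walkCount l p q + (if p = v then 1 else 0) * (if b = q then 1 else 0)
        + walkCount l p b * (if v = q then 1 else 0) := by
    intro p q
    rw [walkCount_insert, walkCount_outside_right h hv]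
    simp [Matrix.one_apply]
  have := walkCount_insert [] (l ++ [(v, b)]) v a p q
  simp only [List.nil_append] at this
  rw [this, key, key, key, walkCount_outside_left h hv q]
  simp [Matrix.one_apply]

/-- The edges of a vertex `v` of degree two may be put at the two ends of the list, if there is no
walk yet from the neighbor `a` of the first edge to the neighbor `b` of the last one. -/
theorem IsGoodOrder.insert_leaf {W : Set V} {l : List (V × V)} (h : IsGoodOrder G W l) {v a b : V}
    (hv : v ∉ W) (ha : a ∈ W) (hb : b ∈ W) (hab : a ≠ b) (hva : G.Adj v a) (hvb : G.Adj v b)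
    (h0 : walkCount l a b = 0) (huniq : ∀ c ∈ W, G.Adj v c → c = a ∨ c = b) :
    IsGoodOrder G (insert v W) ((v, a) :: (l ++ [(v, b)])) where
  adj e he := by
    simp only [List.mem_append, List.mem_cons, List.not_mem_nil, or_false] at he
    rcases he with rfl | he | rfl
    · exact hva
    · exact h.adj e he
    · exact hvb
  mem e he := by
    simp only [List.mem_append, List.mem_cons, List.not_mem_nil, or_false] at he
    rcases he with rfl | he | rfl
    · exact ⟨.inl rfl, .inr ha⟩
    · exact (h.mem e he).imp .inr .inr
    · exact ⟨.inl rfl, .inr hb⟩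
  complete := by
    rintro c (rfl | hc) d (rfl | hd) hcd
    · exact absurd hcd (G.irrefl)
    · left; rcases huniq d hd hcd with rfl | rfl <;> simp
    · right; rcases huniq c hc hcd.symm with rfl | rfl <;> simp
    · exact (h.complete c hc d hd hcd).imp (fun h => by simp; tauto) (fun h => by simp; tauto)
  count := by
    intro p q
    rw [walkCount_insert_leaf h.mem hv]
    have hav : a ≠ v := hva.ne'
    have hbv : b ≠ v := hvb.ne'
    have h1 := h.count p q
    have h2 := h.count p b
    have h3 := h.count a q
    rw [if_neg hav, h0, walkCount_outside_left h.mem hv, if_neg hbv.symm]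
    rcases eq_or_ne p v with rfl | hpv
    · have hl : ∀ q, walkCount l p q = if p = q then 1 else 0 := walkCount_outside_left h.mem hv
      rcases eq_or_ne q p with rfl | hqv
      · simp [hl, hav, hav.symm, hbv, hbv.symm, walkCount_outside_right h.mem hv a]
      · rcases eq_or_ne b q with rfl | hbq
        · simp [hl, hav.symm, h0, hbv.symm]
        · simpa [hl, hav.symm, hbv.symm, hqv.symm, hbq] using h3
    · rcases eq_or_ne q v with rfl | hqv
      · have hr : ∀ p, walkCount l p q = if p = q then 1 else 0 := walkCount_outside_right h.mem hv
        rcases eq_or_ne p a with rfl | hpa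
        · simp [hr, hpv, hbv, h0]
        · simpa [hr, hpv, hbv, hpa] using h2
      · rcases eq_or_ne p a with rfl | hpa
        · rcases eq_or_ne b q with rfl | hbq
          · simp [hpv, hqv.symm, h0]
          · simpa [hpv, hqv.symm, hbq] using h1
        · simpa [hpv, hqv.symm, hpa] using h1

/-- The two edges at the ends of the list create only one new walk between old vertices. -/
theorem walkCount_insert_leaf_of_ne {W : Set V} {l : List (V × V)}
    (h : ∀ e ∈ l, e.1 ∈ W ∧ e.2 ∈ W) {v a b p q : V} (hv : v ∉ W) (hp : p ∈ W) (hq : q ∈ W)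
    (hne : ¬ (p = a ∧ q = b)) :
    walkCount ((v, a) :: (l ++ [(v, b)])) p q = walkCount l p q := by
  have hpv : p ≠ v := fun h => hv (h ▸ hp)
  have hqv : v ≠ q := fun h => hv (h ▸ hq)
  rw [walkCount_insert_leaf h hv, if_neg hpv, if_neg hqv]
  by_cases hpa : p = a
  · have : b ≠ q := fun hb => hne ⟨hpa, hb.symm⟩
    simp [this]
  · simp [hpa]

/-- If single splits of `l` separate all pairs of elements of `D`, then so does a common one. -/
theorem exists_common_split (l : List (V × V)) {z : V} {D : Set V} (hz : z ∉ D)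
    (h : ∀ x ∈ D, ∀ y ∈ D, ∃ l₁ l₂, l = l₁ ++ l₂ ∧ walkCount l₁ x z = 0 ∧ walkCount l₂ z y = 0) :
    ∃ l₁ l₂, l = l₁ ++ l₂ ∧ ∀ x ∈ D, walkCount l₁ x z = 0 ∧ walkCount l₂ z x = 0 := by
  classical
  have hne : ∀ x ∈ D, x ≠ z := fun x hx e => hz (e ▸ hx)
  -- The least index after which no walk leads from `z` to `D`.
  have hex : ∃ j, ∀ y ∈ D, walkCount (l.drop j) z y = 0 :=
    ⟨l.length, fun y hy => by simp [(hne y hy).symm]⟩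
  obtain ⟨j, hj, hmin⟩ : ∃ j, (∀ y ∈ D, walkCount (l.drop j) z y = 0) ∧
      ∀ i < j, ¬ ∀ y ∈ D, walkCount (l.drop i) z y = 0 :=
    ⟨Nat.find hex, Nat.find_spec hex, fun i hi => Nat.find_min hex hi⟩
  refine ⟨l.take j, l.drop j, (List.take_append_drop _ _).symm, fun x hx => ⟨?_, hj x hx⟩⟩
  rcases Nat.eq_zero_or_pos j with rfl | h0
  · simp [hne x hx]
  · have := hmin (j - 1) (by omega)
    push Not at this
    obtain ⟨y, hy, hny⟩ := this
    obtain ⟨l₁, l₂, rfl, h1, h2⟩ := h x hx y hy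
    have hlt : j ≤ l₁.length := by
      by_contra hlt
      apply hny
      have hsub : ((l₁ ++ l₂).drop (j - 1)).Sublist l₂ := by
        rw [List.drop_append, List.drop_eq_nil_of_le (by omega)]
        exact List.drop_sublist _ _
      have := walkCount_mono hsub z y
      omega
    have hsub : ((l₁ ++ l₂).take j).Sublist l₁ := by
      rw [List.take_append_of_le_length hlt]
      exact List.take_sublist _ _
    have := walkCount_mono hsub x z
    omega

end Extend

/-! ### Star forests and the kernel -/

section Kernel

variable {V : Type*} [Fintype V] [DecidableEq V]

/-- `ctr` maps the vertices outside `X` to the centers of their stars in `G ∖ X`. -/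
structure IsStarCenter (G : SimpleGraph V) (X : Finset V) (ctr : V → V) : Prop where
  notMem : ∀ v, v ∉ X → ctr v ∉ X
  idem : ∀ v, v ∉ X → ctr (ctr v) = ctr v
  adj_iff : ∀ u v, u ∉ X → v ∉ X →
    (G.Adj u v ↔ ctr u = ctr v ∧ u ≠ v ∧ (u = ctr u ∨ v = ctr v))

theorem IsStarForestModulator.exists_isStarCenter {G : SimpleGraph V} {X : Finset V}
    (h : IsStarForestModulator G X) : ∃ ctr, IsStarCenter G X ctr := by
  classical
  choose c hc using h
  let H := G.induce {v | v ∉ X}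
  let f : {v | v ∉ X} → {v | v ∉ X} := fun v => (c (H.connectedComponentMk v)).1
  have hmk : ∀ v, H.connectedComponentMk (f v) = H.connectedComponentMk v := fun v =>
    (c (H.connectedComponentMk v)).2
  refine ⟨fun v => if hv : v ∉ X then (f ⟨v, hv⟩).1 else v, ?_, ?_, ?_⟩
  · intro v hv
    simp only [hv, not_false_eq_true, dif_pos]
    exact (f ⟨v, hv⟩).2
  · intro v hv
    have h2 : (f ⟨v, hv⟩).1 ∉ X := (f ⟨v, hv⟩).2
    simp only [hv, h2, not_false_eq_true, dif_pos]
    have : f (f ⟨v, hv⟩) = f ⟨v, hv⟩ := by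
      change (c (H.connectedComponentMk (f ⟨v, hv⟩))).1 = (c (H.connectedComponentMk ⟨v, hv⟩)).1
      rw [hmk]
    exact congrArg Subtype.val this
  · intro u v hu hv
    simp only [hu, hv, not_false_eq_true, dif_pos]
    -- Adjacency within one component is adjacency in the star.
    have key : ∀ (C : H.ConnectedComponent) (a b : {v | v ∉ X}), H.connectedComponentMk a = C →
        H.connectedComponentMk b = C →
        (G.Adj a.1 b.1 ↔ a.1 ≠ b.1 ∧ (a.1 = (f a).1 ∨ b.1 = (f b).1)) := by
      intro C a b ha hb
      have h1 := SimpleGraph.ConnectedComponent.toSimpleGraph_adj C (u := a) (v := b) ha hb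
      rw [hc C, SimpleGraph.starGraph_adj] at h1
      have h2 : H.Adj a b ↔ G.Adj a.1 b.1 := Iff.rfl
      rw [← h2, ← h1]
      have hfa : f a = (c C).1 := by subst ha; rfl
      have hfb : f b = (c C).1 := by subst hb; rfl
      simp only [hfa, hfb, ne_eq, Subtype.ext_iff]
    constructor
    · intro hadj
      have hmk' : H.connectedComponentMk ⟨u, hu⟩ = H.connectedComponentMk ⟨v, hv⟩ :=
        SimpleGraph.ConnectedComponent.sound (SimpleGraph.Adj.reachable (G := H) hadj)
      refine ⟨congrArg (fun C => ((c C).1 : {v | v ∉ X}).1) hmk',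
        (key _ ⟨u, hu⟩ ⟨v, hv⟩ hmk' rfl).mp hadj⟩
    · rintro ⟨h1, h2⟩
      have hmk' : H.connectedComponentMk ⟨u, hu⟩ = H.connectedComponentMk ⟨v, hv⟩ := by
        rw [← hmk, ← hmk ⟨v, hv⟩, Subtype.ext h1]
      exact (key _ ⟨u, hu⟩ ⟨v, hv⟩ hmk' rfl).mpr h2

/-- There is no triangle and no `K_{2,3}`. -/
structure FewCommonNeighbors (G : SimpleGraph V) : Prop where
  triangle : ∀ a b c, G.Adj a b → G.Adj a c → G.Adj b c → False
  common : ∀ a b, a ≠ b → ∀ p q r, G.Adj a p → G.Adj b p → G.Adj a q → G.Adj b q →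
    G.Adj a r → G.Adj b r → p = q ∨ p = r ∨ q = r

theorem isIncreasing_two {G : SimpleGraph V} {lam : G.edgeSet → ℝ} {a p b : V} (h : G.Adj a p)
    (h' : G.Adj p b) (hle : extendLabel lam s(a, p) ≤ extendLabel lam s(p, b)) :
    IsIncreasing lam (.cons h (.cons h' .nil)) := by
  rw [isIncreasing_iff]
  simpa using hle

/-- A vertex between `a` and `b` makes one of the paths of length two from `a` to `b` and from `b`
to `a` increasing, so of three such vertices two agree. -/
theorem IsGoodGraph.fewCommonNeighbors {G : SimpleGraph V} (h : IsGoodGraph G) :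
    FewCommonNeighbors G := by
  obtain ⟨lam, hlam⟩ := h
  -- Two vertices are not joined by two increasing paths of length two.
  have up : ∀ a b p q, a ≠ b → G.Adj a p → G.Adj p b → G.Adj a q → G.Adj q b →
      extendLabel lam s(a, p) ≤ extendLabel lam s(p, b) →
      extendLabel lam s(a, q) ≤ extendLabel lam s(q, b) → p = q := by
    intro a b p q hab hap hpb haq hqb hp hq
    have := hlam a b (.cons hap (.cons hpb .nil)) (.cons haq (.cons hqb .nil))
      (by simp [hap.ne, hpb.ne, hab]) (by simp [haq.ne, hqb.ne, hab])
      (isIncreasing_two _ _ hp) (isIncreasing_two _ _ hq)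
    simpa using congrArg SimpleGraph.Walk.support this
  have tri : ∀ a b c, G.Adj a b → G.Adj a c → G.Adj b c →
      ¬ extendLabel lam s(a, b) ≤ extendLabel lam s(b, c) := by
    intro a b c hab hac hbc hle
    have := hlam a c (.cons hab (.cons hbc .nil)) (.cons hac .nil)
      (by simp [hab.ne, hbc.ne, hac.ne]) (by simp [hac.ne])
      (isIncreasing_two _ _ hle) ((isIncreasing_iff _ _).mpr (by simp))
    have := congrArg SimpleGraph.Walk.length this
    simp at this
  constructor
  · intro a b c hab hac hbc
    rcases le_total (extendLabel lam s(a, b)) (extendLabel lam s(b, c)) with hle | hle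
    · exact tri a b c hab hac hbc hle
    · refine tri c b a hbc.symm hac.symm hab.symm ?_
      rwa [Sym2.eq_swap (a := c), Sym2.eq_swap (a := b) (b := a)]
  · intro a b hab p q r hap hbp haq hbq har hbr
    have down : ∀ p q, G.Adj a p → G.Adj b p → G.Adj a q → G.Adj b q →
        ¬ extendLabel lam s(a, p) ≤ extendLabel lam s(p, b) →
        ¬ extendLabel lam s(a, q) ≤ extendLabel lam s(q, b) → p = q := by
      intro p q hap hbp haq hbq hp hq
      refine up b a p q hab.symm hbp hap.symm hbq haq.symm ?_ ?_
      · rw [Sym2.eq_swap (a := b), Sym2.eq_swap (b := a)]; exact (not_le.mp hp).le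
      · rw [Sym2.eq_swap (a := b), Sym2.eq_swap (b := a)]; exact (not_le.mp hq).le
    have up := fun p q hap hbp haq hbq => up a b p q hab hap (G.adj_symm hbp) haq (G.adj_symm hbq)
    by_cases hp : extendLabel lam s(a, p) ≤ extendLabel lam s(p, b) <;>
    by_cases hq : extendLabel lam s(a, q) ≤ extendLabel lam s(q, b) <;>
    by_cases hr : extendLabel lam s(a, r) ≤ extendLabel lam s(r, b)
    · exact .inl (up p q hap hbp haq hbq hp hq)
    · exact .inl (up p q hap hbp haq hbq hp hq)
    · exact .inr (.inl (up p r hap hbp har hbr hp hr))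
    · exact .inr (.inr (down q r haq hbq har hbr hq hr))
    · exact .inr (.inr (up q r haq hbq har hbr hq hr))
    · exact .inr (.inl (down p r hap hbp har hbr hp hr))
    · exact .inl (down p q hap hbp haq hbq hp hq)
    · exact .inl (down p q hap hbp haq hbq hp hq)

variable (G : SimpleGraph V) (X : Finset V)

/-- A vertex outside `X` with at least two neighbors in `X`. -/
def IsSpecial (v : V) : Prop :=
  v ∉ X ∧ ∃ x y, x ≠ y ∧ x ∈ X ∧ y ∈ X ∧ G.Adj v x ∧ G.Adj v y

/-- For vertices outside `X`: they lie in the same star of `G ∖ X`. -/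
def SameStar (v s : V) : Prop :=
  v = s ∨ G.Adj v s ∨ ∃ c, c ∉ X ∧ G.Adj v c ∧ G.Adj c s

/-- The core: the set `X`, and the vertices of degree at least two in the stars with a special
vertex. -/
def InCore (v : V) : Prop :=
  v ∈ X ∨ (∃ s, IsSpecial G X s ∧ SameStar G X v s) ∧ ∃ a b, a ≠ b ∧ G.Adj v a ∧ G.Adj v b

/-- Two neighbors of `c` outside `X` are adjacent to `x`. A vertex with two neighbors outside `X`
is a center, and the neighbors are leaves of its star. -/
def IsDoubled (c x : V) : Prop :=
  ∃ p q, p ≠ q ∧ p ∉ X ∧ q ∉ X ∧ G.Adj c p ∧ G.Adj p x ∧ G.Adj c q ∧ G.Adj q x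

/-- The center `c` of a star outside the core, adjacent to `z`, is doubled at `x` and at `y`. -/
def IsWitness (z x y c : V) : Prop :=
  (z ∈ X ∧ x ∈ X ∧ y ∈ X) ∧ c ∉ X ∧ ¬ InCore G X c ∧ G.Adj c z ∧ IsDoubled G X c x ∧
    IsDoubled G X c y

/-- The least witness. The kernel needs a single witness of each triple, and this choice of it is
definable. -/
def IsFirstWitness [LT V] (z x y c : V) : Prop :=
  IsWitness G X z x y c ∧ ¬ ∃ c', c' < c ∧ IsWitness G X z x y c'

/-- The kernel: the core, and the least witness of each triple with its leaves. -/
def InKernel [LT V] (v : V) : Prop :=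
  InCore G X v ∨ ∃ z x y c, IsFirstWitness G X z x y c ∧
    (v = c ∨ v ∉ X ∧ G.Adj c v ∧ (G.Adj v x ∨ G.Adj v y))

end Kernel

/-! ### The positions left for the center edges -/

section KernelTheorem

variable {V : Type*} [Fintype V] [DecidableEq V] {G : SimpleGraph V} {X : Finset V} {ctr : V → V}

theorem IsStarCenter.adj_ctr (hs : IsStarCenter G X ctr) {v : V} (hv : v ∉ X) (hne : v ≠ ctr v) :
    G.Adj v (ctr v) :=
  (hs.adj_iff v _ hv (hs.notMem v hv)).mpr ⟨(hs.idem v hv).symm, hne, .inr (hs.idem v hv).symm⟩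

theorem IsStarCenter.ctr_eq (hs : IsStarCenter G X ctr) {u v : V} (hu : u ∉ X) (hv : v ∉ X)
    (h : G.Adj u v) : ctr u = ctr v := ((hs.adj_iff u v hu hv).mp h).1

/-- A leaf has no neighbor outside `X` other than the center. -/
theorem IsStarCenter.eq_ctr_of_adj (hs : IsStarCenter G X ctr) {u v : V} (hu : u ∉ X) (hv : v ∉ X)
    (h : G.Adj u v) (hne : u ≠ ctr u) : v = ctr u := by
  obtain ⟨h1, -, h2 | h2⟩ := (hs.adj_iff u v hu hv).mp h
  · exact absurd h2 hne
  · rw [h1]; exact h2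

theorem IsStarCenter.sameStar_iff (hs : IsStarCenter G X ctr) {v s : V} (hv : v ∉ X)
    (hsX : s ∉ X) : SameStar G X v s ↔ ctr v = ctr s := by
  constructor
  · rintro (rfl | h | ⟨c, hc, h1, h2⟩)
    · rfl
    · exact hs.ctr_eq hv hsX h
    · exact (hs.ctr_eq hv hc h1).trans (hs.ctr_eq hc hsX h2)
  · intro h
    by_cases h1 : v = s
    · exact .inl h1
    by_cases h2 : v = ctr v
    · exact .inr (.inl ((hs.adj_iff v s hv hsX).mpr ⟨h, h1, .inl h2⟩))
    by_cases h3 : s = ctr s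
    · exact .inr (.inl ((hs.adj_iff v s hv hsX).mpr ⟨h, h1, .inr h3⟩))
    · exact .inr (.inr ⟨ctr v, hs.notMem v hv, hs.adj_ctr hv h2, h ▸ (hs.adj_ctr hsX h3).symm⟩)

/-- The star with center `ctr v` has no special vertex. -/
def IsOrdinary (G : SimpleGraph V) (X : Finset V) (ctr : V → V) (v : V) : Prop :=
  ∀ s, IsSpecial G X s → ctr s ≠ ctr v

theorem IsStarCenter.not_inCore (hs : IsStarCenter G X ctr) {v : V} (hv : v ∉ X)
    (h : IsOrdinary G X ctr v) : ¬ InCore G X v := by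
  rintro (h1 | ⟨⟨s, h1, h2⟩, -⟩)
  · exact hv h1
  · exact h s h1 ((hs.sameStar_iff hv h1.1).mp h2).symm

/-- A vertex outside the core, in a star with a special vertex, has degree at most one. -/
theorem IsStarCenter.eq_of_adj_of_not_inCore (hs : IsStarCenter G X ctr) {v : V}
    (hv : ¬ InCore G X v) (h : ¬ IsOrdinary G X ctr v) {a b : V} (ha : G.Adj v a)
    (hb : G.Adj v b) : a = b := by
  unfold IsOrdinary at h
  push Not at h
  obtain ⟨s, h1, h2⟩ := h
  have hvX : v ∉ X := fun h => hv (.inl h)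
  by_contra hab
  exact hv (.inr ⟨⟨s, h1, (hs.sameStar_iff hvX h1.1).mpr h2.symm⟩, a, b, hab, ha, hb⟩)

/-- A vertex of an ordinary star has at most one neighbor in `X`. -/
theorem IsOrdinary.eq_of_adj {v : V} (h : IsOrdinary G X ctr v) (hv : v ∉ X) {a b : V}
    (haX : a ∈ X) (hbX : b ∈ X) (ha : G.Adj v a) (hb : G.Adj v b) : a = b := by
  by_contra hab
  exact h v ⟨hv, a, b, hab, haX, hbX, ha, hb⟩ rfl

theorem List.pair_sublist_or {α : Type*} {L : List α} {a b : α} (ha : a ∈ L) (hb : b ∈ L)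
    (hab : a ≠ b) : [a, b].Sublist L ∨ [b, a].Sublist L := by
  obtain ⟨s, t, rfl⟩ := List.append_of_mem ha
  rcases List.mem_append.mp hb with h | h
  · right
    exact (List.singleton_sublist.mpr h).append (List.singleton_sublist.mpr (by simp))
  · left
    rcases List.mem_cons.mp h with h | h
    · exact absurd h.symm hab
    · exact ((List.singleton_sublist.mpr h).cons_cons a).trans (List.sublist_append_right _ _)

theorem IsGoodOrder.mem_undirected {W : Set V} {l : List (V × V)} (h : IsGoodOrder G W l) {a b : V}
    (ha : a ∈ W) (hb : b ∈ W) (hab : G.Adj a b) : s(a, b) ∈ undirected l := by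
  rcases h.complete a ha b hb hab with h | h
  · exact List.mem_map.mpr ⟨_, h, rfl⟩
  · exact List.mem_map.mpr ⟨_, h, Sym2.eq_swap⟩

/-- Of the two paths of length two from `x` to `c` in a four-cycle, one is increasing. -/
theorem IsGoodOrder.exists_up {W : Set V} {l : List (V × V)} (h : IsGoodOrder G W l) {x c p q : V}
    (hx : x ∈ W) (hc : c ∈ W) (hp : p ∈ W) (hq : q ∈ W) (hpq : p ≠ q) (hxc : x ≠ c)
    (hxp : G.Adj x p) (hpc : G.Adj p c) (hxq : G.Adj x q) (hqc : G.Adj q c) :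
    ∃ r, (r = p ∨ r = q) ∧ [s(x, r), s(r, c)].Sublist (undirected l) := by
  by_contra hno
  push Not at hno
  have key : ∀ r, (r = p ∨ r = q) → r ∈ W → G.Adj x r → G.Adj r c →
      [s(c, r), s(r, x)].Sublist (undirected l) := by
    intro r hr hrW hxr hrc
    have := (List.pair_sublist_or (h.mem_undirected hx hrW hxr) (h.mem_undirected hrW hc hrc)
      (by simp [hxr.ne, hxc])).resolve_left (hno r hr)
    rwa [Sym2.eq_swap (a := c), Sym2.eq_swap (b := x)]
  have := two_le_walkCount_of_walks (l := l) (SimpleGraph.Walk.cons hpc.symm (.cons hxp.symm .nil))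
    (SimpleGraph.Walk.cons hqc.symm (.cons hxq.symm .nil))
    (fun e => hpq (by simpa using congrArg SimpleGraph.Walk.support e))
    (by simpa using key p (.inl rfl) hp hxp hpc) (by simpa using key q (.inr rfl) hq hxq hqc)
  have := h.count c x
  omega

/-- Let `c` be doubled at `x` and at `y`, and adjacent to `z` by the edge `e`. Before `e`, no
increasing walk leads from `x` to `z`, since it could be extended to `c`; after `e`, none leads from
`z` to `y`. -/
theorem IsGoodOrder.exists_split_of_isWitness {W : Set V} {l : List (V × V)}
    (h : IsGoodOrder G W l) {z x y c : V} (hw : IsWitness G X z x y c) (hXW : ↑X ⊆ W)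
    (hc : c ∈ W) (hleaf : ∀ p, p ∉ X → G.Adj c p → (G.Adj p x ∨ G.Adj p y) → p ∈ W) :
    ∃ l₁ l₂ e, l = l₁ ++ e :: l₂ ∧ (e.1 = c ∨ e.2 = c) ∧ walkCount l₁ x z = 0 ∧
      walkCount l₂ z y = 0 := by
  obtain ⟨⟨hz, hx, hy⟩, hcX, -, hcz, ⟨p, q, hpq, hpX, hqX, hcp, hpx, hcq, hqx⟩,
    ⟨p', q', hpq', hpX', hqX', hcp', hpy, hcq', hqy⟩⟩ := hw
  have hcx : x ≠ c := fun e => hcX (e ▸ hx)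
  have hcy : c ≠ y := fun e => hcX (e ▸ hy)
  obtain ⟨r, hr, hrs⟩ := h.exists_up (hXW hx) hc (hleaf p hpX hcp (.inl hpx))
    (hleaf q hqX hcq (.inl hqx)) hpq hcx hpx.symm hcp.symm hqx.symm hcq.symm
  obtain ⟨r', hr', hrs'⟩ := h.exists_up hc (hXW hy) (hleaf p' hpX' hcp' (.inr hpy))
    (hleaf q' hqX' hcq' (.inr hqy)) hpq' hcy hcp' hpy hcq' hqy
  have hrX : r ∉ X := by rcases hr with rfl | rfl <;> assumption
  have hrX' : r' ∉ X := by rcases hr' with rfl | rfl <;> assumption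
  have hxr : G.Adj x r := by rcases hr with rfl | rfl <;> [exact hpx.symm; exact hqx.symm]
  have hrc : G.Adj r c := by rcases hr with rfl | rfl <;> [exact hcp.symm; exact hcq.symm]
  have hcr' : G.Adj c r' := by rcases hr' with rfl | rfl <;> assumption
  have hry' : G.Adj r' y := by rcases hr' with rfl | rfl <;> assumption
  have hmem := h.mem_undirected (hXW hz) hc hcz.symm
  obtain ⟨e, he, hes⟩ := List.mem_map.mp hmem
  obtain ⟨l₁, l₂, rfl⟩ := List.append_of_mem he
  have hund : undirected (l₁ ++ e :: l₂) = undirected l₁ ++ s(z, c) :: undirected l₂ := by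
    rw [← hes]; simp [undirected]
  refine ⟨l₁, l₂, e, rfl, ?_, ?_, ?_⟩
  · rcases Sym2.eq_iff.mp hes with h | h
    · exact .inr h.2
    · exact .inl h.1
  · by_contra h0
    obtain ⟨w, hw⟩ := exists_walk_of_walkCount (fun e he => h.adj e (by simp [he])) h0
    have := two_le_walkCount_of_walks (l := l₁ ++ e :: l₂) (w.concat hcz.symm)
      (SimpleGraph.Walk.cons hxr (.cons hrc .nil)) ?_ ?_ (by simpa using hrs)
    · have := h.count x c
      omega
    · intro heq
      have := congrArg SimpleGraph.Walk.penultimate heq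
      simp at this
      exact hrX (this ▸ hz)
    · rw [hund, SimpleGraph.Walk.edges_concat, List.concat_eq_append]
      exact hw.append (by simp)
  · by_contra h0
    obtain ⟨w, hw⟩ := exists_walk_of_walkCount (fun e he => h.adj e (by simp [he])) h0
    have := two_le_walkCount_of_walks (l := l₁ ++ e :: l₂) (SimpleGraph.Walk.cons hcz w)
      (SimpleGraph.Walk.cons hcr' (.cons hry' .nil)) ?_ ?_ (by simpa using hrs')
    · have := h.count c y
      omega
    · intro heq
      have := congrArg SimpleGraph.Walk.snd heq
      simp at this
      exact hrX' (this ▸ hz)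
    · rw [hund, SimpleGraph.Walk.edges_cons, Sym2.eq_swap (a := c)]
      exact (hw.cons_cons _).trans (List.sublist_append_right _ _)

/-- For each vertex `c` outside the core with a neighbor `z` in `X`, the edge `zc` has an admissible
position in `l`: before it no walk leads to `z` from a vertex at which `c` is doubled, and after
it none leads from `z` to such a vertex. -/
def HasSlots (G : SimpleGraph V) (X : Finset V) (l : List (V × V)) : Prop :=
  ∀ c z, ¬ InCore G X c → z ∈ X → G.Adj c z → ∃ l₁ l₂, l = l₁ ++ l₂ ∧
    ∀ x ∈ X, IsDoubled G X c x → walkCount l₁ x z = 0 ∧ walkCount l₂ z x = 0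

/-- The restriction of a good order of the kernel to the core leaves positions for all edges from
`X` to centers outside the core: the witnesses of the kernel provide a split for each pair of
doubled vertices, and `exists_common_split` merges these splits. -/
theorem IsGoodOrder.exists_core [LinearOrder V] (hf : FewCommonNeighbors G) {l : List (V × V)}
    (h : IsGoodOrder G {v | InKernel G X v} l) :
    ∃ l, IsGoodOrder G {v | InCore G X v} l ∧ HasSlots G X l := by
  classical
  have hsub : {v | InCore G X v} ⊆ {v | InKernel G X v} := fun v hv => .inl hv
  refine ⟨_, h.restrict hsub, fun c z hc hz hcz => ?_⟩
  have hcX : c ∉ X := fun h => hc (.inl h)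
  refine (exists_common_split (D := {x | x ∈ X ∧ IsDoubled G X c x}) _ ?_ ?_).imp
    fun l₁ => Exists.imp fun l₂ h => ⟨h.1, fun x hx hd => h.2 x ⟨hx, hd⟩⟩
  · rintro ⟨-, p, q, -, -, -, hcp, hpz, -⟩
    exact hf.triangle c p z hcp hcz hpz
  · rintro x ⟨hx, hdx⟩ y ⟨hy, hdy⟩
    have hex : ∃ c, IsWitness G X z x y c := ⟨c, ⟨hz, hx, hy⟩, hcX, hc, hcz, hdx, hdy⟩
    obtain ⟨c₀, hc₀, hmin⟩ := (wellFounded_lt (α := V)).has_min {c | IsWitness G X z x y c} hex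
    have hfirst : IsFirstWitness G X z x y c₀ := ⟨hc₀, fun ⟨c', h1, h2⟩ => hmin c' h2 h1⟩
    obtain ⟨l₁, l₂, e, rfl, he, h1, h2⟩ := h.exists_split_of_isWitness hc₀
      (fun v hv => .inl (.inl hv)) (.inr ⟨z, x, y, c₀, hfirst, .inl rfl⟩)
      (fun p hp hcp hpxy => .inr ⟨z, x, y, c₀, hfirst, .inr ⟨hp, hcp, hpxy⟩⟩)
    refine ⟨l₁.filter fun e => e.1 ∈ {v | InCore G X v} ∧ e.2 ∈ {v | InCore G X v},
      l₂.filter fun e => e.1 ∈ {v | InCore G X v} ∧ e.2 ∈ {v | InCore G X v}, ?_, ?_, ?_⟩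
    · have : ¬ (InCore G X e.1 ∧ InCore G X e.2) := by
        rcases he with he | he <;> rw [he] <;> have := hc₀.2.2.1 <;> tauto
      rw [List.filter_append, List.filter_cons_of_neg (by simpa using this)]
    · have := walkCount_mono (List.filter_sublist (l := l₁)
        (p := fun e => e.1 ∈ {v | InCore G X v} ∧ e.2 ∈ {v | InCore G X v})) x z
      omega
    · have := walkCount_mono (List.filter_sublist (l := l₂)
        (p := fun e => e.1 ∈ {v | InCore G X v} ∧ e.2 ∈ {v | InCore G X v})) z y
      omega

end KernelTheorem

/-! ### Inserting the vertices outside the core -/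

section Extension

variable {V : Type*} [Fintype V] [DecidableEq V] {G : SimpleGraph V} {X : Finset V} {ctr : V → V}

/-- The vertices outside the core that are centers of ordinary stars, or of degree at most one in
the other stars. -/
def outerCenters (G : SimpleGraph V) (X : Finset V) (ctr : V → V) : Set V :=
  {v | ¬ InCore G X v ∧ (v = ctr v ∨ ¬ IsOrdinary G X ctr v)}

/-- For the centers `c` in `S` of ordinary stars: a leaf `p` at `c` that is adjacent to `y ∈ X` can
still be inserted, and so can both leaves if there are two of them. -/
def HasRoom (G : SimpleGraph V) (X : Finset V) (ctr : V → V) (S : Set V)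
    (l : List (V × V)) : Prop :=
  ∀ c ∈ S, IsOrdinary G X ctr c → ∀ y ∈ X, ∀ p, p ∉ X → G.Adj c p → G.Adj p y →
    (walkCount l y c = 0 ∨ walkCount l c y = 0) ∧
    (IsDoubled G X c y → walkCount l y c = 0 ∧ walkCount l c y = 0)

theorem IsStarCenter.isOrdinary_congr {u v : V} (h : ctr u = ctr v) :
    IsOrdinary G X ctr u ↔ IsOrdinary G X ctr v := by simp [IsOrdinary, h]

/-- A vertex of `outerCenters` has at most one neighbor in the core and `outerCenters` together, and
this neighbor is in `X` if the vertex belongs to an ordinary star. -/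
theorem IsStarCenter.outerCenters_adj (hs : IsStarCenter G X ctr) {v : V}
    (hv : v ∈ outerCenters G X ctr) :
    (∀ a b, a ∈ {v | InCore G X v} ∪ outerCenters G X ctr →
      b ∈ {v | InCore G X v} ∪ outerCenters G X ctr → G.Adj v a → G.Adj v b → a = b) ∧
    (IsOrdinary G X ctr v → ∀ a ∈ {v | InCore G X v} ∪ outerCenters G X ctr, G.Adj v a →
      a ∈ X) := by
  have hvX : v ∉ X := fun h => hv.1 (.inl h)
  have hX : IsOrdinary G X ctr v → ∀ a ∈ {v | InCore G X v} ∪ outerCenters G X ctr,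
      G.Adj v a → a ∈ X := by
    intro ho a ha hva
    by_contra haX
    have hctr := hs.ctr_eq hvX haX hva
    have hoa := (IsStarCenter.isOrdinary_congr hctr).mp ho
    have hvc := hv.2.resolve_right (fun h => h ho)
    rcases ha with ha | ha
    · exact hs.not_inCore haX hoa ha
    · have hac := ha.2.resolve_right (fun h => h hoa)
      exact hva.ne (by rw [hvc, hctr, ← hac])
  refine ⟨fun a b ha hb hva hvb => ?_, hX⟩
  by_cases ho : IsOrdinary G X ctr v
  · exact ho.eq_of_adj hvX (hX ho a ha hva) (hX ho b hb hvb) hva hvb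
  · exact hs.eq_of_adj_of_not_inCore hv.1 ho hva hvb

/-- A pendant edge does not destroy the positions of the others: walks between vertices of `X` do
not use it. -/
theorem HasSlots.insert_pendant {W : Set V} {l₁ l₂ : List (V × V)}
    (h : HasSlots G X (l₁ ++ l₂)) (hW : IsGoodOrder G W (l₁ ++ l₂)) (hXW : ↑X ⊆ W) {v a : V}
    (hv : v ∉ W) : HasSlots G X (l₁ ++ (v, a) :: l₂) := by
  intro c z hc hz hcz
  obtain ⟨m₁, m₂, hm, hcount⟩ := h c z hc hz hcz
  have h₁ : ∀ e ∈ l₁, e.1 ∈ W ∧ e.2 ∈ W := fun e he => hW.mem e (by simp [he])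
  have h₂ : ∀ e ∈ l₂, e.1 ∈ W ∧ e.2 ∈ W := fun e he => hW.mem e (by simp [he])
  rcases List.append_eq_append_iff.mp hm with ⟨r, rfl, rfl⟩ | ⟨r, rfl, rfl⟩
  · refine ⟨l₁ ++ (v, a) :: r, m₂, by simp, fun x hx hd => ⟨?_, (hcount x hx hd).2⟩⟩
    rw [walkCount_insert_pendant h₁ (fun e he => h₂ e (by simp [he])) hv (hXW hx) (hXW hz)]
    exact (hcount x hx hd).1
  · refine ⟨m₁, r ++ (v, a) :: l₂, by simp, fun x hx hd => ⟨(hcount x hx hd).1, ?_⟩⟩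
    rw [walkCount_insert_pendant (fun e he => h₁ e (by simp [he])) h₂ hv (hXW hz) (hXW hx)]
    exact (hcount x hx hd).2

/-- All vertices of `outerCenters` can be inserted, each with at most one edge. If the vertex is
the center of an ordinary star, this edge goes to the position that `HasSlots` provides. -/
theorem IsStarCenter.exists_extend_centers (hs : IsStarCenter G X ctr)
    (hf : FewCommonNeighbors G) {l : List (V × V)} (h : IsGoodOrder G {v | InCore G X v} l)
    (hl : HasSlots G X l) (S : Finset V) (hS : ↑S ⊆ outerCenters G X ctr) :
    ∃ l, IsGoodOrder G ({v | InCore G X v} ∪ ↑S) l ∧ HasSlots G X l ∧ HasRoom G X ctr ↑S l := by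
  induction S using Finset.induction_on with
  | empty => exact ⟨l, by simpa using h, hl, fun c hc => by simp at hc⟩
  | insert v S hvS ih =>
    obtain ⟨l, h, hl, hr⟩ := ih fun x hx => hS (by simp [Finset.mem_coe.mp hx])
    have hvC : v ∈ outerCenters G X ctr := hS (by simp)
    have hvX : v ∉ X := fun h => hvC.1 (.inl h)
    obtain ⟨huniq, hordX⟩ := hs.outerCenters_adj hvC
    set W : Set V := {v | InCore G X v} ∪ ↑S with hWdef
    have hWC : W ⊆ {v | InCore G X v} ∪ outerCenters G X ctr :=
      Set.union_subset_union_right _ fun x hx => hS (by simp [Finset.mem_coe.mp hx])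
    have hvW : v ∉ W := by
      rintro (h | h)
      · exact hvC.1 h
      · exact hvS (Finset.mem_coe.mp h)
    have hXW : ↑X ⊆ W := fun x hx => .inl (.inl hx)
    have hSW : ↑S ⊆ W := Set.subset_union_right
    have hins : {v | InCore G X v} ∪ ↑(insert v S) = insert v W := by
      rw [Finset.coe_insert, Set.union_insert]
    rw [hins]
    by_cases hex : ∃ a ∈ W, G.Adj v a
    · obtain ⟨a, ha, hva⟩ := hex
      obtain ⟨l₁, l₂, rfl, hsplit⟩ : ∃ l₁ l₂, l = l₁ ++ l₂ ∧ (a ∈ X →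
          ∀ x ∈ X, IsDoubled G X v x → walkCount l₁ x a = 0 ∧ walkCount l₂ a x = 0) := by
        by_cases haX : a ∈ X
        · obtain ⟨l₁, l₂, h1, h2⟩ := hl v a hvC.1 haX hva
          exact ⟨l₁, l₂, h1, fun _ => h2⟩
        · exact ⟨l, [], by simp, fun h => absurd h haX⟩
      have h₁ : ∀ e ∈ l₁, e.1 ∈ W ∧ e.2 ∈ W := fun e he => h.mem e (by simp [he])
      have h₂ : ∀ e ∈ l₂, e.1 ∈ W ∧ e.2 ∈ W := fun e he => h.mem e (by simp [he])
      refine ⟨l₁ ++ (v, a) :: l₂, h.insert_pendant hvW ha hva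
        (fun b hb hvb => huniq b a (hWC hb) (hWC ha) hvb hva), hl.insert_pendant h hXW hvW, ?_⟩
      intro c hc ho y hy p hp hcp hpy
      rcases Finset.mem_insert.mp (Finset.mem_coe.mp hc) with rfl | hc
      · have haX : a ∈ X := hordX ho a (hWC ha) hva
        rw [walkCount_insert_pendant_right h₁ h₂ hvW (hXW hy),
          walkCount_insert_pendant_left h₁ h₂ hvW (hXW hy)]
        refine ⟨?_, hsplit haX y hy⟩
        by_contra hno
        push Not at hno
        have hya : y ≠ a := by
          rintro rfl
          exact hf.triangle c p y hcp hva hpy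
        have := two_le_walkCount_self l₁ l₂ hya hno.1 hno.2
        have := h.count y y
        omega
      · rw [walkCount_insert_pendant h₁ h₂ hvW (hXW hy) (hSW (Finset.mem_coe.mpr hc)),
          walkCount_insert_pendant h₁ h₂ hvW (hSW (Finset.mem_coe.mpr hc)) (hXW hy)]
        exact hr c (Finset.mem_coe.mpr hc) ho y hy p hp hcp hpy
    · push Not at hex
      refine ⟨l, h.insert_isolated hex, hl, fun c hc ho y hy p hp hcp hpy => ?_⟩
      rcases Finset.mem_insert.mp (Finset.mem_coe.mp hc) with rfl | hc
      · have hne : y ≠ c := fun e => hvX (e ▸ hy)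
        rw [walkCount_outside_left h.mem hvW, walkCount_outside_right h.mem hvW, if_neg hne,
          if_neg hne.symm]
        simp
      · exact hr c (Finset.mem_coe.mpr hc) ho y hy p hp hcp hpy

/-- The version of `HasRoom` for a list in which the leaves in `S` have already been inserted: it
speaks only of the leaves outside `S`. -/
def HasRoomOutside (G : SimpleGraph V) (X : Finset V) (ctr : V → V) (S : Set V)
    (l : List (V × V)) : Prop :=
  ∀ c ∈ outerCenters G X ctr, IsOrdinary G X ctr c → ∀ y ∈ X, ∀ p, p ∉ X → p ∉ S → G.Adj c p →
    G.Adj p y → (walkCount l y c = 0 ∨ walkCount l c y = 0) ∧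
    ∀ q, q ∉ X → q ∉ S → q ≠ p → G.Adj c q → G.Adj q y →
      walkCount l y c = 0 ∧ walkCount l c y = 0

/-- The remaining vertices are leaves of ordinary stars, and are adjacent to the center and to at
most one vertex of `X`. They can be inserted one after the other: an insertion by
`IsGoodOrder.insert_leaf` creates a single new walk between old vertices, from `a` to `b`, and at
most one further leaf is adjacent to the same two vertices. -/
theorem IsStarCenter.exists_extend_leaves (hs : IsStarCenter G X ctr)
    (hf : FewCommonNeighbors G) {l : List (V × V)}
    (h : IsGoodOrder G ({v | InCore G X v} ∪ outerCenters G X ctr) l)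
    (hr : HasRoom G X ctr (outerCenters G X ctr) l) (S : Finset V)
    (hS : ∀ v ∈ S, v ∉ {v | InCore G X v} ∪ outerCenters G X ctr) :
    ∃ l, IsGoodOrder G ({v | InCore G X v} ∪ outerCenters G X ctr ∪ ↑S) l ∧
      HasRoomOutside G X ctr ↑S l := by
  induction S using Finset.induction_on with
  | empty =>
    refine ⟨l, by simpa using h, fun c hc ho y hy p hp _ hcp hpy => ?_⟩
    obtain ⟨h1, h2⟩ := hr c hc ho y hy p hp hcp hpy
    exact ⟨h1, fun q hq _ hqp hcq hqy => h2 ⟨p, q, hqp.symm, hp, hq, hcp, hpy, hcq, hqy⟩⟩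
  | insert v S hvS ih =>
    obtain ⟨l, h, hr⟩ := ih fun x hx => hS x (by simp [hx])
    have hv := hS v (by simp)
    have hvB : ¬ InCore G X v := fun h => hv (.inl h)
    have hvX : v ∉ X := fun h => hvB (.inl h)
    have hvo : IsOrdinary G X ctr v := by by_contra ho; exact hv (.inr ⟨hvB, .inr ho⟩)
    have hvc : v ≠ ctr v := fun hc => hv (.inr ⟨hvB, .inl hc⟩)
    have hvadj := hs.adj_ctr hvX hvc
    have hcX := hs.notMem v hvX
    have hidem := hs.idem v hvX
    have hco : IsOrdinary G X ctr (ctr v) := (IsStarCenter.isOrdinary_congr hidem).mpr hvo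
    have hcC : ctr v ∈ outerCenters G X ctr := ⟨hs.not_inCore hcX hco, .inl hidem.symm⟩
    set W : Set V := {v | InCore G X v} ∪ outerCenters G X ctr ∪ ↑S with hWdef
    have hvW : v ∉ W := by
      rintro (h | h)
      · exact hv h
      · exact hvS (Finset.mem_coe.mp h)
    have hXW : ↑X ⊆ W := fun x hx => .inl (.inl (.inl hx))
    have hCW : outerCenters G X ctr ⊆ W := fun x hx => .inl (.inr hx)
    have hins : {v | InCore G X v} ∪ outerCenters G X ctr ∪ ↑(insert v S) = insert v W := by
      rw [Finset.coe_insert, Set.union_insert]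
    rw [hins]
    have hnotS : ∀ {p}, p ∉ (↑(insert v S) : Set V) → p ≠ v ∧ p ∉ (↑S : Set V) := by
      intro p hp
      simpa [not_or] using hp
    by_cases hex : ∃ y ∈ X, G.Adj v y
    · obtain ⟨y, hy, hvy⟩ := hex
      have hyc : y ≠ ctr v := fun e => hcX (e ▸ hy)
      obtain ⟨hroom, hroom'⟩ := hr (ctr v) hcC hco y hy v hvX
        (fun h => hvS (Finset.mem_coe.mp h)) hvadj.symm hvy
      have huniq : ∀ b ∈ W, G.Adj v b → b = y ∨ b = ctr v := by
        intro b _ hvb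
        by_cases hb : b ∈ X
        · exact .inl (hvo.eq_of_adj hvX hb hy hvb hvy)
        · exact .inr (hs.eq_ctr_of_adj hvX hb hvb hvc)
      -- The direction in which there is still room.
      obtain ⟨a, b, hab, h0⟩ : ∃ a b, (a = y ∧ b = ctr v ∨ a = ctr v ∧ b = y) ∧
          walkCount l a b = 0 := by
        rcases hroom with h0 | h0
        · exact ⟨_, _, .inl ⟨rfl, rfl⟩, h0⟩
        · exact ⟨_, _, .inr ⟨rfl, rfl⟩, h0⟩
      have hgood : IsGoodOrder G (insert v W) ((v, a) :: (l ++ [(v, b)])) := by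
        rcases hab with ⟨rfl, rfl⟩ | ⟨rfl, rfl⟩
        · exact h.insert_leaf hvW (hXW hy) (hCW hcC) hyc hvy hvadj h0 huniq
        · exact h.insert_leaf hvW (hCW hcC) (hXW hy) hyc.symm hvadj hvy h0
            fun c hc hvc => (huniq c hc hvc).symm
      refine ⟨_, hgood, fun c hc ho y' hy' p hp hpS hcp hpy' => ?_⟩
      obtain ⟨hpv, hpS⟩ := hnotS hpS
      have hcX' : c ∉ X := fun h => hc.1 (.inl h)
      have hold := hr c hc ho y' hy' p hp hpS hcp hpy'
      have hcount : ∀ p q, p ∈ W → q ∈ W → ¬ (p = a ∧ q = b) →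
          walkCount ((v, a) :: (l ++ [(v, b)])) p q = walkCount l p q := fun p q hp hq hne =>
        walkCount_insert_leaf_of_ne h.mem hvW hp hq hne
      have hyW := hXW hy'
      have hcW := hCW hc
      by_cases hsame : c = ctr v ∧ y' = y
      · obtain ⟨rfl, rfl⟩ := hsame
        obtain ⟨h1, h2⟩ := hroom' p hp hpS hpv hcp hpy'
        refine ⟨?_, fun q hq hqS hqp hcq hqy => ?_⟩
        · rcases hab with ⟨rfl, rfl⟩ | ⟨rfl, rfl⟩
          · right
            rw [hcount _ _ hcW hyW fun e => hyc e.2]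
            exact h2
          · left
            rw [hcount _ _ hyW hcW fun e => hyc e.1]
            exact h1
        · obtain ⟨hqv, -⟩ := hnotS hqS
          rcases hf.common (ctr v) y' hyc.symm v p q hvadj.symm hvy.symm hcp hpy'.symm hcq
            hqy.symm with e | e | e
          · exact absurd e.symm hpv
          · exact absurd e.symm hqv
          · exact absurd e.symm hqp
      · have hyc' : y' ≠ ctr v := fun e => hcX (e ▸ hy')
        have hcy' : c ≠ y := fun e => hcX' (e ▸ hy)
        have e1 := hcount y' c hyW hcW (by
          rintro ⟨h1, h2⟩
          rcases hab with ⟨rfl, rfl⟩ | ⟨rfl, rfl⟩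
          · exact hsame ⟨h2, h1⟩
          · exact hyc' h1)
        have e2 := hcount c y' hcW hyW (by
          rintro ⟨h1, h2⟩
          rcases hab with ⟨rfl, rfl⟩ | ⟨rfl, rfl⟩
          · exact hcy' h1
          · exact hsame ⟨h1, h2⟩)
        rw [e1, e2]
        exact ⟨hold.1, fun q hq hqS => hold.2 q hq (hnotS hqS).2⟩
    · push Not at hex
      have huniq : ∀ b ∈ W, G.Adj v b → b = ctr v := fun b _ hvb =>
        hs.eq_ctr_of_adj hvX (fun hb => hex b hb hvb) hvb hvc
      have h' : IsGoodOrder G W (l ++ []) := by simpa using h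
      refine ⟨_, h'.insert_pendant hvW (hCW hcC) hvadj huniq, ?_⟩
      intro c hc ho y hy p hp hpS hcp hpy
      rw [walkCount_insert_pendant h.mem (by simp) hvW (hXW hy) (hCW hc),
        walkCount_insert_pendant h.mem (by simp) hvW (hCW hc) (hXW hy), List.append_nil]
      have hold := hr c hc ho y hy p hp (hnotS hpS).2 hcp hpy
      exact ⟨hold.1, fun q hq hqS => hold.2 q hq (hnotS hqS).2⟩

/-- A good order of the kernel extends to a good order of the whole graph. -/
theorem IsStarCenter.exists_isGoodOrder_of_kernel [LinearOrder V] (hs : IsStarCenter G X ctr)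
    (hf : FewCommonNeighbors G) {l : List (V × V)}
    (h : IsGoodOrder G {v | InKernel G X v} l) : ∃ l, IsGoodOrder G Set.univ l := by
  classical
  obtain ⟨l, h, hl⟩ := h.exists_core hf
  obtain ⟨l, h, -, hr⟩ := hs.exists_extend_centers hf h hl (outerCenters G X ctr).toFinset (by simp)
  rw [Set.coe_toFinset] at h hr
  obtain ⟨l, h, -⟩ := hs.exists_extend_leaves hf h hr
    ({v | InCore G X v} ∪ outerCenters G X ctr)ᶜ.toFinset (by simp)
  rw [Set.coe_toFinset, Set.union_compl_self] at h
  exact ⟨l, h⟩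

end Extension

/-! ### The size of the kernel -/

section KernelSize

variable {V : Type*} [Fintype V] [DecidableEq V] {G : SimpleGraph V} {X : Finset V} {ctr : V → V}

open Classical in
/-- The common neighbors of two vertices. -/
noncomputable def commonNbrs (G : SimpleGraph V) (a b : V) : Finset V :=
  Finset.univ.filter fun v => G.Adj a v ∧ G.Adj b v

theorem FewCommonNeighbors.card_commonNbrs_le (hf : FewCommonNeighbors G) {a b : V} (hab : a ≠ b) :
    (commonNbrs G a b).card ≤ 2 := by
  by_contra h
  push Not at h
  obtain ⟨p, q, r, hp, hq, hr, hpq, hpr, hqr⟩ := Finset.two_lt_card_iff.mp h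
  simp only [commonNbrs, Finset.mem_filter, Finset.mem_univ, true_and] at hp hq hr
  rcases hf.common a b hab p q r hp.1 hp.2 hq.1 hq.2 hr.1 hr.2 with h | h | h
  · exact hpq h
  · exact hpr h
  · exact hqr h

open Classical in
/-- Special vertices are common neighbors of two vertices of `X`. -/
theorem FewCommonNeighbors.card_special_le (hf : FewCommonNeighbors G) :
    (Finset.univ.filter (IsSpecial G X)).card ≤ 2 * X.card ^ 2 := by
  have hsub : Finset.univ.filter (IsSpecial G X) ⊆
      ((X ×ˢ X).filter fun e => e.1 ≠ e.2).biUnion fun e => commonNbrs G e.1 e.2 := by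
    intro v hv
    obtain ⟨-, x, y, hxy, hx, hy, hvx, hvy⟩ := (Finset.mem_filter.mp hv).2
    refine Finset.mem_biUnion.mpr ⟨(x, y), by simp [hx, hy, hxy], ?_⟩
    simp [commonNbrs, hvx.symm, hvy.symm]
  calc _ ≤ _ := Finset.card_le_card hsub
    _ ≤ ((X ×ˢ X).filter fun e => e.1 ≠ e.2).card * 2 :=
        Finset.card_biUnion_le_card_mul _ _ _ fun e he =>
          hf.card_commonNbrs_le (Finset.mem_filter.mp he).2
    _ ≤ (X ×ˢ X).card * 2 := Nat.mul_le_mul_right _ (Finset.card_filter_le _ _)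
    _ = 2 * X.card ^ 2 := by rw [Finset.card_product]; ring

open Classical in
/-- A star has at most `2k + 1` vertices of degree at least two: a leaf of degree two is a common
neighbor of the center and of a vertex of `X`. -/
theorem IsStarCenter.card_core_le (hs : IsStarCenter G X ctr) (hf : FewCommonNeighbors G) :
    (Finset.univ.filter (InCore G X)).card ≤ X.card + 2 * X.card ^ 2 * (1 + 2 * X.card) := by
  have hsub : Finset.univ.filter (InCore G X) ⊆ X ∪
      (Finset.univ.filter (IsSpecial G X)).biUnion fun s =>
        insert (ctr s) (X.biUnion fun x => commonNbrs G (ctr s) x) := by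
    intro v hv
    by_cases hvX : v ∈ X
    · exact Finset.mem_union_left _ hvX
    refine Finset.mem_union_right _ ?_
    obtain ⟨⟨s, hsp, hss⟩, a, b, hab, hva, hvb⟩ := ((Finset.mem_filter.mp hv).2).resolve_left hvX
    refine Finset.mem_biUnion.mpr ⟨s, by simp [hsp], ?_⟩
    have hctr := (hs.sameStar_iff hvX hsp.1).mp hss
    rw [← hctr]
    by_cases hvc : v = ctr v
    · exact Finset.mem_insert.mpr (.inl hvc)
    refine Finset.mem_insert_of_mem ?_
    have hvadj := hs.adj_ctr hvX hvc
    obtain ⟨x, hx, hvx⟩ : ∃ x ∈ X, G.Adj v x := by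
      by_contra hno
      push Not at hno
      exact hab ((hs.eq_ctr_of_adj hvX (fun h => hno a h hva) hva hvc).trans
        (hs.eq_ctr_of_adj hvX (fun h => hno b h hvb) hvb hvc).symm)
    exact Finset.mem_biUnion.mpr ⟨x, hx, by simp [commonNbrs, hvadj.symm, hvx.symm]⟩
  calc _ ≤ _ := Finset.card_le_card hsub
    _ ≤ _ := Finset.card_union_le _ _
    _ ≤ X.card + (Finset.univ.filter (IsSpecial G X)).card * (1 + 2 * X.card) := by
        refine Nat.add_le_add_left (Finset.card_biUnion_le_card_mul _ _ _ fun s hsp => ?_) _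
        refine (Finset.card_insert_le _ _).trans ?_
        have : (X.biUnion fun x => commonNbrs G (ctr s) x).card ≤ X.card * 2 :=
          Finset.card_biUnion_le_card_mul _ _ _ fun x hx => hf.card_commonNbrs_le fun h =>
            hs.notMem s (Finset.mem_filter.mp hsp).2.1 (h ▸ hx)
        omega
    _ ≤ _ := Nat.add_le_add_left (Nat.mul_le_mul_right _ hf.card_special_le) _

theorem IsFirstWitness.eq [LinearOrder V] {z x y c c' : V} (h : IsFirstWitness G X z x y c)
    (h' : IsFirstWitness G X z x y c') : c = c' := by
  rcases lt_trichotomy c c' with hlt | rfl | hlt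
  · exact absurd ⟨c, hlt, h.1⟩ h'.2
  · rfl
  · exact absurd ⟨c', hlt, h'.1⟩ h.2

open Classical in
/-- A witness of a triple brings itself and at most two leaves for each of `x` and `y`. -/
theorem FewCommonNeighbors.card_witness_le [LinearOrder V] (hf : FewCommonNeighbors G) :
    (Finset.univ.filter fun v => ∃ z x y c, IsFirstWitness G X z x y c ∧
      (v = c ∨ v ∉ X ∧ G.Adj c v ∧ (G.Adj v x ∨ G.Adj v y))).card ≤ 5 * X.card ^ 3 := by
  set A : V × V × V → Finset V := fun e => Finset.univ.filter fun v =>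
    ∃ c, IsFirstWitness G X e.1 e.2.1 e.2.2 c ∧
      (v = c ∨ v ∉ X ∧ G.Adj c v ∧ (G.Adj v e.2.1 ∨ G.Adj v e.2.2)) with hA
  have hsub : (Finset.univ.filter fun v => ∃ z x y c, IsFirstWitness G X z x y c ∧
      (v = c ∨ v ∉ X ∧ G.Adj c v ∧ (G.Adj v x ∨ G.Adj v y))) ⊆ (X ×ˢ X ×ˢ X).biUnion A := by
    intro v hv
    obtain ⟨z, x, y, c, hc, hvc⟩ := (Finset.mem_filter.mp hv).2
    refine Finset.mem_biUnion.mpr ⟨(z, x, y), ?_, Finset.mem_filter.mpr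
      ⟨Finset.mem_univ _, c, hc, hvc⟩⟩
    simp [hc.1.1]
  have hcard : ∀ e ∈ X ×ˢ X ×ˢ X, (A e).card ≤ 5 := by
    rintro ⟨z, x, y⟩ he
    by_cases hex : ∃ c, IsFirstWitness G X z x y c
    · obtain ⟨c, hc⟩ := hex
      have hsub : A (z, x, y) ⊆ {c} ∪ (commonNbrs G c x ∪ commonNbrs G c y) := by
        intro v hv
        obtain ⟨c', hc', hvc⟩ := (Finset.mem_filter.mp hv).2
        obtain rfl := hc'.eq hc
        rcases hvc with rfl | ⟨-, h1, h2 | h2⟩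
        · simp
        · simp [commonNbrs, h1, G.adj_symm h2]
        · simp [commonNbrs, h1, G.adj_symm h2]
      have hcX := hc.1.2.1
      have h1 := hf.card_commonNbrs_le (a := c) (b := x) fun h => hcX (h ▸ hc.1.1.2.1)
      have h2 := hf.card_commonNbrs_le (a := c) (b := y) fun h => hcX (h ▸ hc.1.1.2.2)
      calc _ ≤ _ := Finset.card_le_card hsub
        _ ≤ _ := Finset.card_union_le _ _
        _ ≤ 1 + _ := Nat.add_le_add_left (Finset.card_union_le _ _) _
        _ ≤ 5 := by omega
    · have : A (z, x, y) = ∅ := by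
        refine Finset.filter_eq_empty_iff.mpr fun v _ => ?_
        rintro ⟨c, hc, -⟩
        exact hex ⟨c, hc⟩
      simp [this]
  calc _ ≤ _ := Finset.card_le_card hsub
    _ ≤ (X ×ˢ X ×ˢ X).card * 5 := Finset.card_biUnion_le_card_mul _ _ _ hcard
    _ = 5 * X.card ^ 3 := by rw [Finset.card_product, Finset.card_product]; ring

open Classical in
theorem IsStarCenter.card_kernel_le [LinearOrder V] (hs : IsStarCenter G X ctr)
    (hf : FewCommonNeighbors G) :
    (Finset.univ.filter (InKernel G X)).card ≤ 12 * X.card ^ 3 := by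
  have h1 := hs.card_core_le hf
  have h2 := hf.card_witness_le (X := X)
  have h3 : (Finset.univ.filter (InKernel G X)).card ≤
      (X.card + 2 * X.card ^ 2 * (1 + 2 * X.card)) + 5 * X.card ^ 3 := by
    refine le_trans ?_ (Nat.add_le_add h1 h2)
    refine le_trans (Finset.card_le_card fun v hv => ?_) (Finset.card_union_le _ _)
    rcases (Finset.mem_filter.mp hv).2 with h | h
    · exact Finset.mem_union_left _ (by simpa using h)
    · exact Finset.mem_union_right _ (by simpa using h)
  have h4 : X.card ≤ X.card ^ 3 := Nat.le_self_pow (by norm_num) _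
  have h5 : X.card ^ 2 ≤ X.card ^ 3 := by
    rcases Nat.eq_zero_or_pos X.card with h | h
    · simp [h]
    · exact Nat.pow_le_pow_right h (by norm_num)
  have h6 : 2 * X.card ^ 2 * (1 + 2 * X.card) = 2 * X.card ^ 2 + 4 * X.card ^ 3 := by ring
  omega

/-- Each edge of the kernel is inside `X`, or joins `X` with a special vertex, or joins a vertex
outside `X` with its center or with its only neighbor in `X`. With at most `12 * k ^ 3` vertices and
`2 * k ^ 2` special ones, this gives the bound `k ^ 2 + 4 * k ^ 3 + 4 * 12 * k ^ 3`. -/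
theorem IsStarCenter.card_kernel_edges_le [LinearOrder V] (hs : IsStarCenter G X ctr)
    (hf : FewCommonNeighbors G) {E : Finset (V × V)}
    (hE : ∀ e ∈ E, G.Adj e.1 e.2 ∧ InKernel G X e.1 ∧ InKernel G X e.2) :
    E.card ≤ 53 * X.card ^ 3 := by
  classical
  set S := Finset.univ.filter (IsSpecial G X) with hS
  set K := Finset.univ.filter (InKernel G X) with hK
  -- A chosen neighbor in `X`.
  let g : V → V := fun v => if h : ∃ x ∈ X, G.Adj v x then h.choose else v
  have hg : ∀ v x, v ∉ X → ¬ IsSpecial G X v → x ∈ X → G.Adj v x → x = g v := by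
    intro v x hv hsp hx hvx
    have h : ∃ x ∈ X, G.Adj v x := ⟨x, hx, hvx⟩
    by_contra hne
    simp only [g, h, dif_pos] at hne
    exact hsp ⟨hv, x, _, hne, hx, h.choose_spec.1, hvx, h.choose_spec.2⟩
  have hsub : E ⊆ (X ×ˢ X) ∪ ((X ×ˢ S) ∪ (S ×ˢ X)) ∪
      K.biUnion fun v => {(v, ctr v), (ctr v, v), (v, g v), (g v, v)} := by
    rintro ⟨a, b⟩ he
    obtain ⟨hab, ha, hb⟩ := hE _ he
    simp only at hab ha hb
    have haK : a ∈ K := by simpa [hK] using ha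
    have hbK : b ∈ K := by simpa [hK] using hb
    by_cases haX : a ∈ X
    · by_cases hbX : b ∈ X
      · exact Finset.mem_union_left _ (Finset.mem_union_left _ (by simp [haX, hbX]))
      · by_cases hbS : IsSpecial G X b
        · exact Finset.mem_union_left _ (Finset.mem_union_right _ (by simp [haX, hS, hbS]))
        · refine Finset.mem_union_right _ (Finset.mem_biUnion.mpr ⟨b, hbK, ?_⟩)
          simp [← hg b a hbX hbS haX hab.symm]
    · by_cases hbX : b ∈ X
      · by_cases haS : IsSpecial G X a
        · exact Finset.mem_union_left _ (Finset.mem_union_right _ (by simp [hbX, hS, haS]))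
        · refine Finset.mem_union_right _ (Finset.mem_biUnion.mpr ⟨a, haK, ?_⟩)
          simp [← hg a b haX haS hbX hab]
      · obtain ⟨h1, -, h2 | h2⟩ := (hs.adj_iff a b haX hbX).mp hab
        · refine Finset.mem_union_right _ (Finset.mem_biUnion.mpr ⟨b, hbK, ?_⟩)
          simp [← h1, ← h2]
        · refine Finset.mem_union_right _ (Finset.mem_biUnion.mpr ⟨a, haK, ?_⟩)
          simp [h1, ← h2]
  have hcard4 : ∀ v ∈ K, ({(v, ctr v), (ctr v, v), (v, g v), (g v, v)} : Finset (V × V)).card ≤ 4 :=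
    fun v _ => Finset.card_le_four
  have h1 : S.card ≤ 2 * X.card ^ 2 := hf.card_special_le (X := X)
  have h2 : K.card ≤ 12 * X.card ^ 3 := hs.card_kernel_le hf
  have h3 : E.card ≤ X.card * X.card + (X.card * S.card + S.card * X.card) + K.card * 4 := by
    refine (Finset.card_le_card hsub).trans ((Finset.card_union_le _ _).trans ?_)
    refine Nat.add_le_add ((Finset.card_union_le _ _).trans ?_)
      (Finset.card_biUnion_le_card_mul _ _ _ hcard4)
    rw [Finset.card_product]
    refine Nat.add_le_add_left ((Finset.card_union_le _ _).trans ?_) _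
    rw [Finset.card_product, Finset.card_product]
  have h4 : X.card * S.card ≤ 2 * X.card ^ 3 :=
    (Nat.mul_le_mul_left X.card h1).trans (by ring_nf; exact le_rfl)
  have h5 : S.card * X.card ≤ 2 * X.card ^ 3 := by rw [mul_comm]; exact h4
  have h6 : X.card * X.card ≤ X.card ^ 3 := by
    rcases Nat.eq_zero_or_pos X.card with h | h
    · simp [h]
    · calc X.card * X.card = X.card ^ 2 := by ring
        _ ≤ X.card ^ 3 := Nat.pow_le_pow_right h (by norm_num)
  omega

end KernelSize

/-! ### Reasoning about programs -/

section Programs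

/-- Started in `s`, the program halts within `T` units of time, in a state that satisfies `Q`. -/
def RamProg.Runs (P : RamProg) (s : RamState) (T : ℕ) (Q : RamState → Prop) : Prop :=
  ∃ t s', P.Exec s t s' ∧ t ≤ T ∧ Q s'

@[simp] theorem RamState.setReg_reg (s : RamState) (i v j : ℕ) :
    (s.setReg i v).reg j = if j = i then v else s.reg j := by
  simp [RamState.setReg, Function.update_apply]

@[simp] theorem RamState.setReg_arr (s : RamState) (i v : ℕ) : (s.setReg i v).arr = s.arr := rfl

@[simp] theorem RamState.setArr_reg (s : RamState) (a j v : ℕ) : (s.setArr a j v).reg = s.reg := rfl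

@[simp] theorem RamState.setArr_arr (s : RamState) (a j v b : ℕ) :
    (s.setArr a j v).arr b = if b = a then Function.update (s.arr a) j v else s.arr b := by
  simp [RamState.setArr, Function.update_apply]

namespace RamProg

theorem Runs.mono {P : RamProg} {s : RamState} {T T' : ℕ} {Q Q' : RamState → Prop}
    (h : P.Runs s T Q) (hT : T ≤ T') (hQ : ∀ s', Q s' → Q' s') : P.Runs s T' Q' := by
  obtain ⟨t, s', he, ht, hq⟩ := h
  exact ⟨t, s', he, ht.trans hT, hQ s' hq⟩

theorem runs_skip {s : RamState} {Q : RamState → Prop} (h : Q s) : skip.Runs s 1 Q :=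
  ⟨1, s, .skip s, le_rfl, h⟩

theorem runs_setReg {i : ℕ} {e : RamExpr} {s : RamState} {Q : RamState → Prop}
    (h : Q (s.setReg i (e.eval s))) : (setReg i e).Runs s (e.cost + 1) Q :=
  ⟨_, _, .setReg i e s, le_rfl, h⟩

theorem runs_setArr {a : ℕ} {e f : RamExpr} {s : RamState} {Q : RamState → Prop}
    (h : Q (s.setArr a (e.eval s) (f.eval s))) : (setArr a e f).Runs s (e.cost + f.cost + 1) Q :=
  ⟨_, _, .setArr a e f s, le_rfl, h⟩

theorem runs_seq {P R : RamProg} {s : RamState} {T T' : ℕ} {Q : RamState → Prop}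
    (h : P.Runs s T fun s' => R.Runs s' T' Q) : (seq P R).Runs s (T + T') Q := by
  obtain ⟨t, s', he, ht, t', s'', he', ht', hq⟩ := h
  exact ⟨_, _, .seq he he', Nat.add_le_add ht ht', hq⟩

theorem runs_ite {e : RamExpr} {P R : RamProg} {s : RamState} {T : ℕ} {Q : RamState → Prop}
    (h : e.eval s ≠ 0 → P.Runs s T Q) (h' : e.eval s = 0 → R.Runs s T Q) :
    (ite e P R).Runs s (e.cost + T + 1) Q := by
  by_cases he : e.eval s = 0
  · obtain ⟨t, s', hx, ht, hq⟩ := h' he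
    exact ⟨_, _, .ite_false he hx, by omega, hq⟩
  · obtain ⟨t, s', hx, ht, hq⟩ := h he
    exact ⟨_, _, .ite_true he hx, by omega, hq⟩

/-- The loop "for `i` from `0` to `r - 1` do `P`", with the counter in register `i` and the bound in
register `r`. The program `P` must change neither of them. -/
def forLoop (i r : ℕ) (P : RamProg) : RamProg :=
  seq (setReg i (.const 0))
    (loop (.sub (.reg r) (.reg i)) (seq P (setReg i (.add (.reg i) (.const 1)))))

/-- The rule for loops: `I j` is the invariant at the start of round `j`, of `n` rounds. Besides the
time `T` of the body, a round takes four units for the test and four for the counter. -/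
theorem runs_forLoop {i r n T : ℕ} {P : RamProg} {s : RamState} {Q : RamState → Prop}
    (I : ℕ → RamState → Prop) (hI : ∀ j s, I j s → s.reg i = j ∧ s.reg r = n)
    (h0 : I 0 (s.setReg i 0))
    (step : ∀ j s, j < n → I j s → P.Runs s T fun s' => I (j + 1) (s'.setReg i (s'.reg i + 1)))
    (hQ : ∀ s, I n s → Q s) : (forLoop i r P).Runs s (n * (T + 8) + 6) Q := by
  have key : ∀ m j s, j + m = n → I j s →
      (loop (.sub (.reg r) (.reg i)) (seq P (setReg i (.add (.reg i) (.const 1))))).Runs s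
        (m * (T + 8) + 4) Q := by
    intro m
    induction m with
    | zero =>
      intro j s hj hs
      obtain ⟨h1, h2⟩ := hI j s hs
      obtain rfl : j = n := by omega
      exact ⟨_, s, .loop_done (by simp [RamExpr.eval, h1, h2]), by simp [RamExpr.cost], hQ s hs⟩
    | succ m ih =>
      intro j s hj hs
      obtain ⟨h1, h2⟩ := hI j s hs
      obtain ⟨t, s', he, ht, hq⟩ := step j s (by omega) hs
      obtain ⟨t', s'', he', ht', hq'⟩ := ih (j + 1) _ (by omega) hq
      have hne : (RamExpr.sub (.reg r) (.reg i)).eval s ≠ 0 := by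
        simp only [RamExpr.eval, h1, h2]; omega
      refine ⟨_, s'', .loop_step hne (.seq he (.setReg i _ s')) he', ?_, hq'⟩
      simp only [RamExpr.cost]
      have : (m + 1) * (T + 8) = m * (T + 8) + T + 8 := by ring
      omega
  have := runs_seq (P := setReg i (.const 0)) (T := 2) (runs_setReg (s := s)
    (Q := fun s' => (loop (.sub (.reg r) (.reg i))
      (seq P (setReg i (.add (.reg i) (.const 1))))).Runs s' (n * (T + 8) + 4) Q)
    (key n 0 _ (by omega) h0))
  exact this.mono (by omega) fun _ h => h

end RamProg

/-- Polynomially bounded functions. -/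
def PolyBounded (f : ℕ → ℕ) : Prop := ∃ c, ∀ n, f n ≤ c * (n + 1) ^ c

theorem PolyBounded.const (c : ℕ) : PolyBounded fun _ => c :=
  ⟨c, fun n => Nat.le_mul_of_pos_right _ (by positivity)⟩

theorem PolyBounded.id : PolyBounded fun n => n := ⟨1, fun n => by simp⟩

theorem PolyBounded.add {f g : ℕ → ℕ} (hf : PolyBounded f) (hg : PolyBounded g) :
    PolyBounded fun n => f n + g n := by
  obtain ⟨c, hc⟩ := hf
  obtain ⟨d, hd⟩ := hg
  refine ⟨c + d, fun n => (Nat.add_le_add (hc n) (hd n)).trans ?_⟩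
  rw [Nat.add_mul]
  gcongr <;> omega

theorem PolyBounded.mul {f g : ℕ → ℕ} (hf : PolyBounded f) (hg : PolyBounded g) :
    PolyBounded fun n => f n * g n := by
  obtain ⟨c, hc⟩ := hf
  obtain ⟨d, hd⟩ := hg
  refine ⟨c * d + c + d, fun n => (Nat.mul_le_mul (hc n) (hd n)).trans ?_⟩
  calc c * (n + 1) ^ c * (d * (n + 1) ^ d) = c * d * (n + 1) ^ (c + d) := by ring
    _ ≤ _ := by gcongr <;> nlinarith

end Programs

/-! ### Evaluation of first-order formulas -/

section Formulas

/-- First-order formulas about an ordered graph with a distinguished set of vertices. The variables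
are de Bruijn levels: in a formula with free variables `0, …, d - 1`, the quantifier `ex` binds the
variable `d`. -/
inductive Fml where
  | adj (i j : ℕ)
  | mem (i : ℕ)
  | lt (i j : ℕ)
  | not (φ : Fml)
  | and (φ ψ : Fml)
  | ex (φ : Fml)

namespace Fml

/-- All free variables are among `0, …, d - 1`. -/
def WF : Fml → ℕ → Prop
  | adj i j, d => i < d ∧ j < d
  | mem i, d => i < d
  | lt i j, d => i < d ∧ j < d
  | not φ, d => φ.WF d
  | and φ ψ, d => φ.WF d ∧ ψ.WF d
  | ex φ, d => φ.WF (d + 1)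

variable {n : ℕ} (G : SimpleGraph (Fin n)) (X : Finset (Fin n))

/-- The truth of a formula with `d` free variables, whose values are given by `env`. -/
def Holds : Fml → ℕ → (ℕ → ℕ) → Prop
  | adj i j, _, env => ∃ a b : Fin n, env i = a ∧ env j = b ∧ G.Adj a b
  | mem i, _, env => ∃ a : Fin n, env i = a ∧ a ∈ X
  | lt i j, _, env => env i < env j
  | not φ, d, env => ¬ φ.Holds d env
  | and φ ψ, d, env => φ.Holds d env ∧ ψ.Holds d env
  | ex φ, d, env => ∃ a : Fin n, φ.Holds (d + 1) (Function.update env d a)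

/-- The program that evaluates a formula by exhaustive search. The value of the variable `i` is in
register `20 + 2 * i`; the answer is left in register `1`, and the register `21 + 2 * d` collects
the answer of the quantifier that binds the variable `d`. -/
def compile : Fml → ℕ → RamProg
  | adj i j, _ => .setReg 1 (.arr 0 (.add (.arr 2 (.reg (20 + 2 * i))) (.reg (20 + 2 * j))))
  | mem i, _ => .setReg 1 (.arr 1 (.reg (20 + 2 * i)))
  | lt i j, _ => .setReg 1 (.sub (.reg (20 + 2 * j)) (.reg (20 + 2 * i)))
  | not φ, d => .seq (φ.compile d) (.setReg 1 (.sub (.const 1) (.reg 1)))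
  | and φ ψ, d => .seq (φ.compile d) (.ite (.reg 1) (ψ.compile d) .skip)
  | ex φ, d => .seq (.setReg (21 + 2 * d) (.const 0)) (.seq
      (.forLoop (20 + 2 * d) 0
        (.seq (φ.compile (d + 1)) (.ite (.reg 1) (.setReg (21 + 2 * d) (.const 1)) .skip)))
      (.setReg 1 (.reg (21 + 2 * d))))

/-- A bound for the running time of the evaluation. -/
def time : Fml → ℕ → ℕ
  | adj _ _, _ => 6
  | mem _, _ => 3
  | lt _ _, _ => 4
  | not φ, n => φ.time n + 4
  | and φ ψ, n => φ.time n + (ψ.time n + 3)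
  | ex φ, n => 2 + (n * (φ.time n + 4 + 8) + 6 + 2)

theorem polyBounded_time (φ : Fml) : PolyBounded φ.time := by
  induction φ with
  | adj | mem | lt => exact .const _
  | not φ ih => exact ih.add (.const 4)
  | and φ ψ ih ih' => exact ih.add (ih'.add (.const 3))
  | ex φ ih =>
    exact PolyBounded.add (.const 2) (((PolyBounded.id.mul ((ih.add (.const 4)).add (.const 8))).add
      (.const 6)).add (.const 2))

end Fml

/-- The part of the memory that holds the input, and the offsets of the rows of the adjacency
matrix. -/
structure IsInput {n : ℕ} (G : SimpleGraph (Fin n)) (X : Finset (Fin n)) (s : RamState) : Prop where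
  size : s.reg 0 = n
  adj : ∀ a b : Fin n, s.arr 0 (a * n + b) ≠ 0 ↔ G.Adj a b
  mem : ∀ a : Fin n, s.arr 1 a ≠ 0 ↔ a ∈ X
  row : ∀ a : Fin n, s.arr 2 a = a * n

theorem IsInput.congr {n : ℕ} {G : SimpleGraph (Fin n)} {X : Finset (Fin n)} {s s' : RamState}
    (h : IsInput G X s) (h0 : s'.reg 0 = s.reg 0) (h1 : s'.arr 0 = s.arr 0)
    (h2 : s'.arr 1 = s.arr 1) (h3 : s'.arr 2 = s.arr 2) : IsInput G X s' :=
  ⟨h0.trans h.size, by rw [h1]; exact h.adj, by rw [h2]; exact h.mem, by rw [h3]; exact h.row⟩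

namespace Fml

variable {n : ℕ} {G : SimpleGraph (Fin n)} {X : Finset (Fin n)}

/-- The evaluation changes no array, and, except for register `1`, no register below those of the
first bound variable. -/
theorem runs_compile (φ : Fml) {d : ℕ} {env : ℕ → ℕ} {s : RamState} (hs : IsInput G X s)
    (hwf : φ.WF d) (henv : ∀ i < d, s.reg (20 + 2 * i) = env i ∧ env i < n) :
    (φ.compile d).Runs s (φ.time n) fun s' => (s'.reg 1 ≠ 0 ↔ φ.Holds G X d env) ∧
      s'.arr = s.arr ∧ ∀ i, i ≠ 1 → i < 20 + 2 * d → s'.reg i = s.reg i := by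
  induction φ generalizing d env s with
  | adj i j =>
    refine (RamProg.runs_setReg ?_).mono le_rfl fun _ h => h
    refine ⟨?_, rfl, fun i hi _ => by simp [hi]⟩
    obtain ⟨hi, hi'⟩ := henv i hwf.1
    obtain ⟨hj, hj'⟩ := henv j hwf.2
    have h1 := hs.adj ⟨env i, hi'⟩ ⟨env j, hj'⟩
    have h2 := hs.row ⟨env i, hi'⟩
    simp only at h1 h2
    simp only [RamExpr.eval, RamState.setReg_reg, if_true, hi, hj, h2, h1, Holds]
    constructor
    · intro h; exact ⟨_, _, rfl, rfl, h⟩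
    · rintro ⟨a, b, ha, hb, h⟩
      simpa [ha, hb] using h
  | mem i =>
    refine (RamProg.runs_setReg ?_).mono le_rfl fun _ h => h
    refine ⟨?_, rfl, fun i hi _ => by simp [hi]⟩
    obtain ⟨hi, hi'⟩ := henv i hwf
    have h1 := hs.mem ⟨env i, hi'⟩
    simp only at h1
    simp only [RamExpr.eval, RamState.setReg_reg, if_true, hi, h1, Holds]
    constructor
    · intro h; exact ⟨_, rfl, h⟩
    · rintro ⟨a, ha, h⟩
      simpa [ha] using h
  | lt i j =>
    refine (RamProg.runs_setReg ?_).mono le_rfl fun _ h => h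
    refine ⟨?_, rfl, fun i hi _ => by simp [hi]⟩
    simp only [RamExpr.eval, RamState.setReg_reg, if_true, (henv i hwf.1).1, (henv j hwf.2).1,
      Holds]
    omega
  | not φ ih =>
    refine RamProg.runs_seq ((ih hs hwf henv).mono le_rfl ?_)
    rintro s' ⟨h1, h2, h3⟩
    refine (RamProg.runs_setReg ?_).mono le_rfl fun _ h => h
    refine ⟨?_, h2, fun i hi hid => by simp [hi, h3 i hi hid]⟩
    simp only [RamExpr.eval, RamState.setReg_reg, if_true, Holds, ← h1]
    omega
  | and φ ψ ih ih' =>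
    refine RamProg.runs_seq ((ih hs hwf.1 henv).mono le_rfl ?_)
    rintro s' ⟨h1, h2, h3⟩
    refine (RamProg.runs_ite (T := ψ.time n + 1) ?_ ?_).mono (by simp [RamExpr.cost]; omega)
      fun _ h => h
    · intro hr
      have hφ := h1.mp hr
      refine (ih' (env := env) (s := s')
        (hs.congr (h3 0 (by omega) (by omega)) (by rw [h2]) (by rw [h2]) (by rw [h2])) hwf.2
        fun i hi => ?_).mono (by omega) ?_
      · rw [h3 _ (by omega) (by omega)]; exact henv i hi
      · rintro s'' ⟨h1', h2', h3'⟩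
        refine ⟨?_, h2'.trans h2, fun i hi hid => (h3' i hi hid).trans (h3 i hi hid)⟩
        rw [h1']
        simp [Holds, hφ]
    · intro hr
      refine (RamProg.runs_skip ?_).mono (by omega) fun _ h => h
      have hφ : ¬ φ.Holds G X d env := fun h => h1.mpr h hr
      refine ⟨?_, h2, h3⟩
      simp only [RamExpr.eval] at hr
      simp [Holds, hφ, hr]
  | ex φ ih =>
    refine RamProg.runs_seq ((RamProg.runs_setReg ?_).mono le_rfl fun _ h => h)
    refine RamProg.runs_seq (RamProg.runs_forLoop (n := n)
      (fun j s' => s'.reg (20 + 2 * d) = j ∧ (s'.reg (21 + 2 * d) ≠ 0 ↔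
        ∃ a : Fin n, a.1 < j ∧ φ.Holds G X (d + 1) (Function.update env d a)) ∧ s'.arr = s.arr ∧
        ∀ i, i ≠ 1 → i < 20 + 2 * d → s'.reg i = s.reg i) ?_ ?_ ?_ ?_)
    · rintro j s' ⟨h1, -, -, h2⟩
      exact ⟨h1, (h2 0 (by omega) (by omega)).trans hs.size⟩
    · refine ⟨by simp, by simp [RamExpr.eval], rfl, fun i hi hid => ?_⟩
      simp only [RamState.setReg_reg]
      rw [if_neg (by omega), if_neg (by omega)]
    · rintro j s' hj ⟨h1, h2, h3, h4⟩
      refine RamProg.runs_seq ((ih (d := d + 1) (env := Function.update env d j) (s := s')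
        (hs.congr (h4 0 (by omega) (by omega)) (by rw [h3]) (by rw [h3]) (by rw [h3])) hwf ?_).mono
        le_rfl ?_)
      · intro i hi
        rcases Nat.lt_succ_iff_lt_or_eq.mp hi with hi | rfl
        · rw [Function.update_of_ne (by omega), h4 _ (by omega) (by omega)]
          exact henv i hi
        · rw [Function.update_self]
          exact ⟨h1, hj⟩
      · rintro s'' ⟨h1', h2', h3'⟩
        have hiff : (∃ a : Fin n, a.1 < j + 1 ∧ φ.Holds G X (d + 1) (Function.update env d a)) ↔
            s''.reg 1 ≠ 0 ∨ s'.reg (21 + 2 * d) ≠ 0 := by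
          rw [h1', h2]
          constructor
          · rintro ⟨a, ha, h⟩
            rcases Nat.lt_succ_iff_lt_or_eq.mp ha with ha | ha
            · exact .inr ⟨a, ha, h⟩
            · exact .inl (by rw [← ha]; exact h)
          · rintro (h | ⟨a, ha, h⟩)
            · exact ⟨⟨j, hj⟩, Nat.lt_succ_self j, h⟩
            · exact ⟨a, by omega, h⟩
        have hreg : s''.reg (20 + 2 * d) = j := (h3' _ (by omega) (by omega)).trans h1
        have hacc : s''.reg (21 + 2 * d) = s'.reg (21 + 2 * d) := h3' _ (by omega) (by omega)
        have hfr : ∀ i, i ≠ 1 → i < 20 + 2 * d → s''.reg i = s.reg i := fun i hi hid =>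
          (h3' i hi (by omega)).trans (h4 i hi hid)
        refine (RamProg.runs_ite (T := 2) ?_ ?_).mono (by simp [RamExpr.cost]) fun _ h => h
        · intro hr
          simp only [RamExpr.eval] at hr
          refine (RamProg.runs_setReg ?_).mono le_rfl fun _ h => h
          refine ⟨?_, ?_, h2'.trans h3, fun i hi hid => ?_⟩
          · simp [hreg]
          · rw [hiff]
            simp [RamExpr.eval, hr]
          · simp only [RamState.setReg_reg]
            rw [if_neg (by omega), if_neg (by omega)]
            exact hfr i hi hid
        · intro hr
          simp only [RamExpr.eval] at hr
          refine (RamProg.runs_skip ?_).mono (by omega) fun _ h => h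
          refine ⟨?_, ?_, h2'.trans h3, fun i hi hid => ?_⟩
          · simp [hreg]
          · rw [hiff]
            simp [hr, hacc]
          · simp only [RamState.setReg_reg]
            rw [if_neg (by omega)]
            exact hfr i hi hid
    · rintro s' ⟨h1, h2, h3, h4⟩
      refine (RamProg.runs_setReg ?_).mono le_rfl fun _ h => h
      refine ⟨?_, h3, fun i hi hid => by simp [hi, h4 i hi hid]⟩
      simp only [RamExpr.eval, RamState.setReg_reg, if_true, h2, Holds]
      simp

end Fml

end Formulas

/-! ### The kernel in first-order logic -/

namespace Fml

/-- Disjunction. -/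
def or (φ ψ : Fml) : Fml := not (and (not φ) (not ψ))

/-- Equality, expressed by the order. -/
def eq (i j : ℕ) : Fml := and (not (lt i j)) (not (lt j i))

/-- `IsSpecial v`; here and below, `d` is the number of free variables. -/
def special (v d : ℕ) : Fml :=
  and (not (mem v)) (ex (ex (and (not (eq d (d + 1))) (and (mem d) (and (mem (d + 1))
    (and (adj v d) (adj v (d + 1))))))))

/-- `SameStar v s`. -/
def sameStar (v s d : ℕ) : Fml :=
  or (eq v s) (or (adj v s) (ex (and (not (mem d)) (and (adj v d) (adj d s)))))

/-- `InCore v`. -/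
def core (v d : ℕ) : Fml :=
  or (mem v) (and (ex (and (special d (d + 1)) (sameStar v d (d + 1))))
    (ex (ex (and (not (eq d (d + 1))) (and (adj v d) (adj v (d + 1)))))))

/-- `IsDoubled c x`. -/
def doubled (c x d : ℕ) : Fml :=
  ex (ex (and (not (eq d (d + 1))) (and (not (mem d)) (and (not (mem (d + 1))) (and (adj c d)
    (and (adj d x) (and (adj c (d + 1)) (adj (d + 1) x))))))))

/-- `IsWitness z x y c`. -/
def witness (z x y c d : ℕ) : Fml :=
  and (and (mem z) (and (mem x) (mem y))) (and (not (mem c)) (and (not (core c d)) (and (adj c z)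
    (and (doubled c x d) (doubled c y d)))))

/-- `IsFirstWitness z x y c`. -/
def firstWitness (z x y c d : ℕ) : Fml :=
  and (witness z x y c d) (not (ex (and (lt d c) (witness z x y d (d + 1)))))

/-- `InKernel v`. -/
def kernel (v d : ℕ) : Fml :=
  or (core v d) (ex (ex (ex (ex (and (firstWitness d (d + 1) (d + 2) (d + 3) (d + 4))
    (or (eq v (d + 3)) (and (not (mem v)) (and (adj (d + 3) v)
      (or (adj v (d + 1)) (adj v (d + 2)))))))))))

/-- The pair of the variables `0` and `1`, in this order, is an edge of the kernel. -/
def kernelEdge : Fml := and (lt 0 1) (and (adj 0 1) (and (kernel 0 2) (kernel 1 2)))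

/-- `FewCommonNeighbors`. -/
def fewCommon : Fml :=
  and (not (ex (ex (ex (and (adj 0 1) (and (adj 0 2) (adj 1 2)))))))
    (not (ex (ex (ex (ex (ex (and (not (eq 0 1)) (and (adj 0 2) (and (adj 1 2) (and (adj 0 3)
      (and (adj 1 3) (and (adj 0 4) (and (adj 1 4) (and (not (eq 2 3)) (and (not (eq 2 4))
        (not (eq 3 4)))))))))))))))))

variable {n : ℕ} {G : SimpleGraph (Fin n)} {X : Finset (Fin n)} {d : ℕ} {env : ℕ → ℕ}

@[simp] theorem holds_or (φ ψ : Fml) :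
    (or φ ψ).Holds G X d env ↔ φ.Holds G X d env ∨ ψ.Holds G X d env := by
  simp only [or, Holds]; tauto

@[simp] theorem holds_eq (i j : ℕ) : (eq i j).Holds G X d env ↔ env i = env j := by
  simp only [eq, Holds]; omega

theorem holds_special {v : ℕ} {v' : Fin n} (hv : v < d) (h : env v = v') :
    (special v d).Holds G X d env ↔ IsSpecial G X v' := by
  have h1 : v ≠ d := by omega
  have h2 : v ≠ d + 1 := by omega
  simp [special, Holds, IsSpecial, h, h1, h2, Fin.val_inj]

theorem holds_sameStar {v s : ℕ} {v' s' : Fin n} (hv : v < d) (h : env v = v') (hs : s < d)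
    (h' : env s = s') : (sameStar v s d).Holds G X d env ↔ SameStar G X v' s' := by
  have h1 : v ≠ d := by omega
  have h2 : s ≠ d := by omega
  simp [sameStar, Holds, SameStar, h, h', h1, h2, Fin.val_inj]

theorem holds_core {v : ℕ} {v' : Fin n} (hv : v < d) (h : env v = v') :
    (core v d).Holds G X d env ↔ InCore G X v' := by
  have h1 : v ≠ d := by omega
  have h2 : v ≠ d + 1 := by omega
  have key : ∀ a : Fin n, ((special d (d + 1)).Holds G X (d + 1) (Function.update env d a) ∧
      (sameStar v d (d + 1)).Holds G X (d + 1) (Function.update env d a)) ↔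
      IsSpecial G X a ∧ SameStar G X v' a := fun a => by
    rw [holds_special (v' := a) (by omega) (by simp), holds_sameStar (v' := v') (s' := a) (by omega)
      (by simp [h1, h]) (by omega) (by simp)]
  simp only [core, holds_or, Holds, InCore, key]
  simp [h, h1, h2, Fin.val_inj]

theorem holds_doubled {c x : ℕ} {c' x' : Fin n} (hc : c < d) (h : env c = c') (hx : x < d)
    (h' : env x = x') : (doubled c x d).Holds G X d env ↔ IsDoubled G X c' x' := by
  have h1 : c ≠ d := by omega
  have h2 : c ≠ d + 1 := by omega
  have h3 : x ≠ d := by omega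
  have h4 : x ≠ d + 1 := by omega
  simp [doubled, Holds, IsDoubled, h, h', h1, h2, h3, h4, Fin.val_inj]

theorem holds_witness {z x y c : ℕ} {z' x' y' c' : Fin n} (hz : env z = z')
    (hxd : x < d) (hx : env x = x') (hyd : y < d) (hy : env y = y') (hcd : c < d)
    (hc : env c = c') :
    (witness z x y c d).Holds G X d env ↔ IsWitness G X z' x' y' c' := by
  simp only [witness, Holds, IsWitness, holds_core hcd hc, holds_doubled hcd hc hxd hx,
    holds_doubled hcd hc hyd hy]
  simp [hz, hx, hy, hc, Fin.val_inj]

theorem holds_firstWitness {z x y c : ℕ} {z' x' y' c' : Fin n} (hzd : z < d) (hz : env z = z')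
    (hxd : x < d) (hx : env x = x') (hyd : y < d) (hy : env y = y') (hcd : c < d)
    (hc : env c = c') :
    (firstWitness z x y c d).Holds G X d env ↔ IsFirstWitness G X z' x' y' c' := by
  have key : ∀ a : Fin n,
      (witness z x y d (d + 1)).Holds G X (d + 1) (Function.update env d a) ↔
      IsWitness G X z' x' y' a := fun a =>
    holds_witness (by rw [Function.update_of_ne (by omega), hz])
      (by omega) (by rw [Function.update_of_ne (by omega), hx])
      (by omega) (by rw [Function.update_of_ne (by omega), hy]) (by omega) (by simp)
  simp only [firstWitness, Holds, IsFirstWitness, holds_witness hz hxd hx hyd hy hcd hc, key]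
  have h1 : c ≠ d := by omega
  simp [h1, hc]

theorem holds_kernel {v : ℕ} {v' : Fin n} (hv : v < d) (h : env v = v') :
    (kernel v d).Holds G X d env ↔ InKernel G X v' := by
  simp only [kernel, holds_or, holds_core hv h, Holds, InKernel]
  refine or_congr Iff.rfl (exists_congr fun z => exists_congr fun x => exists_congr fun y =>
    exists_congr fun c => ?_)
  set env' := Function.update (Function.update (Function.update (Function.update env d z) (d + 1) x)
    (d + 1 + 1) y) (d + 1 + 1 + 1) c with henv
  have hz : env' d = z := by
    rw [henv, Function.update_of_ne (by omega), Function.update_of_ne (by omega),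
      Function.update_of_ne (by omega), Function.update_self]
  have hx : env' (d + 1) = x := by simp [henv]
  have hy : env' (d + 2) = y := by simp [henv]
  have hc : env' (d + 3) = c := by simp [henv]
  have hv' : env' v = v' := by
    rw [henv, Function.update_of_ne (by omega), Function.update_of_ne (by omega),
      Function.update_of_ne (by omega), Function.update_of_ne (by omega), h]
  rw [show d + 1 + 1 + 1 + 1 = d + 4 from rfl,
    holds_firstWitness (by omega) hz (by omega) hx (by omega) hy (by omega) hc]
  simp [hx, hy, hc, hv', Fin.val_inj]

theorem holds_kernelEdge {a b : Fin n} (ha : env 0 = a) (hb : env 1 = b) :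
    kernelEdge.Holds G X 2 env ↔ a < b ∧ G.Adj a b ∧ InKernel G X a ∧ InKernel G X b := by
  simp only [kernelEdge, Holds, holds_kernel (by omega : 0 < 2) ha,
    holds_kernel (by omega : 1 < 2) hb]
  simp [ha, hb, Fin.val_inj]

theorem holds_fewCommon : fewCommon.Holds G X 0 env ↔ FewCommonNeighbors G := by
  have : fewCommon.Holds G X 0 env ↔
      (¬ ∃ a b c, G.Adj a b ∧ G.Adj a c ∧ G.Adj b c) ∧
      ¬ ∃ a b p q r, a ≠ b ∧ G.Adj a p ∧ G.Adj b p ∧ G.Adj a q ∧ G.Adj b q ∧ G.Adj a r ∧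
        G.Adj b r ∧ p ≠ q ∧ p ≠ r ∧ q ≠ r := by
    simp [fewCommon, Holds, Fin.val_inj]
  rw [this]
  constructor
  · rintro ⟨h1, h2⟩
    refine ⟨fun a b c hab hac hbc => h1 ⟨a, b, c, hab, hac, hbc⟩,
      fun a b hab p q r h3 h4 h5 h6 h7 h8 => ?_⟩
    by_contra hno
    push Not at hno
    exact h2 ⟨a, b, p, q, r, hab, h3, h4, h5, h6, h7, h8, hno⟩
  · rintro ⟨h1, h2⟩
    refine ⟨fun ⟨a, b, c, hab, hac, hbc⟩ => h1 a b c hab hac hbc, ?_⟩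
    rintro ⟨a, b, p, q, r, hab, h3, h4, h5, h6, h7, h8, hpq, hpr, hqr⟩
    rcases h2 a b hab p q r h3 h4 h5 h6 h7 h8 with h | h | h
    · exact hpq h
    · exact hpr h
    · exact hqr h

theorem wf_kernelEdge : kernelEdge.WF 2 := by
  simp [kernelEdge, kernel, firstWitness, witness, doubled, core, sameStar, special, or, eq, WF]

theorem wf_fewCommon : fewCommon.WF 0 := by simp [fewCommon, eq, WF]

end Fml

/-! ### Frames and nested loops -/

namespace RamState

/-- The states differ at most in the registers in `R` and in the arrays in `A`. -/
def Frame (R A : List ℕ) (s s' : RamState) : Prop :=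
  (∀ i, i ∉ R → s'.reg i = s.reg i) ∧ ∀ a, a ∉ A → s'.arr a = s.arr a

theorem Frame.refl (R A : List ℕ) (s : RamState) : Frame R A s s := ⟨fun _ _ => rfl, fun _ _ => rfl⟩

theorem Frame.trans {R A R' A' : List ℕ} {s s' s'' : RamState} (h : Frame R A s s')
    (h' : Frame R' A' s' s'') (hR : R ⊆ R') (hA : A ⊆ A') : Frame R' A' s s'' :=
  ⟨fun i hi => (h'.1 i hi).trans (h.1 i fun h => hi (hR h)),
    fun a ha => (h'.2 a ha).trans (h.2 a fun h => ha (hA h))⟩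

theorem Frame.trans' {R A R' A' : List ℕ} {s s' s'' : RamState} (h : Frame R A s s')
    (h' : Frame R' A' s' s'') (hR : R' ⊆ R) (hA : A' ⊆ A) : Frame R A s s'' :=
  ⟨fun i hi => (h'.1 i fun h => hi (hR h)).trans (h.1 i hi),
    fun a ha => (h'.2 a fun h => ha (hA h)).trans (h.2 a ha)⟩

theorem Frame.setReg {R A : List ℕ} {s s' : RamState} (h : Frame R A s s') {i : ℕ} (hi : i ∈ R)
    (v : ℕ) : Frame R A s (s'.setReg i v) := by
  refine ⟨fun j hj => ?_, h.2⟩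
  rw [setReg_reg, if_neg (fun e : j = i => hj (e ▸ hi))]
  exact h.1 j hj

theorem Frame.setArr {R A : List ℕ} {s s' : RamState} (h : Frame R A s s') {a : ℕ} (ha : a ∈ A)
    (j v : ℕ) : Frame R A s (s'.setArr a j v) := by
  refine ⟨h.1, fun b hb => ?_⟩
  rw [setArr_arr, if_neg (fun e : b = a => hb (e ▸ ha))]
  exact h.2 b hb

end RamState

open RamState

namespace RamProg

/-- Two nested loops over the same range; `I a b` is the invariant before the round `(a, b)`. -/
theorem runs_forLoop₂ {i j r n T : ℕ} {P : RamProg} {s : RamState} {Q : RamState → Prop}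
    (hij : i ≠ j) (hrj : r ≠ j) (I : ℕ → ℕ → RamState → Prop)
    (hI : ∀ a b s, I a b s → s.reg i = a ∧ s.reg j = b ∧ s.reg r = n)
    (h0 : I 0 0 ((s.setReg i 0).setReg j 0))
    (hrow : ∀ a s, I a n s → I (a + 1) 0 ((s.setReg i (s.reg i + 1)).setReg j 0))
    (step : ∀ a b s, a < n → b < n → I a b s →
      P.Runs s T fun s' => I a (b + 1) (s'.setReg j (s'.reg j + 1)))
    (hQ : ∀ s, I n 0 (s.setReg j 0) → Q s) :
    (forLoop i r (forLoop j r P)).Runs s (n * (n * (T + 8) + 6 + 8) + 6) Q := by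
  refine runs_forLoop (n := n) (fun a s => I a 0 (s.setReg j 0)) ?_ h0 ?_ hQ
  · intro a s h
    have := hI a 0 _ h
    simp only [setReg_reg, if_neg hij, if_neg hrj] at this
    exact ⟨this.1, this.2.2⟩
  · intro a s ha hs
    exact runs_forLoop (n := n) (fun b s => I a b s) (fun b s h => (hI a b s h).2) hs
      (fun b s hb h => step a b s ha hb h) fun s h => hrow a s h

end RamProg

/-! ### The list of edges -/

section EdgeList

variable {n : ℕ}

/-- Distinct entries of a matrix stand in distinct cells. -/
theorem cell_inj {u v u' v' : Fin n} (h : (u : ℕ) * n + v = u' * n + v') : u = u' ∧ v = v' := by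
  have hv : (v : ℕ) = v' := by
    have := congrArg (· % n) h
    simpa [Nat.mul_add_mod', Nat.mod_eq_of_lt v.2, Nat.mod_eq_of_lt v'.2] using this
  have hn : 0 < n := Nat.pos_of_ne_zero fun h0 => by subst h0; exact u.elim0
  rw [hv] at h
  exact ⟨Fin.ext (Nat.eq_of_mul_eq_mul_right hn (by omega)), Fin.ext hv⟩

theorem cell_eq_iff {u v u' v' : Fin n} : (u : ℕ) * n + v = u' * n + v' ↔ u = u' ∧ v = v' :=
  ⟨cell_inj, fun ⟨h, h'⟩ => by rw [h, h']⟩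

variable {G : SimpleGraph (Fin n)} {X : Finset (Fin n)}

/-- Computes the offsets `i * n` of the rows, in the array `2`; the machine cannot multiply. -/
def rowsProg : RamProg :=
  .forLoop 12 0 (.setArr 2 (.add (.reg 12) (.const 1)) (.add (.arr 2 (.reg 12)) (.reg 0)))

theorem runs_rowsProg : rowsProg.Runs (graphInput G X) (n * (8 + 8) + 6) (IsInput G X) := by
  refine RamProg.runs_forLoop (n := n) (fun j s => s.reg 12 = j ∧ s.reg 0 = n ∧
    (∀ i ≤ j, s.arr 2 i = i * n) ∧ s.arr 0 = (graphInput G X).arr 0 ∧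
    s.arr 1 = (graphInput G X).arr 1) ?_ ?_ ?_ ?_
  · rintro j s ⟨h1, h2, -⟩; exact ⟨h1, h2⟩
  · refine ⟨by simp, by simp [graphInput], fun i hi => ?_, rfl, rfl⟩
    obtain rfl : i = 0 := by omega
    simp [graphInput]
  · rintro j s hj ⟨h1, h2, h3, h4, h5⟩
    refine (RamProg.runs_setArr ?_).mono (by simp [RamExpr.cost]) fun _ h => h
    refine ⟨by simp [h1], by simp [h2], fun i hi => ?_, by simp [h4], by simp [h5]⟩
    simp only [setReg_arr, setArr_arr, if_true, RamExpr.eval, h1, h2, Function.update_apply]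
    split_ifs with h
    · rw [h3 j le_rfl, h]; ring
    · exact h3 i (by omega)
  · rintro s ⟨-, h2, h3, h4, h5⟩
    refine ⟨h2, fun a b => ?_, fun a => ?_, fun a => h3 a a.2.le⟩
    · rw [h4]
      simp only [graphInput]
      constructor
      · intro h
        by_contra hno
        apply h
        rw [if_neg]
        rintro (⟨-, i, j, hij, he⟩ | ⟨h01, -⟩)
        swap
        · exact absurd h01 zero_ne_one
        obtain ⟨rfl, rfl⟩ := cell_inj he
        exact hno hij
      · intro h
        rw [if_pos (.inl ⟨rfl, a, b, h, rfl⟩)]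
        exact one_ne_zero
    · rw [h5]
      simp only [graphInput, true_and, one_ne_zero, false_and, false_or]
      constructor
      · intro h
        by_contra hno
        apply h
        rw [if_neg]
        rintro ⟨i, hi, he⟩
        exact hno (Fin.ext he ▸ hi)
      · intro h
        rw [if_pos ⟨a, h, rfl⟩]
        exact one_ne_zero

/-- The input is in place, register `2` holds the length of the list `L`, and the arrays `3` and `4`
hold the first and the second components of its entries. -/
structure HasEdges (G : SimpleGraph (Fin n)) (X : Finset (Fin n)) (L : List (Fin n × Fin n))
    (s : RamState) : Prop where
  input : IsInput G X s
  length : s.reg 2 = L.length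
  ends : ∀ m (h : m < L.length), s.arr 3 m = L[m].1 ∧ s.arr 4 m = L[m].2

theorem HasEdges.of_frame {L : List (Fin n × Fin n)} {s s' : RamState} (h : HasEdges G X L s)
    {R A : List ℕ} (hf : Frame R A s s') (hR : 0 ∉ R ∧ 2 ∉ R) (hA : ∀ a ∈ A, 5 ≤ a) :
    HasEdges G X L s' := by
  have hA : ∀ a < 5, a ∉ A := fun a ha h => by have := hA a h; omega
  refine ⟨h.input.congr (hf.1 0 hR.1) (hf.2 0 (hA 0 (by omega))) (hf.2 1 (hA 1 (by omega)))
    (hf.2 2 (hA 2 (by omega))), (hf.1 2 hR.2).trans h.length, ?_⟩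
  rw [hf.2 3 (hA 3 (by omega)), hf.2 4 (hA 4 (by omega))]
  exact h.ends

/-- Lists the pairs that satisfy the formula `φ`. The two loops run over the registers of the
variables `0` and `1`. -/
def edgesProg (φ : Fml) : RamProg :=
  .seq (.setReg 2 (.const 0)) (.forLoop 20 0 (.forLoop 22 0 (.seq (φ.compile 2) (.ite (.reg 1)
    (.seq (.setArr 3 (.reg 2) (.reg 20)) (.seq (.setArr 4 (.reg 2) (.reg 22))
      (.setReg 2 (.add (.reg 2) (.const 1))))) .skip))))

theorem runs_edgesProg {φ : Fml} (hwf : φ.WF 2) {R : Fin n → Fin n → Prop}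
    (hφ : ∀ (env : ℕ → ℕ) (a b : Fin n), env 0 = a → env 1 = b → (φ.Holds G X 2 env ↔ R a b))
    {s : RamState} (hs : IsInput G X s) :
    (edgesProg φ).Runs s (2 + (n * (n * (φ.time n + 12 + 8) + 6 + 8) + 6)) fun s' =>
      ∃ L : List (Fin n × Fin n), HasEdges G X L s' ∧ L.Nodup ∧ ∀ e, e ∈ L ↔ R e.1 e.2 := by
  refine RamProg.runs_seq ((RamProg.runs_setReg ?_).mono le_rfl fun _ h => h)
  refine RamProg.runs_forLoop₂ (n := n) (by omega) (by omega)
    (fun a b s' => s'.reg 20 = a ∧ s'.reg 22 = b ∧ ∃ L : List (Fin n × Fin n), HasEdges G X L s' ∧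
      L.Nodup ∧ ∀ e : Fin n × Fin n, e ∈ L ↔ (e.1.1 < a ∨ e.1.1 = a ∧ e.2.1 < b) ∧ R e.1 e.2)
    ?_ ?_ ?_ ?_ ?_
  · rintro a b s ⟨h1, h2, L, hL, -⟩
    exact ⟨h1, h2, hL.input.size⟩
  · refine ⟨by simp, by simp, [], ⟨hs.congr (by simp) rfl rfl rfl, by simp [RamExpr.eval], by simp⟩,
      List.nodup_nil, by simp⟩
  · rintro a s ⟨h1, h2, L, hL, hnd, hmem⟩
    refine ⟨by simp [h1], by simp, L, ⟨hL.input.congr (by simp) rfl rfl rfl, by simp [hL.length],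
      hL.ends⟩, hnd, fun e => ?_⟩
    rw [hmem]
    have := e.2.2
    refine and_congr_left fun _ => ?_
    omega
  · rintro a b s ha hb ⟨h1, h2, L, hL, hnd, hmem⟩
    have hpair : ∀ e : Fin n × Fin n,
        (e.1.1 < a ∨ e.1.1 = a ∧ e.2.1 < b + 1) ∧ R e.1 e.2 ↔
        e ∈ L ∨ e = (⟨a, ha⟩, ⟨b, hb⟩) ∧ R ⟨a, ha⟩ ⟨b, hb⟩ := by
      rintro ⟨u, v⟩
      rw [hmem]
      have : ((u, v) = ((⟨a, ha⟩, ⟨b, hb⟩) : Fin n × Fin n)) ↔ u.1 = a ∧ v.1 = b := by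
        simp [Fin.ext_iff]
      constructor
      · rintro ⟨h, hR⟩
        by_cases hv : u.1 = a ∧ v.1 = b
        · have heq := this.mpr hv
          refine .inr ⟨heq, ?_⟩
          obtain ⟨rfl, rfl⟩ := Prod.mk.inj heq
          exact hR
        · refine .inl ⟨?_, hR⟩
          simp only at h ⊢
          omega
      · rintro (⟨h, hR⟩ | ⟨heq, hR⟩)
        · refine ⟨?_, hR⟩
          simp only at h ⊢
          omega
        · have := this.mp heq
          obtain ⟨rfl, rfl⟩ := Prod.mk.inj heq
          exact ⟨.inr ⟨rfl, Nat.lt_succ_self _⟩, hR⟩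
    refine RamProg.runs_seq ((φ.runs_compile (d := 2) (env := fun i => if i = 0 then a else b)
      hL.input hwf ?_).mono le_rfl ?_)
    · intro i hi
      rcases (by omega : i = 0 ∨ i = 1) with rfl | rfl
      · exact ⟨h1, ha⟩
      · exact ⟨h2, hb⟩
    · rintro s' ⟨hr, harr, hreg⟩
      rw [hφ _ ⟨a, ha⟩ ⟨b, hb⟩ rfl rfl] at hr
      have e1 : s'.reg 20 = a := (hreg 20 (by omega) (by omega)).trans h1
      have e2 : s'.reg 22 = b := (hreg 22 (by omega) (by omega)).trans h2
      have e3 : s'.reg 2 = L.length := (hreg 2 (by omega) (by omega)).trans hL.length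
      have e4 : s'.reg 0 = s.reg 0 := hreg 0 (by omega) (by omega)
      refine (RamProg.runs_ite (T := 10) ?_ ?_).mono (by simp [RamExpr.cost]) fun _ h => h
      · intro h
        have hR := hr.mp h
        refine (RamProg.runs_seq ((RamProg.runs_setArr (RamProg.runs_seq ((RamProg.runs_setArr
          (RamProg.runs_setReg ?_)).mono le_rfl fun _ h => h))).mono le_rfl fun _ h => h)).mono
          (by simp [RamExpr.cost]) fun _ h => h
        refine ⟨by simp [e1], by simp [e2], L ++ [(⟨a, ha⟩, ⟨b, hb⟩)], ⟨?_, ?_, ?_⟩, ?_,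
          fun e => ?_⟩
        · refine hL.input.congr (by simp [e4]) ?_ ?_ ?_ <;> simp [harr]
        · simp [RamExpr.eval, e3]
        · intro m hm
          simp only [setReg_arr, setArr_arr, setArr_reg, RamExpr.eval, harr, e1, e2, e3,
            List.getElem_append]
          simp only [List.length_append, List.length_singleton] at hm
          by_cases hm' : m < L.length
          · simp [hm', hm'.ne, hL.ends m hm']
          · obtain rfl : m = L.length := by omega
            simp
        · refine List.nodup_append.mpr ⟨hnd, by simp, ?_⟩
          intro x hx y hy
          rw [List.mem_singleton] at hy
          rintro rfl
          have := ((hmem x).mp hx).1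
          rw [hy] at this
          simp at this
        · rw [hpair]
          simp [hR]
      · intro h
        simp only [RamExpr.eval] at h
        have hR : ¬ R ⟨a, ha⟩ ⟨b, hb⟩ := fun hR => hr.mpr hR h
        refine (RamProg.runs_skip ?_).mono (by omega) fun _ h => h
        refine ⟨by simp [e1], by simp [e2], L, ⟨?_, ?_, ?_⟩, hnd, fun e => ?_⟩
        · refine hL.input.congr (by simp [e4]) ?_ ?_ ?_ <;> simp [harr]
        · simp [e3]
        · simp only [setReg_arr, harr]
          exact hL.ends
        · rw [hpair]
          simp [hR]
  · rintro s ⟨h1, h2, L, hL, hnd, hmem⟩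
    refine ⟨L, ⟨hL.input.congr (by simp) rfl rfl rfl, by simpa using hL.length, hL.ends⟩, hnd,
      fun e => ?_⟩
    rw [hmem]
    simp [e.1.2]

end EdgeList

/-! ### Exhaustive search over the orders of the edges -/

section Search

variable {n : ℕ}

/-- The address of the entry `(u, v)` of a matrix. -/
def cellExpr (u v : RamExpr) : RamExpr := .add (.arr 2 u) v

/-- The entry `(u, v)` of the matrix in the array `5`. -/
def entryExpr (u v : RamExpr) : RamExpr := .arr 5 (cellExpr u v)

/-- The array `5` holds the matrix `A`. -/
def HasMatrix (A : Fin n → Fin n → ℕ) (s : RamState) : Prop :=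
  ∀ u v : Fin n, s.arr 5 (u * n + v) = A u v

/-- Writes the identity matrix. -/
def oneProg : RamProg :=
  .forLoop 12 0 (.forLoop 13 0 (.setArr 5 (cellExpr (.reg 12) (.reg 13)) (.sub (.const 1)
    (.add (.sub (.reg 12) (.reg 13)) (.sub (.reg 13) (.reg 12))))))

variable {G : SimpleGraph (Fin n)} {X : Finset (Fin n)}

theorem runs_oneProg {s : RamState} (hs : IsInput G X s) :
    oneProg.Runs s (n * (n * (14 + 8) + 6 + 8) + 6) fun s' =>
      Frame [12, 13] [5] s s' ∧ HasMatrix (1 : Matrix (Fin n) (Fin n) ℕ) s' := by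
  refine RamProg.runs_forLoop₂ (n := n) (by omega) (by omega)
    (fun a b s' => s'.reg 12 = a ∧ s'.reg 13 = b ∧ Frame [12, 13] [5] s s' ∧
      ∀ u v : Fin n, (u.1 < a ∨ u.1 = a ∧ v.1 < b) →
        s'.arr 5 (u * n + v) = (1 : Matrix (Fin n) (Fin n) ℕ) u v) ?_ ?_ ?_ ?_ ?_
  · rintro a b s' ⟨h1, h2, h3, -⟩
    exact ⟨h1, h2, (h3.1 0 (by simp)).trans hs.size⟩
  · exact ⟨by simp, by simp, ((Frame.refl _ _ s).setReg (by simp) _).setReg (by simp) _, by simp⟩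
  · rintro a s' ⟨h1, h2, h3, h4⟩
    refine ⟨by simp [h1], by simp, (h3.setReg (by simp) _).setReg (by simp) _, fun u v huv => ?_⟩
    exact h4 u v (by have := v.2; omega)
  · rintro a b s' ha hb ⟨h1, h2, h3, h4⟩
    refine (RamProg.runs_setArr ?_).mono (by simp [RamExpr.cost, cellExpr]) fun _ h => h
    refine ⟨by simp [h1], by simp [h2], (h3.setArr (by simp) _ _).setReg (by simp) _,
      fun u v huv => ?_⟩
    have hrow : s'.arr 2 a = a * n := by rw [h3.2 2 (by simp)]; exact hs.row ⟨a, ha⟩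
    simp only [setReg_arr, setArr_arr, if_true, cellExpr, RamExpr.eval, h1, h2, hrow,
      Function.update_apply]
    have hiff := cell_eq_iff (u := u) (v := v) (u' := ⟨a, ha⟩) (v' := ⟨b, hb⟩)
    simp only [Fin.ext_iff] at hiff
    simp only [hiff, Matrix.one_apply]
    by_cases h : u.1 = a ∧ v.1 = b
    · rw [if_pos h, ← h.1, ← h.2]
      by_cases huv : u = v
      · simp [huv]
      · have : u.1 ≠ v.1 := fun h => huv (Fin.ext h)
        rw [if_neg huv]
        omega
    · rw [if_neg h, h4 u v (by omega), Matrix.one_apply]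
  · rintro s' ⟨-, -, h3, h4⟩
    refine ⟨⟨fun i hi => ?_, h3.2⟩, fun u v => h4 u v (.inl u.2)⟩
    have := h3.1 i hi
    rwa [setReg_reg, if_neg (by rintro rfl; simp at hi)] at this

/-- Multiplies the matrix on the right by the elementary matrix of the edge whose ends are in the
registers `9` and `10`: two columns are both replaced by their sum. -/
def mulEdgeProg : RamProg :=
  .forLoop 12 0 (.seq (.setArr 5 (cellExpr (.reg 12) (.reg 9))
      (.add (entryExpr (.reg 12) (.reg 9)) (entryExpr (.reg 12) (.reg 10))))
    (.setArr 5 (cellExpr (.reg 12) (.reg 10)) (entryExpr (.reg 12) (.reg 9))))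

theorem runs_mulEdgeProg {s : RamState} (hs : IsInput G X s) {a b : Fin n} (hab : a ≠ b)
    (ha : s.reg 9 = a) (hb : s.reg 10 = b) {l : List (Fin n × Fin n)}
    (hl : HasMatrix (walkCount l) s) :
    mulEdgeProg.Runs s (n * (26 + 8) + 6) fun s' =>
      Frame [12] [5] s s' ∧ HasMatrix (walkCount (l ++ [(a, b)])) s' := by
  refine RamProg.runs_forLoop (n := n) (fun j s' => s'.reg 12 = j ∧ Frame [12] [5] s s' ∧
    ∀ u v : Fin n, s'.arr 5 (u * n + v) =
      if u.1 < j then walkCount (l ++ [(a, b)]) u v else walkCount l u v) ?_ ?_ ?_ ?_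
  · rintro j s' ⟨h1, h2, -⟩
    exact ⟨h1, (h2.1 0 (by simp)).trans hs.size⟩
  · exact ⟨by simp, (Frame.refl _ _ s).setReg (by simp) _, fun u v => by simpa using hl u v⟩
  · rintro j s' hj ⟨h1, h2, h3⟩
    refine (RamProg.runs_seq ((RamProg.runs_setArr (RamProg.runs_setArr ?_)).mono le_rfl
      fun _ h => h)).mono (by simp [RamExpr.cost, cellExpr, entryExpr]) fun _ h => h
    refine ⟨by simp [h1], ((h2.setArr (by simp) _ _).setArr (by simp) _ _).setReg (by simp) _,
      fun u v => ?_⟩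
    have hrow : s'.arr 2 j = j * n := by rw [h2.2 2 (by simp)]; exact hs.row ⟨j, hj⟩
    have ha' : s'.reg 9 = a := (h2.1 9 (by simp)).trans ha
    have hb' : s'.reg 10 = b := (h2.1 10 (by simp)).trans hb
    have ea := h3 ⟨j, hj⟩ a
    have eb := h3 ⟨j, hj⟩ b
    simp only [lt_irrefl, if_false] at ea eb
    have ia := cell_eq_iff (u := u) (v := v) (u' := ⟨j, hj⟩) (v' := a)
    have ib := cell_eq_iff (u := u) (v := v) (u' := ⟨j, hj⟩) (v' := b)
    simp only [Fin.ext_iff] at ia ib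
    simp only [setReg_arr, setArr_arr, setArr_reg, if_true, cellExpr, entryExpr, RamExpr.eval, h1,
      ha', hb', hrow, Function.update_apply, ea, eb, ia, ib,
      if_neg (show (2 : ℕ) ≠ 5 by omega), h3 u v]
    by_cases huj : u.1 = j
    · obtain rfl : u = ⟨j, hj⟩ := Fin.ext huj
      rw [if_pos (Nat.lt_succ_self j), if_neg (lt_irrefl j), walkCount_concat_apply]
      by_cases hvb : v = b
      · subst hvb
        simp [hab.symm, add_comm]
      · have hvb' : v.1 ≠ b.1 := fun h => hvb (Fin.ext h)
        by_cases hva : v = a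
        · subst hva
          simp [hvb', hvb]
        · have hva' : v.1 ≠ a.1 := fun h => hva (Fin.ext h)
          simp [hvb', hva', hvb, hva]
    · have : u.1 < j + 1 ↔ u.1 < j := by omega
      simp [huj, this]
  · rintro s' ⟨-, h2, h3⟩
    exact ⟨h2, fun u v => by rw [h3, if_pos u.2]⟩

/-- Tests whether all entries of the matrix are at most one. -/
def testProg : RamProg :=
  .seq (.setReg 11 (.const 1)) (.forLoop 12 0 (.forLoop 13 0
    (.ite (.sub (entryExpr (.reg 12) (.reg 13)) (.const 1)) (.setReg 11 (.const 0)) .skip)))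

theorem runs_testProg {s : RamState} (hs : IsInput G X s) {A : Fin n → Fin n → ℕ}
    (hA : HasMatrix A s) :
    testProg.Runs s (2 + (n * (n * (10 + 8) + 6 + 8) + 6)) fun s' =>
      Frame [11, 12, 13] [] s s' ∧ (s'.reg 11 ≠ 0 ↔ ∀ u v, A u v ≤ 1) := by
  refine RamProg.runs_seq ((RamProg.runs_setReg ?_).mono le_rfl fun _ h => h)
  refine RamProg.runs_forLoop₂ (n := n) (by omega) (by omega)
    (fun a b s' => s'.reg 12 = a ∧ s'.reg 13 = b ∧ Frame [11, 12, 13] [] s s' ∧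
      (s'.reg 11 ≠ 0 ↔ ∀ u v : Fin n, (u.1 < a ∨ u.1 = a ∧ v.1 < b) → A u v ≤ 1)) ?_ ?_ ?_ ?_ ?_
  · rintro a b s' ⟨h1, h2, h3, -⟩
    exact ⟨h1, h2, (h3.1 0 (by simp)).trans hs.size⟩
  · exact ⟨by simp, by simp, (((Frame.refl _ _ s).setReg (by simp) _).setReg (by simp) _).setReg
      (by simp) _, by simp [RamExpr.eval]⟩
  · rintro a s' ⟨h1, h2, h3, h4⟩
    refine ⟨by simp [h1], by simp, (h3.setReg (by simp) _).setReg (by simp) _, ?_⟩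
    simp only [setReg_reg]
    rw [if_neg (by omega), if_neg (by omega), h4]
    refine forall_congr' fun u => forall_congr' fun v => ?_
    have := v.2
    refine imp_congr_left ?_
    omega
  · rintro a b s' ha hb ⟨h1, h2, h3, h4⟩
    have hrow : s'.arr 2 a = a * n := by rw [h3.2 2 (by simp)]; exact hs.row ⟨a, ha⟩
    have hent : s'.arr 5 (a * n + b) = A ⟨a, ha⟩ ⟨b, hb⟩ := by
      rw [h3.2 5 (by simp)]; exact hA ⟨a, ha⟩ ⟨b, hb⟩
    have hiff : (∀ u v : Fin n, (u.1 < a ∨ u.1 = a ∧ v.1 < b + 1) → A u v ≤ 1) ↔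
        s'.reg 11 ≠ 0 ∧ A ⟨a, ha⟩ ⟨b, hb⟩ ≤ 1 := by
      rw [h4]
      constructor
      · intro h
        exact ⟨fun u v huv => h u v (by omega), h _ _ (.inr ⟨rfl, Nat.lt_succ_self _⟩)⟩
      · rintro ⟨h, h'⟩ u v huv
        by_cases he : u.1 = a ∧ v.1 = b
        · obtain rfl : u = ⟨a, ha⟩ := Fin.ext he.1
          obtain rfl : v = ⟨b, hb⟩ := Fin.ext he.2
          exact h'
        · exact h u v (by omega)
    refine (RamProg.runs_ite (T := 2) ?_ ?_).mono (by simp [RamExpr.cost, entryExpr, cellExpr])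
      fun _ h => h
    · intro h
      simp only [entryExpr, cellExpr, RamExpr.eval, h1, h2, hrow, hent] at h
      refine (RamProg.runs_setReg ?_).mono le_rfl fun _ h => h
      refine ⟨by simp [h1], by simp [h2], (h3.setReg (by simp) _).setReg (by simp) _, ?_⟩
      rw [hiff]
      simp [RamExpr.eval]
      omega
    · intro h
      simp only [entryExpr, cellExpr, RamExpr.eval, h1, h2, hrow, hent] at h
      refine (RamProg.runs_skip ?_).mono (by omega) fun _ h => h
      refine ⟨by simp [h1], by simp [h2], h3.setReg (by simp) _, ?_⟩
      rw [hiff]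
      simp
      omega
  · rintro s' ⟨-, -, h3, h4⟩
    refine ⟨⟨fun i hi => ?_, h3.2⟩, ?_⟩
    · have := h3.1 i hi
      rwa [setReg_reg, if_neg (by rintro rfl; simp at hi)] at this
    · simp only [setReg_reg] at h4
      rw [if_neg (by omega)] at h4
      rw [h4]
      exact ⟨fun h u v => h u v (.inl u.2), fun h u v _ => h u v⟩

/-- The first `j` entries of the list of edges that the digits `f` select from `L`. -/
def selectEdges (L : List (Fin n × Fin n)) (f : ℕ → ℕ) (j : ℕ) : List (Fin n × Fin n) :=
  (List.range j).filterMap fun i => L[f i]?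

theorem selectEdges_succ {L : List (Fin n × Fin n)} {f : ℕ → ℕ} {j : ℕ} (h : f j < L.length) :
    selectEdges L f (j + 1) = selectEdges L f j ++ [L[f j]] := by
  simp [selectEdges, List.range_succ, h]

/-- Tests the list of edges selected by the digits in the array `6`. -/
def checkProg : RamProg :=
  .seq oneProg (.seq (.forLoop 14 2 (.seq (.setReg 9 (.arr 3 (.arr 6 (.reg 14))))
    (.seq (.setReg 10 (.arr 4 (.arr 6 (.reg 14)))) mulEdgeProg))) testProg)

/-- A bound for the running time of `checkProg` for `m` edges. -/
def checkTime (n m : ℕ) : ℕ :=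
  n * (n * (14 + 8) + 6 + 8) + 6 + (m * (4 + (4 + (n * (26 + 8) + 6)) + 8) + 6 +
    (2 + (n * (n * (10 + 8) + 6 + 8) + 6)))

theorem runs_checkProg {s : RamState} {L : List (Fin n × Fin n)} (hs : HasEdges G X L s)
    (hL : ∀ e ∈ L, e.1 ≠ e.2) {f : ℕ → ℕ} (hf : ∀ i < L.length, s.arr 6 i = f i ∧ f i < L.length) :
    checkProg.Runs s (checkTime n L.length) fun s' => Frame [9, 10, 11, 12, 13, 14] [5] s s' ∧
      (s'.reg 11 ≠ 0 ↔ ∀ u v, walkCount (selectEdges L f L.length) u v ≤ 1) := by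
  refine RamProg.runs_seq ((runs_oneProg hs.input).mono le_rfl ?_)
  rintro s₁ ⟨hf₁, hm₁⟩
  have hf₁ : Frame [9, 10, 11, 12, 13, 14] [5] s s₁ :=
    hf₁.trans (Frame.refl _ _ _) (by simp) (by simp)
  refine RamProg.runs_seq (RamProg.runs_forLoop (n := L.length) (fun j s' => s'.reg 14 = j ∧
    Frame [9, 10, 11, 12, 13, 14] [5] s s' ∧ HasMatrix (walkCount (selectEdges L f j)) s')
    ?_ ?_ ?_ ?_)
  · rintro j s' ⟨h1, h2, -⟩
    exact ⟨h1, (h2.1 2 (by simp)).trans hs.length⟩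
  · exact ⟨by simp, hf₁.setReg (by simp) _, hm₁⟩
  · rintro j s' hj ⟨h1, h2, h3⟩
    have hs' : HasEdges G X L s' := hs.of_frame h2 (by simp) (by simp)
    obtain ⟨hd, hfj⟩ := hf j hj
    have hd : s'.arr 6 j = f j := by rw [h2.2 6 (by simp)]; exact hd
    obtain ⟨he1, he2⟩ := hs'.ends (f j) hfj
    refine RamProg.runs_seq ((RamProg.runs_setReg (RamProg.runs_seq ((RamProg.runs_setReg
      ?_).mono le_rfl fun _ h => h))).mono le_rfl fun _ h => h)
    refine (runs_mulEdgeProg (G := G) (X := X) (s := (s'.setReg 9 _).setReg 10 _)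
      (a := L[f j].1) (b := L[f j].2) (l := selectEdges L f j)
      (hs'.input.congr (by simp) rfl rfl rfl)
      (hL _ (List.getElem_mem _)) ?_ ?_ h3).mono le_rfl ?_
    · simp [RamExpr.eval, h1, hd, he1]
    · simp [RamExpr.eval, h1, hd, he2]
    · rintro s'' ⟨h4, h5⟩
      refine ⟨?_, ?_, ?_⟩
      · have := h4.1 14 (by simp)
        simp [this, h1]
      · exact ((((h2.setReg (by simp) _).setReg (by simp) _).trans' h4 (by simp)
          (by simp)).setReg (by simp) _)
      · rw [selectEdges_succ hfj]
        exact h5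
  · rintro s₂ ⟨-, h2, h3⟩
    refine (runs_testProg (G := G) (X := X) (hs.of_frame h2 (by simp) (by simp)).input h3).mono
      le_rfl ?_
    rintro s₃ ⟨h4, h5⟩
    exact ⟨h2.trans' h4 (by simp) (by simp), h5⟩

/-- Adds one to the number whose digits, in base `m`, are in the array `6`, where `m` is in the
register `2`. Register `8` is the carry. -/
def incrementProg : RamProg :=
  .seq (.setReg 8 (.const 1)) (.forLoop 14 2 (.ite (.reg 8)
    (.ite (.sub (.sub (.reg 2) (.const 1)) (.arr 6 (.reg 14)))
      (.seq (.setArr 6 (.reg 14) (.add (.arr 6 (.reg 14)) (.const 1))) (.setReg 8 (.const 0)))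
      (.setArr 6 (.reg 14) (.const 0))) .skip))

/-- In the invariant, the carry reaches the digit `j` if and only if `m ^ j` divides `w + 1`. -/
theorem runs_incrementProg {s : RamState} {m w : ℕ} (hm : s.reg 2 = m)
    (hw : ∀ i < m, s.arr 6 i = w / m ^ i % m) :
    incrementProg.Runs s (2 + (m * (18 + 8) + 6)) fun s' => Frame [8, 14] [6] s s' ∧
      ∀ i < m, s'.arr 6 i = (w + 1) / m ^ i % m := by
  refine RamProg.runs_seq ((RamProg.runs_setReg ?_).mono le_rfl fun _ h => h)
  refine RamProg.runs_forLoop (n := m) (fun j s' => s'.reg 14 = j ∧ Frame [8, 14] [6] s s' ∧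
    (∀ i < j, s'.arr 6 i = (w + 1) / m ^ i % m) ∧
    (∀ i, j ≤ i → i < m → s'.arr 6 i = w / m ^ i % m) ∧
    (s'.reg 8 ≠ 0 ↔ m ^ j ∣ w + 1)) ?_ ?_ ?_ ?_
  · rintro j s' ⟨h1, h2, -⟩
    exact ⟨h1, (h2.1 2 (by simp)).trans hm⟩
  · exact ⟨by simp, ((Frame.refl _ _ s).setReg (by simp) _).setReg (by simp) _, by simp,
      fun i _ hi => hw i hi, by simp [RamExpr.eval]⟩
  · rintro j s' hj ⟨h1, h2, h3, h4, h5⟩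
    have h2m : s'.reg 2 = m := (h2.1 2 (by simp)).trans hm
    have hd := h4 j le_rfl hj
    have hpos : 0 < m := by omega
    have hlt := Nat.mod_lt (w / m ^ j) hpos
    have hdiv : (w + 1) / m ^ j = w / m ^ j + if m ^ j ∣ w + 1 then 1 else 0 := Nat.succ_div
    have hdvd : m ^ j ∣ w + 1 → (m ^ (j + 1) ∣ w + 1 ↔ (w + 1) / m ^ j % m = 0) := by
      intro h
      rw [pow_succ, ← Nat.dvd_iff_mod_eq_zero, Nat.dvd_div_iff_mul_dvd h]
    have hmod := Nat.mod_add_mod (w / m ^ j) m 1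
    refine (RamProg.runs_ite (T := 16) ?_ ?_).mono (by simp [RamExpr.cost]) fun _ h => h
    · intro hc
      simp only [RamExpr.eval] at hc
      have hdj := h5.mp hc
      have hdvd := hdvd hdj
      rw [if_pos hdj] at hdiv
      refine (RamProg.runs_ite (T := 8) ?_ ?_).mono (by simp [RamExpr.cost]) fun _ h => h
      · intro hsmall
        simp only [RamExpr.eval, h1, hd, h2m] at hsmall
        have hnew : (w + 1) / m ^ j % m = w / m ^ j % m + 1 := by
          rw [hdiv, ← hmod, Nat.mod_eq_of_lt (by omega)]
        refine (RamProg.runs_seq ((RamProg.runs_setArr (RamProg.runs_setReg ?_)).mono le_rfl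
          fun _ h => h)).mono (by simp [RamExpr.cost]) fun _ h => h
        refine ⟨by simp [h1], ((h2.setArr (by simp) _ _).setReg (by simp) _).setReg (by simp) _,
          fun i hi => ?_, fun i hi him => ?_, ?_⟩
        · simp only [setReg_arr, setArr_arr, if_true, RamExpr.eval, h1, hd, Function.update_apply]
          split_ifs with h
          · rw [h, hnew]
          · exact h3 i (by omega)
        · simp only [setReg_arr, setArr_arr, if_true, RamExpr.eval, h1, hd, Function.update_apply]
          rw [if_neg (by omega)]
          exact h4 i (by omega) him
        · rw [hdvd, hnew]
          simp [RamExpr.eval]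
      · intro hbig
        simp only [RamExpr.eval, h1, hd, h2m] at hbig
        have hnew : (w + 1) / m ^ j % m = 0 := by
          rw [hdiv, ← hmod, show w / m ^ j % m + 1 = m by omega, Nat.mod_self]
        refine (RamProg.runs_setArr ?_).mono (by simp [RamExpr.cost]) fun _ h => h
        refine ⟨by simp [h1], (h2.setArr (by simp) _ _).setReg (by simp) _,
          fun i hi => ?_, fun i hi him => ?_, ?_⟩
        · simp only [setReg_arr, setArr_arr, if_true, RamExpr.eval, h1, Function.update_apply]
          split_ifs with h
          · rw [h, hnew]
          · exact h3 i (by omega)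
        · simp only [setReg_arr, setArr_arr, if_true, RamExpr.eval, h1, Function.update_apply]
          rw [if_neg (by omega)]
          exact h4 i (by omega) him
        · rw [hdvd, hnew]
          simpa using hc
    · intro hc
      simp only [RamExpr.eval] at hc
      have hdj : ¬ m ^ j ∣ w + 1 := fun h => h5.mpr h hc
      rw [if_neg hdj] at hdiv
      refine (RamProg.runs_skip ?_).mono (by omega) fun _ h => h
      refine ⟨by simp [h1], h2.setReg (by simp) _, fun i hi => ?_, fun i hi him => ?_, ?_⟩
      · simp only [setReg_arr]
        rcases Nat.lt_succ_iff_lt_or_eq.mp hi with hi | rfl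
        · exact h3 i hi
        · rw [hd, hdiv, add_zero]
      · exact h4 i (by omega) him
      · have : ¬ m ^ (j + 1) ∣ w + 1 := fun h => hdj ((pow_dvd_pow m (by omega)).trans h)
        simp [this, hc]
  · rintro s' ⟨-, h2, h3, -⟩
    exact ⟨h2, h3⟩

/-- Computes `m ^ m` in the register `3`, where `m` is in the register `2`. -/
def powerProg : RamProg :=
  .seq (.setReg 3 (.const 1)) (.forLoop 14 2 (.seq (.setReg 4 (.const 0))
    (.seq (.forLoop 5 2 (.setReg 4 (.add (.reg 4) (.reg 3)))) (.setReg 3 (.reg 4)))))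

theorem runs_powerProg {s : RamState} {m : ℕ} (hm : s.reg 2 = m) :
    powerProg.Runs s (2 + (m * (2 + (m * (4 + 8) + 6 + 2) + 8) + 6)) fun s' =>
      Frame [3, 4, 5, 14] [] s s' ∧ s'.reg 3 = m ^ m := by
  refine RamProg.runs_seq ((RamProg.runs_setReg ?_).mono le_rfl fun _ h => h)
  refine RamProg.runs_forLoop (n := m) (fun j s' => s'.reg 14 = j ∧ Frame [3, 4, 5, 14] [] s s' ∧
    s'.reg 3 = m ^ j) ?_ ?_ ?_ ?_
  · rintro j s' ⟨h1, h2, -⟩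
    exact ⟨h1, (h2.1 2 (by simp)).trans hm⟩
  · exact ⟨by simp, ((Frame.refl _ _ s).setReg (by simp) _).setReg (by simp) _, by
      simp [RamExpr.eval]⟩
  · rintro j s' hj ⟨h1, h2, h3⟩
    refine RamProg.runs_seq ((RamProg.runs_setReg (RamProg.runs_seq (RamProg.runs_forLoop (n := m)
      (T := 4) (fun i s'' => s''.reg 5 = i ∧ s''.reg 14 = j ∧ Frame [3, 4, 5, 14] [] s s'' ∧
      s''.reg 3 = m ^ j ∧ s''.reg 4 = i * m ^ j) ?_ ?_ ?_ ?_))).mono le_rfl fun _ h => h)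
    · rintro i s'' ⟨h4, -, h5, -⟩
      exact ⟨h4, (h5.1 2 (by simp)).trans hm⟩
    · exact ⟨by simp, by simp [h1], (h2.setReg (by simp) _).setReg (by simp) _, by simp [h3],
        by simp [RamExpr.eval]⟩
    · rintro i s'' hi ⟨h4, h5, h6, h7, h8⟩
      refine (RamProg.runs_setReg ?_).mono (by simp [RamExpr.cost]) fun _ h => h
      refine ⟨by simp [h4], by simp [h5], (h6.setReg (by simp) _).setReg (by simp) _, by simp [h7],
        ?_⟩
      simp [RamExpr.eval, h7, h8]
      ring
    · rintro s'' ⟨h4, h5, h6, h7, h8⟩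
      refine (RamProg.runs_setReg ?_).mono le_rfl fun _ h => h
      refine ⟨by simp [h5], (h6.setReg (by simp) _).setReg (by simp) _, ?_⟩
      simp [RamExpr.eval, h8]
      ring
  · rintro s' ⟨-, h2, h3⟩
    exact ⟨h2, h3⟩

/-- Tests all sequences of edges whose length `m` is the number of edges: register `6` counts to
`m ^ m`, the array `6` holds the digits of the counter in base `m`, and register `7` records a
success. The answer is left in register `0`. -/
def searchProg : RamProg :=
  .seq powerProg (.seq (.setReg 7 (.const 0)) (.seq (.forLoop 14 2 (.setArr 6 (.reg 14) (.const 0)))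
    (.seq (.forLoop 6 3 (.seq checkProg (.seq (.ite (.reg 11) (.setReg 7 (.const 1)) .skip)
      incrementProg))) (.setReg 0 (.reg 7)))))

/-- A bound for the running time of `searchProg` for `m` edges. -/
def searchTime (n m : ℕ) : ℕ :=
  2 + (m * (2 + (m * (4 + 8) + 6 + 2) + 8) + 6) + (2 + (m * (3 + 8) + 6 +
    (m ^ m * (checkTime n m + (4 + (2 + (m * (18 + 8) + 6))) + 8) + 6 + 2)))

theorem runs_searchProg {s : RamState} {L : List (Fin n × Fin n)} (hs : HasEdges G X L s)
    (hL : ∀ e ∈ L, e.1 ≠ e.2) :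
    searchProg.Runs s (searchTime n L.length) fun s' =>
      open Classical in s'.reg 0 = if ∃ w < L.length ^ L.length, ∀ u v,
        walkCount (selectEdges L (fun i => w / L.length ^ i % L.length) L.length) u v ≤ 1
        then 1 else 0 := by
  classical
  set m := L.length with hm
  refine RamProg.runs_seq ((runs_powerProg hs.length).mono le_rfl ?_)
  rintro s₁ ⟨hf₁, hp₁⟩
  have hs₁ : HasEdges G X L s₁ := hs.of_frame hf₁ (by simp) (by simp)
  refine RamProg.runs_seq ((RamProg.runs_setReg ?_).mono le_rfl fun _ h => h)
  refine RamProg.runs_seq (RamProg.runs_forLoop (n := m) (fun j s' => s'.reg 14 = j ∧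
    Frame [7, 14] [6] s₁ s' ∧ s'.reg 7 = 0 ∧ ∀ i < j, s'.arr 6 i = 0) ?_ ?_ ?_ ?_)
  · rintro j s' ⟨h1, h2, -⟩
    exact ⟨h1, (h2.1 2 (by simp)).trans hs₁.length⟩
  · exact ⟨by simp, ((Frame.refl _ _ s₁).setReg (by simp) _).setReg (by simp) _,
      by simp [RamExpr.eval], by simp⟩
  · rintro j s' hj ⟨h1, h2, h3, h4⟩
    refine (RamProg.runs_setArr ?_).mono (by simp [RamExpr.cost]) fun _ h => h
    refine ⟨by simp [h1], (h2.setArr (by simp) _ _).setReg (by simp) _, by simp [h3],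
      fun i hi => ?_⟩
    simp only [setReg_arr, setArr_arr, if_true, RamExpr.eval, h1, Function.update_apply]
    split_ifs with h
    · rfl
    · exact h4 i (by omega)
  · rintro s₂ ⟨-, hf₂, h7, h6⟩
    have hs₂ : HasEdges G X L s₂ := hs₁.of_frame hf₂ (by simp) (by simp)
    have hp₂ : s₂.reg 3 = m ^ m := (hf₂.1 3 (by simp)).trans hp₁
    refine RamProg.runs_seq (RamProg.runs_forLoop (n := m ^ m) (fun w s' => s'.reg 6 = w ∧
      Frame [6, 7, 8, 9, 10, 11, 12, 13, 14] [5, 6] s₂ s' ∧ (∀ i < m, s'.arr 6 i = w / m ^ i % m) ∧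
      s'.reg 7 = if ∃ w' < w, ∀ u v,
        walkCount (selectEdges L (fun i => w' / m ^ i % m) m) u v ≤ 1 then 1 else 0) ?_ ?_ ?_ ?_)
    · rintro w s' ⟨h1, h2, -⟩
      exact ⟨h1, (h2.1 3 (by simp)).trans hp₂⟩
    · exact ⟨by simp, (Frame.refl _ _ s₂).setReg (by simp) _, fun i hi => by simp [h6 i hi],
        by simp [h7]⟩
    · rintro w s' hw ⟨h1, h2, h3, h4⟩
      have hs' : HasEdges G X L s' := hs₂.of_frame h2 (by simp) (by simp)
      refine RamProg.runs_seq ((runs_checkProg hs' hL (f := fun i => w / m ^ i % m)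
        fun i hi => ⟨h3 i hi, Nat.mod_lt _ (by omega)⟩).mono le_rfl ?_)
      rintro s₃ ⟨hf₃, h11⟩
      have hf₃' : Frame [6, 7, 8, 9, 10, 11, 12, 13, 14] [5, 6] s₂ s₃ :=
        h2.trans' hf₃ (by simp) (by simp)
      have h7' : s₃.reg 7 = s'.reg 7 := hf₃.1 7 (by simp)
      have h6' : s₃.reg 6 = w := (hf₃.1 6 (by simp)).trans h1
      have hd₃ : ∀ i < m, s₃.arr 6 i = w / m ^ i % m := by
        intro i hi
        rw [hf₃.2 6 (by simp)]
        exact h3 i hi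
      have key : ∀ s₄ : RamState, Frame [7] [] s₃ s₄ → (s₄.reg 7 = if ∃ w' < w + 1, ∀ u v,
          walkCount (selectEdges L (fun i => w' / m ^ i % m) m) u v ≤ 1 then 1 else 0) →
          incrementProg.Runs s₄ (2 + (m * (18 + 8) + 6)) fun s' =>
            (s'.setReg 6 (s'.reg 6 + 1)).reg 6 = w + 1 ∧
            Frame [6, 7, 8, 9, 10, 11, 12, 13, 14] [5, 6] s₂ (s'.setReg 6 (s'.reg 6 + 1)) ∧
            (∀ i < m, (s'.setReg 6 (s'.reg 6 + 1)).arr 6 i = (w + 1) / m ^ i % m) ∧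
            (s'.setReg 6 (s'.reg 6 + 1)).reg 7 = if ∃ w' < w + 1, ∀ u v,
              walkCount (selectEdges L (fun i => w' / m ^ i % m) m) u v ≤ 1 then 1 else 0 := by
        intro s₄ hf₄ h7₄
        have hf₄' := hf₃'.trans' hf₄ (by simp) (by simp)
        refine (runs_incrementProg (m := m) (w := w) ((hf₄'.1 2 (by simp)).trans hs₂.length)
          fun i hi => ?_).mono le_rfl ?_
        · rw [hf₄.2 6 (by simp)]; exact hd₃ i hi
        · rintro s₅ ⟨hf₅, hd₅⟩
          refine ⟨?_, (hf₄'.trans' hf₅ (by simp) (by simp)).setReg (by simp) _, hd₅, ?_⟩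
          · simp [hf₅.1 6 (by simp), hf₄.1 6 (by simp), h6']
          · simp [hf₅.1 7 (by simp), h7₄]
      have hex : (∃ w' < w + 1, ∀ u v,
          walkCount (selectEdges L (fun i => w' / m ^ i % m) m) u v ≤ 1) ↔ s₃.reg 11 ≠ 0 ∨
          ∃ w' < w, ∀ u v, walkCount (selectEdges L (fun i => w' / m ^ i % m) m) u v ≤ 1 := by
        rw [h11]
        constructor
        · rintro ⟨w', hw', h⟩
          rcases Nat.lt_succ_iff_lt_or_eq.mp hw' with hw' | rfl
          · exact .inr ⟨w', hw', h⟩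
          · exact .inl h
        · rintro (h | ⟨w', hw', h⟩)
          · exact ⟨w, Nat.lt_succ_self w, h⟩
          · exact ⟨w', by omega, h⟩
      refine RamProg.runs_seq ((RamProg.runs_ite (T := 2) ?_ ?_).mono (by simp [RamExpr.cost])
        fun _ h => h)
      · intro h
        simp only [RamExpr.eval] at h
        refine (RamProg.runs_setReg (key _ ((Frame.refl _ _ _).setReg (by simp) _) ?_)).mono le_rfl
          fun _ h => h
        rw [if_pos (hex.mpr (.inl h))]
        simp [RamExpr.eval]
      · intro h
        simp only [RamExpr.eval] at h
        refine (RamProg.runs_skip (key _ (Frame.refl _ _ _) ?_)).mono (by omega) fun _ h => h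
        rw [h7', h4]
        simp only [hex, h]
        simp
    · rintro s' ⟨-, -, -, h4⟩
      refine (RamProg.runs_setReg ?_).mono le_rfl fun _ h => h
      simpa [RamExpr.eval] using h4

end Search

/-! ### The search decides whether the kernel is good -/

section Words

variable {n : ℕ} {G : SimpleGraph (Fin n)}

/-- A repeated edge gives two walks from one end to itself: the trivial one, and forth and back. -/
theorem nodup_of_walkCount_le_one {l : List (Fin n × Fin n)} (h : ∀ u v, walkCount l u v ≤ 1) :
    l.Nodup := by
  rw [List.nodup_iff_sublist]
  intro e he
  have h1 := walkCount_mono he e.1 e.1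
  have h2 := h e.1 e.1
  have h3 : 2 ≤ walkCount [e, e] e.1 e.1 := by
    rw [walkCount_cons_apply, walkCount_cons_apply, walkCount_cons_apply]
    by_cases he : e.1 = e.2
    · simp [← he]
    · simp [he, Ne.symm he]
  omega

theorem length_selectEdges {L : List (Fin n × Fin n)} {f : ℕ → ℕ} {j : ℕ}
    (h : ∀ i < j, f i < L.length) : (selectEdges L f j).length = j := by
  induction j with
  | zero => simp [selectEdges]
  | succ j ih =>
    rw [selectEdges_succ (h j (Nat.lt_succ_self j)), List.length_append,
      ih fun i hi => h i (by omega), List.length_singleton]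

theorem selectEdges_subset (L : List (Fin n × Fin n)) (f : ℕ → ℕ) (j : ℕ) :
    selectEdges L f j ⊆ L := by
  intro e he
  obtain ⟨i, -, hi⟩ := List.mem_filterMap.mp he
  exact List.mem_of_getElem? hi

/-- Directs an edge from its smaller end to its larger one. -/
def orientEdge (e : Fin n × Fin n) : Fin n × Fin n := if e.1 < e.2 then e else e.swap

theorem walkCount_map_orientEdge (l : List (Fin n × Fin n)) :
    walkCount (l.map orientEdge) = walkCount l := by
  have : ∀ e : Fin n × Fin n, edgeMatrix (orientEdge e) = edgeMatrix e := by
    intro e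
    unfold orientEdge
    split_ifs
    · rfl
    · simp only [edgeMatrix, Prod.fst_swap, Prod.snd_swap]
      exact add_right_comm _ _ _
  simp only [walkCount, List.map_map]
  congr 1
  exact List.map_congr_left fun e _ => this e

/-- The search succeeds if and only if there is a good order: a sequence of `m` out of `m` edges
without repetitions contains all of them, and the good orders are found among the sequences by
taking the indices of the edges as the digits of `w`. -/
theorem exists_word_iff {K : Fin n → Prop} {L : List (Fin n × Fin n)} (hnd : L.Nodup)
    (hL : ∀ e, e ∈ L ↔ e.1 < e.2 ∧ G.Adj e.1 e.2 ∧ K e.1 ∧ K e.2) :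
    (∃ w < L.length ^ L.length, ∀ u v,
      walkCount (selectEdges L (fun i => w / L.length ^ i % L.length) L.length) u v ≤ 1) ↔
    ∃ l, IsGoodOrder G {v | K v} l := by
  constructor
  · rintro ⟨w, -, hw⟩
    set l := selectEdges L (fun i => w / L.length ^ i % L.length) L.length with hl
    have hsub : l ⊆ L := selectEdges_subset _ _ _
    -- Without repetitions, all edges are selected.
    have hperm : l.Perm L := (List.subperm_of_subset (nodup_of_walkCount_le_one hw)
      hsub).perm_of_length_le (by
        rw [hl, length_selectEdges fun i hi => Nat.mod_lt _ (by omega)])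
    refine ⟨l, fun e he => ((hL e).mp (hsub he)).2.1, fun e he => ((hL e).mp (hsub he)).2.2,
      fun a ha b hb hab => ?_, hw⟩
    rcases lt_or_gt_of_ne hab.ne with h | h
    · exact .inl (hperm.mem_iff.mpr ((hL (a, b)).mpr ⟨h, hab, ha, hb⟩))
    · exact .inr (hperm.mem_iff.mpr ((hL (b, a)).mpr ⟨h, hab.symm, hb, ha⟩))
  · rintro ⟨l, hl⟩
    set l' := l.map orientEdge with hl'
    have hcount : ∀ u v, walkCount l' u v ≤ 1 := by
      rw [hl', walkCount_map_orientEdge]; exact hl.count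
    have hmem : ∀ e, e ∈ l' ↔ e ∈ L := by
      rintro ⟨a, b⟩
      rw [hL, hl', List.mem_map]
      constructor
      · rintro ⟨⟨c, d⟩, he, heq⟩
        have h1 := hl.adj _ he
        have h2 := hl.mem _ he
        unfold orientEdge at heq
        simp only [Set.mem_ofPred_eq] at h1 h2 heq
        split_ifs at heq with hcd
        · obtain ⟨rfl, rfl⟩ := Prod.mk.inj heq
          exact ⟨hcd, h1, h2⟩
        · obtain ⟨rfl, rfl⟩ := Prod.mk.inj heq
          exact ⟨lt_of_le_of_ne (not_lt.mp hcd) h1.ne', h1.symm, h2.2, h2.1⟩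
      · rintro ⟨hab, hadj, ha, hb⟩
        simp only at hab hadj ha hb
        rcases hl.complete a ha b hb hadj with h | h
        · exact ⟨_, h, by simp [orientEdge, hab]⟩
        · exact ⟨_, h, by simp [orientEdge, hab.le.not_gt]⟩
    have hperm : l'.Perm L :=
      (List.perm_ext_iff_of_nodup (nodup_of_walkCount_le_one hcount) hnd).mpr hmem
    have hlen : l'.length = L.length := hperm.length_eq
    -- The digits of the word: the indices in `L` of the entries of the good order.
    let f : Fin L.length → Fin L.length := fun i =>
      ⟨L.idxOf (l'[i.1]'(by omega)), List.idxOf_lt_length_iff.mpr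
        ((hmem _).mp (List.getElem_mem _))⟩
    refine ⟨finFunctionFinEquiv f, (finFunctionFinEquiv f).2, ?_⟩
    have hdigit : ∀ i (hi : i < L.length), (finFunctionFinEquiv f : ℕ) / L.length ^ i % L.length =
        L.idxOf (l'[i]'(by omega)) := fun i hi =>
      congrArg Fin.val (congrFun (finFunctionFinEquiv.symm_apply_apply f) ⟨i, hi⟩)
    have htake : ∀ j ≤ L.length, selectEdges L
        (fun i => (finFunctionFinEquiv f : ℕ) / L.length ^ i % L.length) j = l'.take j := by
      intro j
      induction j with
      | zero => simp [selectEdges]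
      | succ j ih =>
        intro hj
        have hfj : (fun i => (finFunctionFinEquiv f : ℕ) / L.length ^ i % L.length) j < L.length :=
          Nat.mod_lt _ (by omega)
        rw [selectEdges_succ
          (f := fun i => (finFunctionFinEquiv f : ℕ) / L.length ^ i % L.length) hfj, ih (by omega),
          List.take_succ_eq_append_getElem (by omega)]
        simp only [hdigit j hj, List.getElem_idxOf]
    rw [htake _ le_rfl, ← hlen, List.take_length]
    exact hcount

end Words

/-! ### The running time -/

/-- For `m = O(k ^ 3)` edges, there are `m ^ m = 2 ^ O(k ^ 3 * log k)` sequences. For `k ≥ 2` this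
follows from `53 ≤ 2 ^ 6 ≤ k ^ 6`, so that `m ≤ k ^ 9`; for `k = 1`, where the logarithm is zero,
the constant `53 ^ 53` takes care of it. -/
theorem pow_self_le_two_rpow : ∃ c : ℕ, ∀ k m : ℕ, m ≤ 53 * k ^ 3 →
    ((m ^ m : ℕ) : ℝ) ≤ c * (2 : ℝ) ^ ((c : ℝ) * (k : ℝ) ^ 4 * Real.logb 2 (k : ℝ)) := by
  obtain ⟨D, hD⟩ : ∃ D : ℕ, D = 53 ^ 53 := ⟨_, rfl⟩
  refine ⟨D + 477, fun k m hm => ?_⟩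
  rcases (by omega : k = 0 ∨ k = 1 ∨ 2 ≤ k) with rfl | rfl | hk
  · obtain rfl : m = 0 := by simpa using hm
    simp
    have : (0 : ℝ) ≤ D := Nat.cast_nonneg D
    linarith
  · have h1 : m ^ m ≤ D := by
      rw [hD]
      exact (Nat.pow_le_pow_left (by omega) m).trans (Nat.pow_le_pow_right (by norm_num) (by omega))
    have h2 : ((m ^ m : ℕ) : ℝ) ≤ D := Nat.cast_le.mpr h1
    simp only [Nat.cast_one, Real.logb_one, mul_zero, Real.rpow_zero, mul_one, Nat.cast_add]
    exact h2.trans (le_add_of_nonneg_right (Nat.cast_nonneg _))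
  · have hk0 : 0 < k := by omega
    have h1 : 53 * k ^ 3 ≤ k ^ 9 := by
      have : 2 ^ 6 ≤ k ^ 6 := Nat.pow_le_pow_left hk 6
      calc 53 * k ^ 3 ≤ k ^ 6 * k ^ 3 := Nat.mul_le_mul_right _ (by omega)
        _ = k ^ 9 := by ring
    have h2 : m ^ m ≤ k ^ (477 * k ^ 3) := by
      calc m ^ m ≤ (k ^ 9) ^ m := Nat.pow_le_pow_left (hm.trans h1) m
        _ ≤ (k ^ 9) ^ (53 * k ^ 3) := Nat.pow_le_pow_right (by positivity) hm
        _ = k ^ (477 * k ^ 3) := by rw [← pow_mul]; congr 1; ring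
    have hkr : (0 : ℝ) < k := Nat.cast_pos.mpr hk0
    have h3 : (k : ℝ) = (2 : ℝ) ^ Real.logb 2 (k : ℝ) :=
      (Real.rpow_logb (by norm_num) (by norm_num) hkr).symm
    have hlog : 0 ≤ Real.logb 2 (k : ℝ) :=
      Real.logb_nonneg (by norm_num) (by exact_mod_cast hk0)
    have h4 : ((k ^ (477 * k ^ 3) : ℕ) : ℝ) =
        (2 : ℝ) ^ (Real.logb 2 (k : ℝ) * ((477 * k ^ 3 : ℕ) : ℝ)) := by
      rw [Real.rpow_mul (by norm_num), ← h3, Real.rpow_natCast, Nat.cast_pow]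
    have h5 : (k : ℝ) ^ 3 ≤ (k : ℝ) ^ 4 :=
      pow_le_pow_right₀ (by exact_mod_cast hk0) (by norm_num)
    have hD0 : (0 : ℝ) ≤ D := Nat.cast_nonneg D
    calc ((m ^ m : ℕ) : ℝ) ≤ ((k ^ (477 * k ^ 3) : ℕ) : ℝ) := Nat.cast_le.mpr h2
      _ = (2 : ℝ) ^ (Real.logb 2 (k : ℝ) * ((477 * k ^ 3 : ℕ) : ℝ)) := h4
      _ ≤ (2 : ℝ) ^ (((D + 477 : ℕ) : ℝ) * (k : ℝ) ^ 4 * Real.logb 2 (k : ℝ)) := by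
          refine Real.rpow_le_rpow_of_exponent_le (by norm_num) ?_
          rw [mul_comm (Real.logb 2 (k : ℝ))]
          refine mul_le_mul_of_nonneg_right ?_ hlog
          push_cast
          refine mul_le_mul (by linarith) h5 (by positivity) (by positivity)
      _ ≤ _ := by
          refine le_mul_of_one_le_left (by positivity) ?_
          push_cast
          linarith

/-- The polynomial factor of the running time of `searchProg`, for at most `n * n` edges. -/
def searchFactor (n : ℕ) : ℕ :=
  2 + (n * n * (2 + (n * n * (4 + 8) + 6 + 2) + 8) + 6) + (2 + (n * n * (3 + 8) + 6)) +
    (checkTime n (n * n) + (4 + (2 + (n * n * (18 + 8) + 6))) + 8) + 8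

theorem searchTime_le {n m : ℕ} (h : m ≤ n * n) : searchTime n m ≤ m ^ m * searchFactor n := by
  have hpos : 1 ≤ m ^ m := Nat.pos_of_ne_zero (by
    rcases Nat.eq_zero_or_pos m with rfl | h
    · simp
    · positivity)
  have h1 : 2 + (m * (2 + (m * (4 + 8) + 6 + 2) + 8) + 6) + (2 + (m * (3 + 8) + 6)) + 8 ≤
      2 + (n * n * (2 + (n * n * (4 + 8) + 6 + 2) + 8) + 6) + (2 + (n * n * (3 + 8) + 6)) + 8 := by
    gcongr
  have h2 : checkTime n m + (4 + (2 + (m * (18 + 8) + 6))) + 8 ≤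
      checkTime n (n * n) + (4 + (2 + (n * n * (18 + 8) + 6))) + 8 := by
    unfold checkTime
    gcongr
  have h3 := Nat.mul_le_mul hpos h1
  have h4 := Nat.mul_le_mul_left (m ^ m) h2
  have h5 : m ^ m * searchFactor n =
      m ^ m * (2 + (n * n * (2 + (n * n * (4 + 8) + 6 + 2) + 8) + 6) +
        (2 + (n * n * (3 + 8) + 6)) + 8) +
      m ^ m * (checkTime n (n * n) + (4 + (2 + (n * n * (18 + 8) + 6))) + 8) := by
    unfold searchFactor; ring
  rw [h5]
  unfold searchTime
  omega

theorem polyBounded_searchFactor : PolyBounded searchFactor := by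
  have c := PolyBounded.const
  have i := PolyBounded.id
  have s := i.mul i
  have hc : PolyBounded fun n => checkTime n (n * n) := by
    unfold checkTime
    exact ((i.mul (((i.mul (c _)).add (c _)).add (c _))).add (c _)).add
      (((s.mul (((c _).add ((c _).add ((i.mul (c _)).add (c _)))).add (c _))).add (c _)).add
        ((c _).add ((i.mul (((i.mul (c _)).add (c _)).add (c _))).add (c _))))
  unfold searchFactor
  exact (((((c _).add ((s.mul (((c _).add (((s.mul (c _)).add (c _)).add (c _))).add (c _))).add
    (c _))).add ((c _).add ((s.mul (c _)).add (c _)))).add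
    ((hc.add ((c _).add ((c _).add ((s.mul (c _)).add (c _))))).add (c _))).add (c _))

/-- The decision procedure: it rejects graphs with a triangle or a `K_{2,3}`, and otherwise
searches for a good order of the edges of the kernel. -/
def decideProg : RamProg :=
  .seq rowsProg (.seq (Fml.fewCommon.compile 0) (.ite (.reg 1)
    (.seq (edgesProg Fml.kernelEdge) searchProg) (.setReg 0 (.const 0))))

/-- The polynomial factor of the running time of `decideProg`, term by term the bounds for its
parts. -/
def decideFactor (n : ℕ) : ℕ :=
  n * (8 + 8) + 6 + (Fml.fewCommon.time n + (2 +
    (2 + (n * (n * (Fml.kernelEdge.time n + 12 + 8) + 6 + 8) + 6) + searchFactor n)))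

theorem polyBounded_decideFactor : PolyBounded decideFactor := by
  have c := PolyBounded.const
  have i := PolyBounded.id
  unfold decideFactor
  exact ((i.mul (c _)).add (c _)).add ((Fml.polyBounded_time _).add ((c _).add
    (((c _).add ((i.mul (((i.mul (((Fml.polyBounded_time _).add (c _)).add (c _))).add (c _)).add
      (c _))).add (c _))).add polyBounded_searchFactor)))

/-- The number `m` is the number of edges of the kernel; it is set to zero if the graph is rejected
at once. -/
theorem runs_decideProg {n : ℕ} {G : SimpleGraph (Fin n)} {X : Finset (Fin n)}
    (hX : IsStarForestModulator G X) : ∃ m ≤ 53 * X.card ^ 3,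
      decideProg.Runs (graphInput G X) (m ^ m * decideFactor n) fun s =>
        (IsGoodGraph G → s.reg 0 = 1) ∧ (¬ IsGoodGraph G → s.reg 0 = 0) := by
  classical
  obtain ⟨ctr, hctr⟩ := hX.exists_isStarCenter
  let R : Fin n → Fin n → Prop := fun a b => a < b ∧ G.Adj a b ∧ InKernel G X a ∧ InKernel G X b
  by_cases hf : FewCommonNeighbors G
  · let m := (Finset.univ.filter fun e : Fin n × Fin n => R e.1 e.2).card
    have hm : m ≤ 53 * X.card ^ 3 := hctr.card_kernel_edges_le hf fun e he =>
      (Finset.mem_filter.mp he).2.2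
    have hmn : m ≤ n * n := by
      refine (Finset.card_le_univ _).trans ?_
      simp
    have hpos : 1 ≤ m ^ m := Nat.pos_of_ne_zero (by
      rcases Nat.eq_zero_or_pos m with h | h
      · simp [h]
      · positivity)
    refine ⟨m, hm, ?_⟩
    have htime : n * (8 + 8) + 6 + (Fml.fewCommon.time n + (2 +
        (2 + (n * (n * (Fml.kernelEdge.time n + 12 + 8) + 6 + 8) + 6) + searchTime n m))) ≤
        m ^ m * decideFactor n := by
      have h1 := searchTime_le hmn
      have h2 := Nat.mul_le_mul_right (n * (8 + 8) + 6 + (Fml.fewCommon.time n + (2 +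
        (2 + (n * (n * (Fml.kernelEdge.time n + 12 + 8) + 6 + 8) + 6))))) hpos
      have h3 : m ^ m * decideFactor n = m ^ m * (n * (8 + 8) + 6 + (Fml.fewCommon.time n + (2 +
        (2 + (n * (n * (Fml.kernelEdge.time n + 12 + 8) + 6 + 8) + 6))))) +
        m ^ m * searchFactor n := by
        unfold decideFactor; ring
      omega
    refine RamProg.Runs.mono ?_ htime fun _ h => h
    refine RamProg.runs_seq (runs_rowsProg.mono le_rfl fun s hs => ?_)
    refine RamProg.runs_seq ((Fml.fewCommon.runs_compile (env := fun _ => 0) hs Fml.wf_fewCommon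
      (by simp)).mono le_rfl ?_)
    rintro s₁ ⟨h1, h2, h3⟩
    rw [Fml.holds_fewCommon] at h1
    have hs₁ : IsInput G X s₁ := hs.congr (h3 0 (by omega) (by omega)) (by rw [h2]) (by rw [h2])
      (by rw [h2])
    refine (RamProg.runs_ite (e := .reg 1) (s := s₁) (T := 2 +
      (n * (n * (Fml.kernelEdge.time n + 12 + 8) + 6 + 8) + 6) + searchTime n m) ?_
      fun h => absurd h (h1.mpr hf)).mono (by simp only [RamExpr.cost]; omega) fun _ h => h
    intro _
    refine RamProg.runs_seq ((runs_edgesProg Fml.wf_kernelEdge (R := R)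
      (fun env a b ha hb => Fml.holds_kernelEdge ha hb) hs₁).mono le_rfl ?_)
    rintro s₂ ⟨L, hL, hnd, hmem⟩
    have hlen : L.length = m := by
      rw [← List.toFinset_card_of_nodup hnd]
      congr 1
      ext e
      simp [hmem]
    have hgood : IsGoodGraph G ↔ ∃ l, IsGoodOrder G {v | InKernel G X v} l := by
      rw [isGoodGraph_iff_exists_isGoodOrder]
      constructor
      · rintro ⟨l, hl⟩
        exact ⟨_, hl.restrict (Set.subset_univ _)⟩
      · rintro ⟨l, hl⟩
        exact hctr.exists_isGoodOrder_of_kernel hf hl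
    rw [← hlen]
    refine (runs_searchProg hL fun e he => ((hmem e).mp he).1.ne).mono le_rfl fun s₃ hs₃ => ?_
    rw [hgood, ← exists_word_iff hnd hmem]
    refine ⟨fun h => by rw [hs₃, if_pos h], fun h => by rw [hs₃, if_neg h]⟩
  · refine ⟨0, Nat.zero_le _, ?_⟩
    have htime : n * (8 + 8) + 6 + (Fml.fewCommon.time n + 4) ≤ 0 ^ 0 * decideFactor n := by
      unfold decideFactor; omega
    refine RamProg.Runs.mono ?_ htime fun _ h => h
    refine RamProg.runs_seq (runs_rowsProg.mono le_rfl fun s hs => ?_)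
    refine RamProg.runs_seq ((Fml.fewCommon.runs_compile (env := fun _ => 0) hs Fml.wf_fewCommon
      (by simp)).mono le_rfl ?_)
    rintro s₁ ⟨h1, -, -⟩
    rw [Fml.holds_fewCommon] at h1
    refine (RamProg.runs_ite (e := .reg 1) (s := s₁) (T := 2)
      (fun h => absurd (h1.mp h) hf) fun _ =>
      (RamProg.runs_setReg ?_).mono le_rfl fun _ h => h).mono (by simp [RamExpr.cost]) fun _ h => h
    exact ⟨fun h => absurd h.fewCommonNeighbors hf, fun _ => by simp [RamExpr.eval]⟩

/-- Good Edge-Labeling can be solved in time `2 ^ O(k ^ 4 * log k) * n ^ O(1)` on graphs with `n`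
vertices that are given with a star-forest modulator of size `k`: one program answers in register
`0`, by `1` (yes) or `0` (no). -/
theorem mainTheorem1 :
    ∃ (P : RamProg) (c : ℕ), ∀ (n : ℕ) (G : SimpleGraph (Fin n)) (X : Finset (Fin n)),
      IsStarForestModulator G X →
        ∃ (t : ℕ) (s : RamState), P.Exec (graphInput G X) t s ∧
          (IsGoodGraph G → s.reg 0 = 1) ∧ (¬ IsGoodGraph G → s.reg 0 = 0) ∧
          (t : ℝ) ≤ c * (2 : ℝ) ^ ((c : ℝ) * (X.card : ℝ) ^ 4 * Real.logb 2 (X.card : ℝ)) *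
            ((n : ℝ) + 1) ^ c := by
  obtain ⟨a, ha⟩ := polyBounded_decideFactor
  obtain ⟨b, hb⟩ := pow_self_le_two_rpow
  refine ⟨decideProg, a * b + a + b, fun n G X hX => ?_⟩
  obtain ⟨m, hm, t, s, he, ht, hgood, hbad⟩ := runs_decideProg hX
  refine ⟨t, s, he, hgood, hbad, ?_⟩
  have hlog : 0 ≤ Real.logb 2 (X.card : ℝ) := by
    rcases Nat.eq_zero_or_pos X.card with h | h
    · simp [h]
    · exact Real.logb_nonneg (by norm_num) (by exact_mod_cast h)
  have hn : (1 : ℝ) ≤ (n : ℝ) + 1 := le_add_of_nonneg_left (Nat.cast_nonneg n)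
  have h1 : (decideFactor n : ℝ) ≤ a * ((n : ℝ) + 1) ^ a := by exact_mod_cast ha n
  have hb' : (b : ℝ) ≤ ((a * b + a + b : ℕ) : ℝ) := Nat.cast_le.mpr (by omega)
  calc (t : ℝ) ≤ ((m ^ m * decideFactor n : ℕ) : ℝ) := Nat.cast_le.mpr ht
    _ = ((m ^ m : ℕ) : ℝ) * (decideFactor n : ℝ) := Nat.cast_mul _ _
    _ ≤ (b * (2 : ℝ) ^ ((b : ℝ) * (X.card : ℝ) ^ 4 * Real.logb 2 (X.card : ℝ))) *
        (a * ((n : ℝ) + 1) ^ a) := mul_le_mul (hb _ m hm) h1 (by positivity) (by positivity)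
    _ = (a * b : ℕ) * (2 : ℝ) ^ ((b : ℝ) * (X.card : ℝ) ^ 4 * Real.logb 2 (X.card : ℝ)) *
        ((n : ℝ) + 1) ^ a := by push_cast; ring
    _ ≤ _ := by
        gcongr
        · exact_mod_cast (by omega : a * b ≤ a * b + a + b)
        · norm_num
        · omega
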